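/- For a bounded operator $A$ on a Hilbert space that is compact and positive, let its eigenvalues be listed in non-increasing order with multiplicities taken into account; for $q>0$ let $\mathbf S_q$ denote the Schatten class of compact operators $A$ whose singular values satisfy $\sum_{k} s_k(A)^q<\infty$. Let $\sigma,\tau$ be real numbers, put $\rho=\tau-2\sigma$, and assume $$\rho>0,\qquad \tau+\rho>1,\qquad \tau>0 .$$ Let $\mathbb N=\{1,2,3,\dots\}$, let $[n,m]$ denote the least common multiple, and let $E(\sigma,\tau)$ be the operator on $\ell^2(\mathbb N)$ with the matrix $$E(\sigma,\tau)=\Bigl\{\frac{n^\sigma m^\sigma}{[n,m]^\tau}\Bigr\}_{n,m=1}^\infty .$$ For each prime $p$ let $E_p(\sigma,\tau)$ be the operator on $\ell^2(\{0,1,2,\dots\})$ with the matrix $\{p^{\sigma j}p^{-\tau\max(j,k)}p^{\sigma k}\}_{j,k=0}^\infty$. Then $E(\sigma,\tau)$ is a well-defined bounded operator; it is compact, positive definite and has a trivial kernel. Each $E_p(\sigma,\tau)$ is compact and positive, with eigenvalues $\lambda_0(E_p)\ge\lambda_1(E_p)\ge\cdots$, and the series and the product in $$\varkappa(\sigma,\tau)=\Bigl(\prod_{p\text{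 prime}}\Bigl(1-\frac1p\Bigr)\sum_{k=0}^\infty\lambda_k\bigl(E_p(\sigma,\tau)\bigr)^{1/\rho}\Bigr)^{\rho}$$ converge, with $\varkappa(\sigma,\tau)>0$. If $\lambda_1\ge\lambda_2\ge\cdots$ are the eigenvalues of $E(\sigma,\tau)$ in non-increasing order, with multiplicities, then $$\lambda_n=\frac{\varkappa(\sigma,\tau)}{n^{\rho}}+o(n^{-\rho}),\qquad n\to\infty .$$ In particular, for $q>0$, $E(\sigma,\tau)\in\mathbf S_q$ if and only if $q\rho>1$. -/

import Mathlib

open Filter Asymptotics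

/-- The complex Hilbert space `ℓ²(ι)`. -/
abbrev EllTwo (ι : Type) : Type := lp (fun _ : ι => ℂ) 2

/-- The bounded operator `T` on `ℓ²(ι)` is given by the infinite real matrix `A`:
`(T x)_n = ∑_m A_{nm} x_m` for every `x ∈ ℓ²(ι)` and every `n`, with convergent series. -/
def IsMatrixOperator {ι : Type} (A : ι → ι → ℝ) (T : EllTwo ι →L[ℂ] EllTwo ι) : Prop :=
  ∀ (x : EllTwo ι) (n : ι), HasSum (fun m => (A n m : ℂ) * x m) (T x n)

theorem IsMatrixOperator.unique {ι : Type} {A : ι → ι → ℝ} {T T' : EllTwo ι →L[ℂ] EllTwo ι}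
    (h : IsMatrixOperator A T) (h' : IsMatrixOperator A T') : T = T' := by
  ext x n
  exact (h x n).unique (h' x n)

open Classical in
/-- The bounded operator on `ℓ²(ι)` given by the matrix `A` (it is unique; the value is `0` if the
matrix does not define a bounded operator on all of `ℓ²(ι)`). -/
noncomputable def matrixOperator {ι : Type} (A : ι → ι → ℝ) : EllTwo ι →L[ℂ] EllTwo ι :=
  if h : ∃ T, IsMatrixOperator A T then h.choose else 0

/-- `ev 0 ≥ ev 1 ≥ …` is the sequence of eigenvalues of `T`, in non-increasing order and with
multiplicities taken into account. This is meant for compact positive operators: all the values are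
non-negative and every complex number `z ≠ 0` occurs exactly `dim ker (T - z)` times. As usual for
compact operators, the value `0` serves only to continue the sequence if there are finitely many
non-zero eigenvalues. -/
def IsEigenvalueSeq {H : Type} [NormedAddCommGroup H] [InnerProductSpace ℂ H]
    (T : H →L[ℂ] H) (ev : ℕ → ℝ) : Prop :=
  Antitone ev ∧ (∀ n, 0 ≤ ev n) ∧
    ∀ z : ℂ, z ≠ 0 → {n : ℕ | (ev n : ℂ) = z}.encard =
      Cardinal.toENat (Module.rank ℂ (Module.End.eigenspace (T : H →ₗ[ℂ] H) z))

theorem IsEigenvalueSeq.unique {H : Type} [NormedAddCommGroup H] [InnerProductSpace ℂ H]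
    {T : H →L[ℂ] H} {a b : ℕ → ℝ} (ha : IsEigenvalueSeq T a) (hb : IsEigenvalueSeq T b) :
    a = b := by
  have key : ∀ {a b : ℕ → ℝ}, IsEigenvalueSeq T a → IsEigenvalueSeq T b → ∀ n,
      (∀ m < n, a m = b m) → ¬ a n < b n := by
    intro a b ha hb n hm hlt
    have hz : ((b n : ℝ) : ℂ) ≠ 0 := by
      exact_mod_cast (lt_of_le_of_lt (ha.2.1 n) hlt).ne'
    have hc := (ha.2.2 _ hz).trans (hb.2.2 _ hz).symm
    have hA : ∀ k, (a k : ℂ) = (b n : ℂ) → k < n := by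
      intro k hk
      by_contra hkn
      have h1 := ha.1 (not_lt.mp hkn)
      have h2 : a k = b n := by exact_mod_cast hk
      linarith
    have hfin : {k : ℕ | (a k : ℂ) = (b n : ℂ)}.Finite :=
      (Set.finite_lt_nat n).subset fun k hk => hA k hk
    have hss : {k : ℕ | (a k : ℂ) = (b n : ℂ)} ⊂ {k : ℕ | (b k : ℂ) = (b n : ℂ)} := by
      refine ⟨fun k hk => ?_, fun h => ?_⟩
      · have := hm k (hA k hk)
        simpa [← this] using hk
      · have h3 : (a n : ℂ) = (b n : ℂ) := h rfl
        exact absurd (hA n h3) (lt_irrefl n)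
    exact (hfin.encard_lt_encard hss).ne hc
  funext n
  induction n using Nat.strong_induction_on with
  | _ n ih =>
    exact le_antisymm (not_lt.mp (key hb ha n fun m h => (ih m h).symm))
      (not_lt.mp (key ha hb n ih))

open Classical in
/-- The sequence of eigenvalues of `T` in non-increasing order, with multiplicities (it is unique;
the value is the zero sequence if the eigenvalues of `T` cannot be so listed). -/
noncomputable def eigenvalueSeq {H : Type} [NormedAddCommGroup H] [InnerProductSpace ℂ H]
    (T : H →L[ℂ] H) : ℕ → ℝ :=
  if h : ∃ ev, IsEigenvalueSeq T ev then h.choose else 0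

/-- `s 0 ≥ s 1 ≥ …` is the sequence of singular values of `T`: the non-negative square roots of the
eigenvalues of `T* T`. -/
def IsSingularValueSeq {H : Type} [NormedAddCommGroup H] [InnerProductSpace ℂ H] [CompleteSpace H]
    (T : H →L[ℂ] H) (s : ℕ → ℝ) : Prop :=
  (∀ k, 0 ≤ s k) ∧ IsEigenvalueSeq (ContinuousLinearMap.adjoint T ∘L T) (fun k => s k ^ 2)

/-- The Schatten class `S_q`, `q > 0`: the compact operators `T` with `∑_k s_k(T)^q < ∞`. -/
def InSchattenClass {H : Type} [NormedAddCommGroup H] [InnerProductSpace ℂ H] [CompleteSpace H]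
    (q : ℝ) (T : H →L[ℂ] H) : Prop :=
  IsCompactOperator T ∧ ∃ s : ℕ → ℝ, IsSingularValueSeq T s ∧ Summable fun k => s k ^ q

/-- The matrix `E(σ,τ)` with entries `n^σ m^σ / [n,m]^τ`, where `n, m = 1, 2, 3, …`. -/
noncomputable def lcmMatrix (σ τ : ℝ) (n m : ℕ+) : ℝ :=
  (n : ℝ) ^ σ * (m : ℝ) ^ σ / ((Nat.lcm n m : ℕ) : ℝ) ^ τ

/-- The matrix `E_p(σ,τ)` with entries `p^{σ j} p^{-τ max(j,k)} p^{σ k}`, `j, k = 0, 1, 2, …`. -/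
noncomputable def localMatrix (σ τ : ℝ) (p : ℕ) (j k : ℕ) : ℝ :=
  (p : ℝ) ^ (σ * j) * (p : ℝ) ^ (-τ * (max j k : ℕ)) * (p : ℝ) ^ (σ * k)

/-- The operator `E(σ,τ)` on `ℓ²(ℕ)`. -/
noncomputable def lcmOperator (σ τ : ℝ) : EllTwo ℕ+ →L[ℂ] EllTwo ℕ+ :=
  matrixOperator (lcmMatrix σ τ)

/-- The operator `E_p(σ,τ)` on `ℓ²(ℤ₊)`. -/
noncomputable def localOperator (σ τ : ℝ) (p : ℕ) : EllTwo ℕ →L[ℂ] EllTwo ℕ :=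
  matrixOperator (localMatrix σ τ p)

/-- The Euler factor `(1 - 1/p) ∑_{k ≥ 0} λ_k(E_p(σ,τ))^{1/ρ}`, with `ρ = τ - 2σ`. -/
noncomputable def kappaFactor (σ τ : ℝ) (p : ℕ) : ℝ :=
  (1 - 1 / (p : ℝ)) * ∑' k : ℕ, eigenvalueSeq (localOperator σ τ p) k ^ (1 / (τ - 2 * σ))

/-- The constant `ϰ(σ,τ) = (∏_p (1 - 1/p) ∑_{k ≥ 0} λ_k(E_p(σ,τ))^{1/ρ})^ρ`, `ρ = τ - 2σ`, the
product being over all primes. -/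
noncomputable def kappa (σ τ : ℝ) : ℝ :=
  (∏' p : Nat.Primes, kappaFactor σ τ p) ^ (τ - 2 * σ)

/-!
The matrix factors over the primes: writing `n = ∏ p ^ j_p` and `m = ∏ p ^ k_p`, the entry of
`E(σ,τ)` is the product of the entries of the matrices `E_p(σ,τ)` with indices `j_p, k_p`. So
`E(σ,τ)` is an infinite tensor product, and its eigenvalues should be the products over `p` of
eigenvalues of the local operators, one for each family of indices with finite support, that is, one
for each positive integer.

*Local operators.* With `s = p ^ σ` and `w = p ^ (-τ)` the local matrix is `s^j * w^max(j,k) * s^k`.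
It is a norm-convergent sum of positive operators of rank one, hence compact and positive. Deleting
its first row and column multiplies it by `r = w * s^2 = p ^ (-ρ)`; by the min-max principle this
self-similarity gives `μ (k+1) ≤ r * μ k` for the eigenvalues, while `μ 0` and the entry `u 0 0` of
the first eigenvector differ from `1` by `O(w * r) = O(p ^ (-(τ+ρ)))`, which is summable over the
primes (`exists_local_data`).

*Tensor product.* These bounds make the products of entries of local eigenvectors converge, and a
distributive law for infinite products of series (`hasSum_finsupp_tprod`) turns the orthonormality
and the completeness of the local eigenvectors, and the expansion of the local matrices, into the
same statements for the products. This diagonalises `E(σ,τ)` (`exists_tensor_operator`).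

*Counting.* The eigenvalue attached to `n` is `L * (h n / n) ^ ρ`, where `L` is the product of the
`μ p 0` and `h` is multiplicative with `0 < h ≤ 1`, by `μ (k+1) ≤ r * μ k`. So the number of
eigenvalues above a level is the number of `n` with `n ≤ x * h n`. If `h` is nontrivial at finitely
many primes only, these `n` have the density `∏ (1 - 1/p) ∑ h(p^k)/p^k`, as one sees by adding the
primes one at a time. In general `h` is cut off at a finite set `S` of primes. The mean value of
`1 - h(p^k)`, where `p^k` is the exact power of `p` in `n`, is summable over `p`, because `μ 1 / μ 0` is
close to `r`; so by Markov's inequality the primes outside `S` change the weight noticeably for few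
`n` only (`tendsto_card_weighted`). Inverting the counting function (`tendsto_div_of_counting`) gives the
asymptotics of the eigenvalues, and the Schatten class criterion follows by comparison with
`∑ n ^ (-q * ρ)`.
-/

open scoped Topology ComplexConjugate

/-! ### Enumerating null families in decreasing order -/

/-- A positive family tending to `0` along the cofinite filter of an infinite index type can be
listed in non-increasing order. -/
theorem exists_equiv_nat_antitone {ι : Type*} [Infinite ι] {μ : ι → ℝ} (hpos : ∀ i, 0 < μ i)
    (hlim : Tendsto μ cofinite (𝓝 0)) : ∃ e : ℕ ≃ ι, Antitone (μ ∘ e) := by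
  classical
  have hfin : ∀ ε : ℝ, 0 < ε → {i | ε ≤ μ i}.Finite := by
    intro ε hε
    have := hlim.eventually_lt_const hε
    rw [eventually_cofinite] at this
    simpa using this
  have hcount : Countable ι := by
    have hU : (Set.univ : Set ι) = ⋃ n : ℕ, {i | 1 / ((n : ℝ) + 1) ≤ μ i} := by
      ext i
      simp only [Set.mem_univ, Set.mem_iUnion, true_iff]
      obtain ⟨n, hn⟩ := exists_nat_one_div_lt (hpos i)
      exact ⟨n, hn.le⟩
    rw [← Set.countable_univ_iff, hU]
    exact Set.countable_iUnion fun n => (hfin _ (by positivity)).countable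
  obtain ⟨enc, henc⟩ := hcount.exists_injective_nat
  -- `i` precedes `j` if `μ i` is larger, ties being broken by the injection into `ℕ`
  let key : ι → ℝ ×ₗ ℕ := fun i => toLex (-μ i, enc i)
  have hkey : Function.Injective key := by
    intro i j hij
    have : (-μ i, enc i) = (-μ j, enc j) := toLex.injective hij
    exact henc (Prod.ext_iff.mp this).2
  have hbelow : ∀ i, {j | key j < key i}.Finite := by
    intro i
    refine (hfin (μ i) (hpos i)).subset fun j hj => ?_
    rcases Prod.Lex.toLex_lt_toLex.mp hj with h | h
    · simp only at h
      simp only [Set.mem_ofPred_eq]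
      linarith
    · have := h.1
      simp only at this
      simp only [Set.mem_ofPred_eq]
      linarith
  -- the number of predecessors is an injection of `ι` onto an infinite subset of `ℕ`
  let r : ι → ℕ := fun i => (hbelow i).toFinset.card
  have hr : ∀ i j, key i < key j → r i < r j := by
    intro i j hij
    refine Finset.card_lt_card ?_
    rw [Finset.ssubset_iff_of_subset]
    · exact ⟨i, by simpa using hij, by simp⟩
    · intro k hk
      simp only [Set.Finite.mem_toFinset, Set.mem_ofPred_eq] at hk ⊢
      exact hk.trans hij
  have hrinj : Function.Injective r := by
    intro i j hij
    rcases lt_trichotomy (key i) (key j) with h | h | h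
    · exact absurd hij (hr _ _ h).ne
    · exact hkey h
    · exact absurd hij (hr _ _ h).ne'
  have hinf : Infinite (Set.range r) := (Set.infinite_range_of_injective hrinj).to_subtype
  let e₁ : ℕ ≃o Set.range r := Nat.Subtype.orderIsoOfNat (Set.range r)
  let e₂ : ι ≃ Set.range r := Equiv.ofInjective r hrinj
  refine ⟨e₁.toEquiv.trans e₂.symm, ?_⟩
  intro k l hkl
  have hre : ∀ k, r ((e₁.toEquiv.trans e₂.symm) k) = (e₁ k : ℕ) := by
    intro k
    have : e₂ ((e₁.toEquiv.trans e₂.symm) k) = e₁ k := by simp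
    exact congrArg Subtype.val this
  have hle : r ((e₁.toEquiv.trans e₂.symm) k) ≤ r ((e₁.toEquiv.trans e₂.symm) l) := by
    rw [hre, hre]
    exact e₁.monotone hkl
  have hkle := not_lt.mp fun h => (hr _ _ h).not_ge hle
  rcases Prod.Lex.toLex_le_toLex.mp hkle with h | h
  · simp only at h
    simp only [Function.comp_apply]
    linarith
  · have := h.1
    simp only at this
    simp only [Function.comp_apply]
    linarith

/-! ### Compact operators with an orthonormal basis of eigenvectors -/

section Diagonal

variable {H : Type} [NormedAddCommGroup H] [InnerProductSpace ℂ H]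

/-- The eigenvalues of a compact operator along an orthonormal family of eigenvectors tend to
`0`. -/
theorem tendsto_eigenvalue_cofinite {ι : Type*} {T : H →L[ℂ] H} (hT : IsCompactOperator T)
    {v : ι → H} (hv : Orthonormal ℂ v) {μ : ι → ℝ} (hμ : ∀ i, T (v i) = (μ i : ℂ) • v i) :
    Tendsto μ cofinite (𝓝 0) := by
  rw [Metric.tendsto_nhds]
  intro ε hε
  rw [eventually_cofinite]
  by_contra hinf
  let f := Set.Infinite.natEmbedding _ hinf
  have hf : ∀ n, ε ≤ |μ (f n)| := by
    intro n
    have h := (f n).2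
    simpa using h
  have hK := hT.isCompact_closure_image_closedBall (𝕜₁ := ℂ) 1
  have hmem : ∀ n, T (v (f n)) ∈ closure (T '' Metric.closedBall 0 1) := fun n =>
    subset_closure ⟨v (f n), by simp [hv.1], rfl⟩
  obtain ⟨a, -, φ, hφ, hlim⟩ := hK.tendsto_subseq hmem
  obtain ⟨N, hN⟩ := Metric.cauchySeq_iff'.mp hlim.cauchySeq ε hε
  have hd := hN (N + 1) (Nat.le_succ N)
  set i := f (φ (N + 1)) with hi
  set j := f (φ N) with hj
  have hij : (i : ι) ≠ j := by
    intro h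
    have := hφ.injective (f.injective (Subtype.ext h))
    omega
  have hsq : ‖T (v i) - T (v j)‖ ^ 2 = μ i ^ 2 + μ j ^ 2 := by
    have h0 : inner ℂ ((μ i : ℂ) • v i) ((μ j : ℂ) • v j) = 0 := by
      rw [inner_smul_left, inner_smul_right, hv.2 hij]
      simp
    rw [hμ, hμ, @norm_sub_sq ℂ, h0]
    simp [norm_smul, hv.1]
  have h1 : dist ((⇑T ∘ fun n => v (f n)) (φ (N + 1))) ((⇑T ∘ fun n => v (f n)) (φ N)) =
    ‖T (v i) - T (v j)‖ := dist_eq_norm _ _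
  have h2 : ‖T (v i) - T (v j)‖ < ε := h1 ▸ hd
  have h3 : ε ^ 2 ≤ μ i ^ 2 := by
    rw [← sq_abs (μ i)]
    exact pow_le_pow_left₀ hε.le (hf _) 2
  have h4 : ‖T (v i) - T (v j)‖ ^ 2 < ε ^ 2 := by
    exact pow_lt_pow_left₀ h2 (norm_nonneg _) two_ne_zero
  nlinarith [sq_nonneg (μ j)]

/-- Reordering a Hilbert basis. -/
theorem HilbertBasis.exists_reindex {ι κ : Type*} (b : HilbertBasis ι ℂ H) (e : κ ≃ ι) :
    ∃ c : HilbertBasis κ ℂ H, ∀ k, c k = b (e k) := by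
  have : CompleteSpace H := b.repr.symm.isometry.isUniformInducing.completeSpace_congr
    b.repr.symm.surjective |>.mp inferInstance
  have hc : Orthonormal ℂ (b ∘ e) := b.orthonormal.comp e e.injective
  have hsp : ⊤ ≤ (Submodule.span ℂ (Set.range (b ∘ e))).topologicalClosure := by
    rw [e.surjective.range_comp, b.dense_span]
  exact ⟨HilbertBasis.mk hc hsp, fun k => by simp⟩

/-- The spectral theorem for an injective compact positive operator on an infinite-dimensional
Hilbert space, with the eigenvalues in non-increasing order. -/
theorem exists_hilbertBasis_eigenvectors [CompleteSpace H] {T : H →L[ℂ] H}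
    (hT : IsCompactOperator T) (hpos : T.IsPositive) (hinj : ∀ x, T x = 0 → x = 0)
    (hdim : ¬ FiniteDimensional ℂ H) :
    ∃ (b : HilbertBasis ℕ ℂ H) (μ : ℕ → ℝ), Antitone μ ∧ (∀ n, 0 < μ n) ∧
      Tendsto μ atTop (𝓝 0) ∧ ∀ n, T (b n) = (μ n : ℂ) • b n := by
  have hsymm : (T : H →ₗ[ℂ] H).IsSymmetric := hpos.isSymmetric
  have hfam := hsymm.orthogonalFamily_eigenspaces
  have hbasis : ∀ z : ℂ, ∃ (w : Set (Module.End.eigenspace (T : H →ₗ[ℂ] H) z))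
      (b : HilbertBasis w ℂ (Module.End.eigenspace (T : H →ₗ[ℂ] H) z)),
      ⇑b = ((↑) : w → Module.End.eigenspace (T : H →ₗ[ℂ] H) z) := by
    intro z
    have : CompleteSpace (Module.End.eigenspace (T : H →ₗ[ℂ] H) z) := by
      refine IsClosed.completeSpace_coe (hs := ?_)
      have : ((Module.End.eigenspace (T : H →ₗ[ℂ] H) z : Submodule ℂ H) : Set H) =
          {x | T x = z • x} := by
        ext x
        simp
      rw [this]
      exact isClosed_eq T.continuous (continuous_const_smul z)
    exact exists_hilbertBasis ℂ _
  choose w b hb using hbasis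
  -- bases of all eigenspaces together, the eigenvalues being arbitrary complex numbers at first
  let v : (Σ z, w z) → H := fun a => (b a.1 a.2 : H)
  have hv : Orthonormal ℂ v := hfam.orthonormal_sigma_orthonormal fun z => (b z).orthonormal
  have hTv : ∀ a, T (v a) = a.1 • v a := fun a =>
    Module.End.mem_eigenspace_iff.mp (b a.1 a.2).2
  have hbot : (Submodule.span ℂ (Set.range v))ᗮ = ⊥ := by
    rw [Submodule.eq_bot_iff]
    intro x hx
    have : x ∈ (⨆ z, Module.End.eigenspace (T : Module.End ℂ H) z)ᗮ := by
      rw [← Submodule.iInf_orthogonal, Submodule.mem_iInf]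
      intro z
      rw [Submodule.mem_orthogonal]
      intro y hy
      have hy' := (b z).hasSum_repr ⟨y, hy⟩
      have hy2 := hy'.mapL (Submodule.subtypeL (Module.End.eigenspace (T : H →ₗ[ℂ] H) z))
      have hy3 := hy2.mapL ((innerSL ℂ x))
      have h0 : ∀ i, (innerSL ℂ x) ((Submodule.subtypeL _) ((b z).repr ⟨y, hy⟩ i • b z i)) = 0 := by
        intro i
        have h1 : inner ℂ (v ⟨z, i⟩) x = 0 :=
          (Submodule.mem_orthogonal _ _).mp hx _ (Submodule.subset_span ⟨⟨z, i⟩, rfl⟩)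
        have h2 : inner ℂ x (v ⟨z, i⟩) = 0 := inner_eq_zero_symm.mp h1
        simp only [map_smul, Submodule.subtypeL_apply, innerSL_apply_apply]
        simp only [v] at h2
        rw [h2, smul_zero]
      simp only [h0] at hy3
      have h4 := hy3.unique hasSum_zero
      exact inner_eq_zero_symm.mp h4
    rwa [ContinuousLinearMap.orthogonalComplement_iSup_eigenspaces_eq_bot hT hsymm,
      Submodule.mem_bot] at this
  let B : HilbertBasis (Σ z, w z) ℂ H := HilbertBasis.mkOfOrthogonalEqBot hv hbot
  have hB : ⇑B = v := HilbertBasis.coe_mkOfOrthogonalEqBot hv hbot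
  have hinf : Infinite (Σ z, w z) := by
    by_contra hfin
    rw [not_infinite_iff_finite] at hfin
    have := Fintype.ofFinite (Σ z, w z)
    exact hdim (Module.Finite.of_basis B.toOrthonormalBasis.toBasis)
  have hreal : ∀ a : Σ z, w z, a.1 = ((a.1.re : ℝ) : ℂ) ∧ 0 < a.1.re := by
    intro a
    have hne : v a ≠ 0 := hv.ne_zero a
    have hin : inner ℂ (v a) (T (v a)) = a.1 := by
      rw [hTv, inner_smul_right, inner_self_eq_norm_sq_to_K, hv.1]
      simp
    have h0 := hpos.inner_nonneg_right (v a)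
    rw [hin, Complex.le_def] at h0
    have hz : a.1 = ((a.1.re : ℝ) : ℂ) := by
      apply Complex.ext
      · simp
      · simpa using h0.2.symm
    refine ⟨hz, lt_of_le_of_ne h0.1 fun h => hne (hinj _ ?_)⟩
    rw [hTv, hz, ← h]
    simp
  have hlim : Tendsto (fun a : Σ z, w z => a.1.re) cofinite (𝓝 0) :=
    tendsto_eigenvalue_cofinite hT hv fun a => by rw [hTv, ← (hreal a).1]
  obtain ⟨e, he⟩ := exists_equiv_nat_antitone (fun a => (hreal a).2) hlim
  obtain ⟨c, hc⟩ := B.exists_reindex e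
  refine ⟨c, _, he, fun n => (hreal _).2, ?_, fun n => ?_⟩
  · have := hlim.comp e.injective.tendsto_cofinite
    rwa [Nat.cofinite_eq_atTop] at this
  · rw [hc, hB, hTv, Function.comp_apply, ← (hreal _).1]

/-- Coordinates of `T x` in a Hilbert basis of eigenvectors. -/
theorem HilbertBasis.repr_apply_of_eigenvectors {ι : Type*} (b : HilbertBasis ι ℂ H)
    {T : H →L[ℂ] H} {μ : ι → ℝ} (hb : ∀ n, T (b n) = (μ n : ℂ) • b n) (x : H) (n : ι) :
    b.repr (T x) n = μ n * b.repr x n := by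
  have h1 := (b.hasSum_repr x).mapL T
  have h2 := h1.mapL (innerSL ℂ (b n))
  have h3 : ∀ m, m ≠ n → innerSL ℂ (b n) (T (b.repr x m • b m)) = 0 := by
    intro m hm
    simp [hb, b.orthonormal.2 hm.symm]
  have h4 := h2.unique (hasSum_single n h3)
  rw [HilbertBasis.repr_apply_apply, ← innerSL_apply_apply ℂ, h4]
  simp [hb, b.orthonormal.1, inner_self_eq_norm_sq_to_K]
  ring

/-- If an operator is diagonal in a Hilbert basis with a non-increasing null sequence of
non-negative diagonal entries, then these entries are its eigenvalues with multiplicities. -/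
theorem HilbertBasis.isEigenvalueSeq (b : HilbertBasis ℕ ℂ H) {T : H →L[ℂ] H} {μ : ℕ → ℝ}
    (hanti : Antitone μ) (hpos : ∀ n, 0 ≤ μ n) (hlim : Tendsto μ atTop (𝓝 0))
    (hb : ∀ n, T (b n) = (μ n : ℂ) • b n) : IsEigenvalueSeq T μ := by
  refine ⟨hanti, hpos, fun z hz => ?_⟩
  set s : Set ℕ := {n | (μ n : ℂ) = z} with hs
  have hfin : s.Finite := by
    have h1 : ∀ᶠ n in atTop, μ n < ‖z‖ := hlim.eventually_lt_const (by simpa using hz)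
    rw [← Nat.cofinite_eq_atTop, eventually_cofinite] at h1
    refine h1.subset fun n hn => ?_
    have h2 : (μ n : ℂ) = z := hn
    have h3 : ‖z‖ = μ n := by rw [← h2, Complex.norm_real, Real.norm_of_nonneg (hpos n)]
    simp [h3]
  have hspan : Module.End.eigenspace (T : H →ₗ[ℂ] H) z = Submodule.span ℂ (b '' s) := by
    apply le_antisymm
    · intro x hx
      have hx' : T x = z • x := Module.End.mem_eigenspace_iff.mp hx
      have h0 : ∀ n, n ∉ hfin.toFinset → b.repr x n • b n = 0 := by
        intro n hn
        have h1 := b.repr_apply_of_eigenvectors hb x n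
        rw [hx', map_smul] at h1
        have h2 : ((μ n : ℂ) - z) * b.repr x n = 0 := by
          have h3 : z * b.repr x n = μ n * b.repr x n := by simpa using h1
          rw [sub_mul, h3, sub_self]
        rcases mul_eq_zero.mp h2 with h | h
        · exact absurd (by simpa [hs] using sub_eq_zero.mp h) hn
        · rw [h, zero_smul]
      rw [(b.hasSum_repr x).unique (hasSum_sum_of_ne_finset_zero h0)]
      refine Submodule.sum_mem _ fun n hn => Submodule.smul_mem _ _ (Submodule.subset_span ?_)
      exact ⟨n, by simpa using hn, rfl⟩
    · rw [Submodule.span_le]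
      rintro _ ⟨n, hn, rfl⟩
      have hn' : (μ n : ℂ) = z := hn
      simp only [SetLike.mem_coe, Module.End.mem_eigenspace_iff]
      rw [← hn']
      exact hb n
  have hli : LinearIndependent ℂ (fun n : s => b n) :=
    b.orthonormal.linearIndependent.comp _ Subtype.val_injective
  have himg : b '' s = Set.range fun n : s => b n := Set.image_eq_range _ _
  rw [hspan, himg, rank_span hli, Cardinal.mk_range_eq _ hli.injective]
  rfl

end Diagonal

theorem matrixOperator_spec {ι : Type} {A : ι → ι → ℝ} {T : EllTwo ι →L[ℂ] EllTwo ι}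
    (h : IsMatrixOperator A T) : matrixOperator A = T := by
  have hex : ∃ T, IsMatrixOperator A T := ⟨T, h⟩
  rw [matrixOperator, dif_pos hex]
  exact hex.choose_spec.unique h

theorem IsEigenvalueSeq.eigenvalueSeq_eq {H : Type} [NormedAddCommGroup H]
    [InnerProductSpace ℂ H] {T : H →L[ℂ] H} {ev : ℕ → ℝ} (h : IsEigenvalueSeq T ev) :
    eigenvalueSeq T = ev := by
  have hex : ∃ ev, IsEigenvalueSeq T ev := ⟨ev, h⟩
  rw [eigenvalueSeq, dif_pos hex]
  exact hex.choose_spec.unique h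

/-! ### Operators that are norm-convergent sums of operators of rank one -/

section RankOne

variable {H : Type} [NormedAddCommGroup H] [InnerProductSpace ℂ H]

theorem isCompactOperator_rankOne (x y : H) :
    IsCompactOperator (InnerProductSpace.rankOne ℂ x y) := by
  have h : IsCompactOperator (id : ℂ → ℂ) := isCompactOperator_id
  exact (h.comp_clm (innerSL ℂ y)).clm_comp (ContinuousLinearMap.toSpanSingleton ℂ x)

theorem isCompactOperator_of_hasSum_rankOne [CompleteSpace H] {ι : Type*} {c : ι → ℝ} {v : ι → H}
    {T : H →L[ℂ] H}
    (hT : HasSum (fun i => (c i : ℂ) • InnerProductSpace.rankOne ℂ (v i) (v i)) T) :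
    IsCompactOperator T := by
  refine isCompactOperator_of_tendsto hT (Eventually.of_forall fun s => ?_)
  refine Submodule.sum_mem (compactOperator (RingHom.id ℂ) H H) fun i _ => ?_
  exact Submodule.smul_mem _ _ (isCompactOperator_rankOne (v i) (v i))

theorem hasSum_inner_of_hasSum_rankOne {ι : Type*} {c : ι → ℝ} {v : ι → H} {T : H →L[ℂ] H}
    (hT : HasSum (fun i => (c i : ℂ) • InnerProductSpace.rankOne ℂ (v i) (v i)) T) (x : H) :
    HasSum (fun i => ((c i * ‖inner ℂ (v i) x‖ ^ 2 : ℝ) : ℂ)) (inner ℂ (T x) x) := by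
  have h1 : HasSum (fun i => ((c i : ℂ) • InnerProductSpace.rankOne ℂ (v i) (v i)) x) (T x) :=
    hT.mapL (ContinuousLinearMap.apply ℂ H x)
  have h2 := (h1.mapL (innerSL ℂ x)).map (starRingEnd ℂ) Complex.continuous_conj
  convert h2 using 1
  · funext i
    simp only [Function.comp_apply, smul_apply, InnerProductSpace.rankOne_apply, map_smul,
      innerSL_apply_apply, smul_eq_mul, map_mul, Complex.conj_ofReal, inner_conj_symm]
    rw [← inner_conj_symm x (v i), RCLike.conj_mul]
    push_cast
    rfl
  · simp

theorem hasSum_re_inner_of_hasSum_rankOne {ι : Type*} {c : ι → ℝ} {v : ι → H} {T : H →L[ℂ] H}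
    (hT : HasSum (fun i => (c i : ℂ) • InnerProductSpace.rankOne ℂ (v i) (v i)) T) (x : H) :
    HasSum (fun i => c i * ‖inner ℂ (v i) x‖ ^ 2) (inner ℂ (T x) x).re :=
  Complex.hasSum_re (hasSum_inner_of_hasSum_rankOne hT x)

theorem isPositive_of_hasSum_rankOne {ι : Type*} {c : ι → ℝ} (hc : ∀ i, 0 ≤ c i) {v : ι → H}
    {T : H →L[ℂ] H}
    (hT : HasSum (fun i => (c i : ℂ) • InnerProductSpace.rankOne ℂ (v i) (v i)) T) :
    T.IsPositive := by
  rw [ContinuousLinearMap.isPositive_iff_complex]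
  intro x
  have h := hasSum_inner_of_hasSum_rankOne hT x
  have hre := hasSum_re_inner_of_hasSum_rankOne hT x
  refine ⟨?_, hre.nonneg fun i => mul_nonneg (hc i) (sq_nonneg _)⟩
  exact (Complex.hasSum_ofReal.mpr hre).unique h

/-- A diagonal operator with null diagonal is a norm-convergent sum of operators of rank one. -/
theorem Orthonormal.summable_rankOne [CompleteSpace H] {ι : Type*} {v : ι → H}
    (hv : Orthonormal ℂ v) {μ : ι → ℝ} (hlim : Tendsto μ cofinite (𝓝 0)) :
    Summable fun i => (μ i : ℂ) • InnerProductSpace.rankOne ℂ (v i) (v i) := by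
  classical
  rw [summable_iff_vanishing_norm]
  intro ε hε
  have hfin : {i | ¬ |μ i| < ε / 2}.Finite := by
    have h := (Metric.tendsto_nhds.mp hlim) (ε / 2) (half_pos hε)
    rw [eventually_cofinite] at h
    simpa using h
  refine ⟨hfin.toFinset, fun t ht => lt_of_le_of_lt ?_ (half_lt_self hε)⟩
  refine ContinuousLinearMap.opNorm_le_bound _ (half_pos hε).le fun x => ?_
  have hsum : (∑ i ∈ t, (μ i : ℂ) • InnerProductSpace.rankOne ℂ (v i) (v i)) x =
      ∑ i ∈ t, ((μ i : ℂ) * inner ℂ (v i) x) • v i := by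
    rw [sum_apply]
    refine Finset.sum_congr rfl fun i _ => ?_
    rw [smul_apply, InnerProductSpace.rankOne_apply, smul_smul]
  have hnorm : ‖∑ i ∈ t, ((μ i : ℂ) * inner ℂ (v i) x) • v i‖ ^ 2 =
      ∑ i ∈ t, ‖(μ i : ℂ) * inner ℂ (v i) x‖ ^ 2 := by
    have h := hv.inner_sum (fun i => (μ i : ℂ) * inner ℂ (v i) x)
      (fun i => (μ i : ℂ) * inner ℂ (v i) x) t
    rw [inner_self_eq_norm_sq_to_K] at h
    have h2 : ∀ z : ℂ, conj z * z = ((‖z‖ ^ 2 : ℝ) : ℂ) := fun z => by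
      rw [RCLike.conj_mul]; push_cast; rfl
    simp only [h2] at h
    refine Complex.ofReal_injective ?_
    push_cast at h ⊢
    exact h
  rw [hsum]
  refine abs_le_of_sq_le_sq' ?_ (by positivity) |>.2
  rw [hnorm, mul_pow]
  calc ∑ i ∈ t, ‖(μ i : ℂ) * inner ℂ (v i) x‖ ^ 2
      ≤ ∑ i ∈ t, (ε / 2) ^ 2 * ‖inner ℂ (v i) x‖ ^ 2 := by
        refine Finset.sum_le_sum fun i hi => ?_
        have hi' : |μ i| < ε / 2 := by
          by_contra h
          exact Finset.disjoint_left.mp ht hi (by simpa using h)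
        rw [norm_mul, mul_pow, Complex.norm_real, Real.norm_eq_abs]
        gcongr
    _ = (ε / 2) ^ 2 * ∑ i ∈ t, ‖inner ℂ (v i) x‖ ^ 2 := by rw [Finset.mul_sum]
    _ ≤ (ε / 2) ^ 2 * ‖x‖ ^ 2 := by
        gcongr
        exact hv.sum_inner_products_le x

end RankOne

/-! ### Matrices and operators on `ℓ²` -/

theorem EllTwo.inner_single_left {ι : Type} [DecidableEq ι] (n : ι) (x : EllTwo ι) :
    inner ℂ (lp.single 2 n (1 : ℂ) : EllTwo ι) x = x n := by
  rw [lp.inner_single_left]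
  simp

/-- An operator is given by the matrix of its entries in the standard basis. -/
theorem isMatrixOperator_of_entries {ι : Type} [DecidableEq ι] {A : ι → ι → ℝ}
    {T : EllTwo ι →L[ℂ] EllTwo ι}
    (h : ∀ n m, T (lp.single 2 m (1 : ℂ)) n = (A n m : ℂ)) : IsMatrixOperator A T := by
  intro x n
  have h1 : HasSum (fun m => (lp.single 2 m (x m) : EllTwo ι)) x :=
    lp.hasSum_single (by simp) x
  have h2 := (h1.mapL T).mapL (innerSL ℂ (lp.single 2 n (1 : ℂ) : EllTwo ι))
  simp only [innerSL_apply_apply, EllTwo.inner_single_left] at h2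
  refine h2.congr_fun fun m => ?_
  have h3 : (lp.single 2 m (x m) : EllTwo ι) = x m • lp.single 2 m (1 : ℂ) := by
    rw [← lp.single_smul]
    simp
  rw [h3, map_smul, lp.coeFn_smul, Pi.smul_apply, h, smul_eq_mul, mul_comm]

theorem IsMatrixOperator.apply_single {ι : Type} [DecidableEq ι] {A : ι → ι → ℝ}
    {T : EllTwo ι →L[ℂ] EllTwo ι} (h : IsMatrixOperator A T) (n m : ι) :
    T (lp.single 2 m (1 : ℂ)) n = (A n m : ℂ) := by
  refine (h _ n).unique ?_
  convert hasSum_single m ?_ using 1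
  · simp
  · intro k hk
    simp [Pi.single_eq_of_ne hk]

theorem not_finiteDimensional_ellTwo_nat : ¬ FiniteDimensional ℂ (EllTwo ℕ) := by
  intro h
  have hli : LinearIndependent ℂ fun n : ℕ => (lp.single 2 n (1 : ℂ) : EllTwo ℕ) := by
    refine Orthonormal.linearIndependent ⟨fun n => ?_, fun n m hnm => ?_⟩
    · rw [lp.norm_single (by simp)]
      simp
    · exact (EllTwo.inner_single_left n _).trans (lp.single_apply_ne _ _ _ hnm)
  exact not_finite_iff_infinite.mpr inferInstance hli.finite_of_isNoetherian

/-! ### The local operators -/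

/-- The matrix `s^j w^{max(j,k)} s^k`. The local matrix at a prime `p` is the one with `s = p^σ` and
`w = p^{-τ}`. -/
noncomputable def maxMatrix (s w : ℝ) (j k : ℕ) : ℝ := s ^ j * w ^ max j k * s ^ k

theorem localMatrix_eq_maxMatrix (σ τ : ℝ) (p : ℕ) :
    localMatrix σ τ p = maxMatrix ((p : ℝ) ^ σ) ((p : ℝ) ^ (-τ)) := by
  funext j k
  have hp : (0 : ℝ) ≤ p := Nat.cast_nonneg p
  simp only [localMatrix, maxMatrix, Real.rpow_mul_natCast hp]

/-- The vector `∑_{j ≤ i} s^j e_j`. -/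
noncomputable def stairVec (s : ℝ) (i : ℕ) : EllTwo ℕ :=
  ∑ j ∈ Finset.range (i + 1), lp.single 2 j ((s : ℂ) ^ j)

theorem stairVec_apply (s : ℝ) (i k : ℕ) :
    stairVec s i k = if k ≤ i then (s : ℂ) ^ k else 0 := by
  rw [stairVec, lp.coeFn_sum, Finset.sum_apply]
  by_cases hk : k ≤ i
  · rw [if_pos hk, Finset.sum_eq_single_of_mem k (by simpa using Nat.lt_succ_of_le hk)]
    · exact lp.single_apply_self _ _ _
    · intro j _ hj
      exact lp.single_apply_ne _ _ _ hj.symm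
  · rw [if_neg hk]
    refine Finset.sum_eq_zero fun j hj => lp.single_apply_ne _ _ _ ?_
    rw [Finset.mem_range] at hj
    omega

theorem norm_stairVec_le {s : ℝ} (hs : 0 < s) (i : ℕ) :
    ‖stairVec s i‖ ≤ (i + 1) * (1 + s ^ i) := by
  refine (norm_sum_le _ _).trans ?_
  have h : ∀ j ∈ Finset.range (i + 1), ‖(lp.single 2 j ((s : ℂ) ^ j) : EllTwo ℕ)‖ ≤ 1 + s ^ i := by
    intro j hj
    rw [lp.norm_single (by simp), norm_pow, Complex.norm_real, Real.norm_of_nonneg hs.le]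
    have hji : j ≤ i := Nat.lt_succ_iff.mp (Finset.mem_range.mp hj)
    rcases le_total s 1 with h1 | h1
    · have := pow_le_one₀ (n := j) hs.le h1
      have := pow_pos hs i
      linarith
    · have := pow_le_pow_right₀ h1 hji
      linarith
  refine (Finset.sum_le_card_nsmul _ _ _ h).trans (le_of_eq ?_)
  rw [Finset.card_range, nsmul_eq_mul]
  push_cast
  rfl

theorem summable_maxMatrix_rankOne {s w : ℝ} (hs : 0 < s) (hw : 0 < w) (hw1 : w < 1)
    (hr : w * s ^ 2 < 1) :
    Summable fun i : ℕ =>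
      (((1 - w) * w ^ i : ℝ) : ℂ) • InnerProductSpace.rankOne ℂ (stairVec s i) (stairVec s i) := by
  have hpoly : ∀ r : ℝ, 0 < r → r < 1 → Summable fun i : ℕ => ((i : ℝ) + 1) ^ 2 * r ^ i := by
    intro r hr0 hr1
    have h := summable_pow_mul_geometric_of_norm_lt_one (R := ℝ) 2
      (by rwa [Real.norm_of_nonneg hr0.le] : ‖r‖ < 1)
    have h2 := ((summable_nat_add_iff 1).mpr h).mul_right r⁻¹
    refine h2.congr fun i => ?_
    push_cast
    rw [pow_succ r i]
    field_simp
  have hbound : Summable fun i : ℕ => 2 * (((i : ℝ) + 1) ^ 2 * w ^ i +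
      ((i : ℝ) + 1) ^ 2 * (w * s ^ 2) ^ i) :=
    ((hpoly w hw hw1).add (hpoly _ (by positivity) hr)).mul_left 2
  refine Summable.of_norm_bounded hbound fun i => ?_
  rw [norm_smul, Complex.norm_real, InnerProductSpace.norm_rankOne, Real.norm_of_nonneg
    (mul_nonneg (by linarith) (by positivity))]
  have h1 := norm_stairVec_le hs i
  calc (1 - w) * w ^ i * (‖stairVec s i‖ * ‖stairVec s i‖)
      ≤ 1 * w ^ i * (((i + 1) * (1 + s ^ i)) * ((i + 1) * (1 + s ^ i))) := by
        gcongr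
        linarith
    _ = ((i : ℝ) + 1) ^ 2 * w ^ i * (1 + s ^ i) ^ 2 := by ring
    _ ≤ ((i : ℝ) + 1) ^ 2 * w ^ i * (2 * (1 + (s ^ i) ^ 2)) := by
        gcongr
        nlinarith [sq_nonneg (1 - s ^ i)]
    _ = _ := by rw [mul_pow w, ← pow_mul, ← pow_mul, mul_comm i 2]; ring

/-- The matrix `s^j w^{max(j,k)} s^k` defines an injective compact positive operator. The reason is
the expansion `w^{max(j,k)} = ∑_{i ≥ max(j,k)} (1 - w) w^i`: it writes the operator as the sum of the
operators of rank one `(1 - w) w^i ⟨v_i, ·⟩ v_i`, where `v_i` is `stairVec s i`. -/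
theorem exists_maxMatrix_operator {s w : ℝ} (hs : 0 < s) (hw : 0 < w) (hw1 : w < 1)
    (hr : w * s ^ 2 < 1) :
    ∃ T : EllTwo ℕ →L[ℂ] EllTwo ℕ, IsMatrixOperator (maxMatrix s w) T ∧ IsCompactOperator T ∧
      T.IsPositive ∧ ∀ x, T x = 0 → x = 0 := by
  obtain ⟨T, hT⟩ := summable_maxMatrix_rankOne hs hw hw1 hr
  have hc : ∀ i : ℕ, 0 < (1 - w) * w ^ i := fun i => mul_pos (by linarith) (pow_pos hw i)
  refine ⟨T, isMatrixOperator_of_entries fun j k => ?_, isCompactOperator_of_hasSum_rankOne hT,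
    isPositive_of_hasSum_rankOne (fun i => (hc i).le) hT, fun x hx => ?_⟩
  · have h1 := hT.mapL (ContinuousLinearMap.apply ℂ (EllTwo ℕ) (lp.single 2 k (1 : ℂ) : EllTwo ℕ))
    have h2 := h1.mapL (innerSL ℂ (lp.single 2 j (1 : ℂ) : EllTwo ℕ))
    simp only [innerSL_apply_apply, EllTwo.inner_single_left, ContinuousLinearMap.apply_apply] at h2
    refine h2.unique ?_
    have hgeo : HasSum (fun i : ℕ => if max j k ≤ i then (1 - w) * w ^ i else 0)
        (w ^ max j k) := by
      rw [← hasSum_nat_add_iff' (max j k)]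
      have h0 : ∑ i ∈ Finset.range (max j k),
          (if max j k ≤ i then (1 - w) * w ^ i else 0) = 0 :=
        Finset.sum_eq_zero fun i hi => if_neg (not_le.mpr (Finset.mem_range.mp hi))
      rw [h0, sub_zero]
      have hg := (hasSum_geometric_of_lt_one hw.le hw1).mul_left ((1 - w) * w ^ max j k)
      have h1w : 1 - w ≠ 0 := by linarith
      rw [show (1 - w) * w ^ max j k * (1 - w)⁻¹ = w ^ max j k by field_simp] at hg
      refine hg.congr_fun fun i => ?_
      rw [if_pos (Nat.le_add_left _ _), pow_add]
      ring
    have hgeo' := Complex.hasSum_ofReal.mpr ((hgeo.mul_left (s ^ j)).mul_right (s ^ k))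
    refine hgeo'.congr_fun fun i => ?_
    simp only [smul_apply, InnerProductSpace.rankOne_apply, lp.coeFn_smul, Pi.smul_apply,
      stairVec_apply, smul_eq_mul, lp.inner_single_right]
    by_cases hj : j ≤ i <;> by_cases hk : k ≤ i
    · simp [hj, hk]
      ring
    all_goals simp [hj, hk]
  · have h1 := hasSum_re_inner_of_hasSum_rankOne hT x
    rw [hx, inner_zero_left, Complex.zero_re] at h1
    have h2 : ∀ i, inner ℂ (stairVec s i) x = 0 := by
      intro i
      have h3 := congrFun ((hasSum_zero_iff_of_nonneg fun i =>
        mul_nonneg (hc i).le (sq_nonneg _)).mp h1) i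
      simpa [(hc i).ne'] using h3
    have h4 : ∀ i, ∑ j ∈ Finset.range (i + 1), (s : ℂ) ^ j * x j = 0 := by
      intro i
      have h5 := h2 i
      rw [stairVec, sum_inner] at h5
      rw [← h5]
      refine Finset.sum_congr rfl fun j _ => ?_
      rw [lp.inner_single_left]
      simp [mul_comm]
    ext i
    have h6 : (s : ℂ) ^ i * x i = 0 := by
      cases i with
      | zero => simpa using h4 0
      | succ i =>
        have h7 := h4 (i + 1)
        rwa [Finset.sum_range_succ, h4 i, zero_add] at h7
    have hsne : (s : ℂ) ^ i ≠ 0 := pow_ne_zero _ (by exact_mod_cast hs.ne')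
    simpa [hsne] using h6

/-! ### Quadratic forms in a basis of eigenvectors -/

section QuadraticForm

variable {H : Type} [NormedAddCommGroup H] [InnerProductSpace ℂ H]

theorem HilbertBasis.hasSum_norm_sq {ι : Type*} (b : HilbertBasis ι ℂ H) (x : H) :
    HasSum (fun n => ‖b.repr x n‖ ^ 2) (‖x‖ ^ 2) := by
  have h := Complex.hasSum_re (b.hasSum_inner_mul_inner x x)
  rw [← RCLike.re_eq_complex_re, inner_self_eq_norm_sq] at h
  refine h.congr_fun fun n => ?_
  rw [b.repr_apply_apply, ← inner_conj_symm x, RCLike.conj_mul]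
  norm_cast

theorem HilbertBasis.hasSum_inner_apply {ι : Type*} (b : HilbertBasis ι ℂ H) {T : H →L[ℂ] H}
    {μ : ι → ℝ} (hb : ∀ n, T (b n) = (μ n : ℂ) • b n) (x : H) :
    HasSum (fun n => μ n * ‖b.repr x n‖ ^ 2) (inner ℂ x (T x)).re := by
  have h := Complex.hasSum_re (b.hasSum_inner_mul_inner x (T x))
  refine h.congr_fun fun n => ?_
  have h1 := b.repr_apply_of_eigenvectors hb x n
  rw [b.repr_apply_apply, b.repr_apply_apply] at h1
  rw [h1, b.repr_apply_apply, ← inner_conj_symm x, mul_left_comm, RCLike.conj_mul,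
    Complex.re_ofReal_mul, ← RCLike.re_eq_complex_re, ← RCLike.ofReal_pow, RCLike.ofReal_re]

theorem HilbertBasis.inner_apply_le (b : HilbertBasis ℕ ℂ H) {T : H →L[ℂ] H} {μ : ℕ → ℝ}
    (hanti : Antitone μ) (hb : ∀ n, T (b n) = (μ n : ℂ) • b n) {m : ℕ} {x : H}
    (hx : ∀ n < m, b.repr x n = 0) : (inner ℂ x (T x)).re ≤ μ m * ‖x‖ ^ 2 := by
  refine hasSum_le (fun n => ?_) (b.hasSum_inner_apply hb x) ((b.hasSum_norm_sq x).mul_left (μ m))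
  rcases lt_or_ge n m with h | h
  · simp [hx n h]
  · exact mul_le_mul_of_nonneg_right (hanti h) (sq_nonneg _)

theorem HilbertBasis.le_inner_apply (b : HilbertBasis ℕ ℂ H) {T : H →L[ℂ] H} {μ : ℕ → ℝ}
    (hanti : Antitone μ) (hb : ∀ n, T (b n) = (μ n : ℂ) • b n) {m : ℕ} {x : H}
    (hx : ∀ n > m, b.repr x n = 0) : μ m * ‖x‖ ^ 2 ≤ (inner ℂ x (T x)).re := by
  refine hasSum_le (fun n => ?_) ((b.hasSum_norm_sq x).mul_left (μ m)) (b.hasSum_inner_apply hb x)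
  rcases lt_or_ge m n with h | h
  · simp [hx n h]
  · exact mul_le_mul_of_nonneg_right (hanti h) (sq_nonneg _)

/-- A positive operator diagonalised with positive eigenvalues is positive definite. -/
theorem HilbertBasis.inner_apply_self_pos {ι : Type*}
    (b : HilbertBasis ι ℂ H) {T : H →L[ℂ] H} {μ : ι → ℝ}
    (hpos : ∀ n, 0 < μ n) (hb : ∀ n, T (b n) = (μ n : ℂ) • b n) {x : H} (hx : x ≠ 0) :
    0 < (inner ℂ (T x) x).re := by
  have hex : ∃ n, b.repr x n ≠ 0 := by
    by_contra! h
    refine hx (b.repr.map_eq_zero_iff.mp ?_)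
    ext n
    simpa using h n
  obtain ⟨n, hn⟩ := hex
  have h := b.hasSum_inner_apply hb x
  rw [← inner_conj_symm, Complex.conj_re, ← h.tsum_eq]
  refine h.summable.tsum_pos (fun m => ?_) n ?_
  · have := hpos m
    positivity
  · have := hpos n
    positivity

end QuadraticForm

/-! ### The left shift and the self-similarity of the local operators -/

/-- The left shift `(x₀, x₁, …) ↦ (x₁, x₂, …)` on `ℓ²`. -/
noncomputable def leftShift : EllTwo ℕ →ₗ[ℂ] EllTwo ℕ where
  toFun x := ⟨fun n => x (n + 1), memℓp_gen
    ((summable_nat_add_iff 1).mpr ((lp.memℓp x).summable (by simp)))⟩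
  map_add' _ _ := rfl
  map_smul' _ _ := rfl

@[simp]
theorem leftShift_apply (x : EllTwo ℕ) (n : ℕ) : leftShift x n = x (n + 1) := rfl

theorem inner_eq_add_leftShift (x y : EllTwo ℕ) :
    inner ℂ x y = conj (x 0) * y 0 + inner ℂ (leftShift x) (leftShift y) := by
  have h1 := lp.hasSum_inner (𝕜 := ℂ) x y
  have h2 := lp.hasSum_inner (𝕜 := ℂ) (leftShift x) (leftShift y)
  simp only [leftShift_apply] at h2
  have h3 := (hasSum_nat_add_iff (f := fun n => inner ℂ (x n) (y n)) 1).mp h2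
  rw [h1.unique h3, add_comm, Finset.sum_range_one, RCLike.inner_apply, mul_comm]

theorem norm_sq_eq_add_leftShift (x : EllTwo ℕ) : ‖x‖ ^ 2 = ‖x 0‖ ^ 2 + ‖leftShift x‖ ^ 2 := by
  have h := inner_eq_add_leftShift x x
  rw [inner_self_eq_norm_sq_to_K, inner_self_eq_norm_sq_to_K, RCLike.conj_mul] at h
  refine Complex.ofReal_injective ?_
  push_cast at h ⊢
  exact h

section SelfSimilar

variable {s w : ℝ} {T : EllTwo ℕ →L[ℂ] EllTwo ℕ}

theorem maxMatrix_zero_right (s w : ℝ) (j : ℕ) : maxMatrix s w j 0 = (s * w) ^ j := by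
  simp [maxMatrix, mul_pow]

theorem maxMatrix_succ_succ (s w : ℝ) (j k : ℕ) :
    maxMatrix s w (j + 1) (k + 1) = w * s ^ 2 * maxMatrix s w j k := by
  have : max (j + 1) (k + 1) = max j k + 1 := by omega
  rw [maxMatrix, maxMatrix, this]
  ring

/-- Removing the first row and the first column of `s^j w^{max(j,k)} s^k` gives `w s²` times the
same matrix. -/
theorem leftShift_apply_maxMatrix (hT : IsMatrixOperator (maxMatrix s w) T) (x : EllTwo ℕ) :
    leftShift (T x) = x 0 • leftShift (T (lp.single 2 0 (1 : ℂ))) +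
      ((w * s ^ 2 : ℝ) : ℂ) • T (leftShift x) := by
  ext j
  simp only [leftShift_apply, lp.coeFn_add, lp.coeFn_smul, Pi.add_apply, Pi.smul_apply, smul_eq_mul]
  have h1 := hT x (j + 1)
  have h2 := (hT (leftShift x) j).mul_left ((w * s ^ 2 : ℝ) : ℂ)
  have h3 : HasSum (fun k => (maxMatrix s w (j + 1) (k + 1) : ℂ) * x (k + 1))
      (((w * s ^ 2 : ℝ) : ℂ) * T (leftShift x) j) := by
    refine h2.congr_fun fun k => ?_
    rw [maxMatrix_succ_succ, leftShift_apply]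
    push_cast
    ring
  have h4 := (hasSum_nat_add_iff (f := fun k => (maxMatrix s w (j + 1) k : ℂ) * x k) 1).mp h3
  rw [h1.unique h4, hT.apply_single, add_comm, Finset.sum_range_one, mul_comm (x 0)]

theorem apply_zero_maxMatrix (hT : IsMatrixOperator (maxMatrix s w) T) (hpos : T.IsPositive)
    (x : EllTwo ℕ) :
    T x 0 = x 0 + inner ℂ (leftShift (T (lp.single 2 0 (1 : ℂ)))) (leftShift x) := by
  rw [← EllTwo.inner_single_left, ← hpos.isSymmetric.apply_clm, inner_eq_add_leftShift]
  rw [hT.apply_single]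
  simp [maxMatrix]

/-- The squared norm of the first column of `s^j w^{max(j,k)} s^k` without its first entry. -/
theorem norm_sq_leftShift_apply_single (hT : IsMatrixOperator (maxMatrix s w) T)
    (hlt : w * (w * s ^ 2) < 1) (hw : 0 < w) :
    ‖leftShift (T (lp.single 2 0 (1 : ℂ)))‖ ^ 2 =
      w * (w * s ^ 2) / (1 - w * (w * s ^ 2)) := by
  have h0 : 0 ≤ w * (w * s ^ 2) := by positivity
  have h1 := Complex.hasSum_re (lp.hasSum_inner (𝕜 := ℂ) (leftShift (T (lp.single 2 0 (1 : ℂ))))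
    (leftShift (T (lp.single 2 0 (1 : ℂ)))))
  rw [← RCLike.re_eq_complex_re, inner_self_eq_norm_sq] at h1
  have h2 := (hasSum_geometric_of_lt_one h0 hlt).mul_left (w * (w * s ^ 2))
  rw [div_eq_mul_inv]
  refine h1.unique (h2.congr_fun fun j => ?_)
  rw [leftShift_apply, hT.apply_single, maxMatrix_zero_right]
  simp only [RCLike.inner_apply, Complex.conj_ofReal]
  rw [← Complex.ofReal_mul]
  simp only [RCLike.re_eq_complex_re, Complex.ofReal_re]
  ring

end SelfSimilar

/-! ### Estimates for the eigenvalues and the top eigenvector of the local operators -/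

section LocalEstimates

variable {s w : ℝ} {T : EllTwo ℕ →L[ℂ] EllTwo ℕ} {b : HilbertBasis ℕ ℂ (EllTwo ℕ)} {μ : ℕ → ℝ}

theorem one_le_eigenvalue_zero (hT : IsMatrixOperator (maxMatrix s w) T) (hanti : Antitone μ)
    (hb : ∀ n, T (b n) = (μ n : ℂ) • b n) : 1 ≤ μ 0 := by
  have h := b.inner_apply_le hanti hb (m := 0) (x := lp.single 2 0 (1 : ℂ)) (by simp)
  rw [EllTwo.inner_single_left, hT.apply_single, lp.norm_single (by simp)] at h
  simpa [maxMatrix] using h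

/-- The top eigenvector is concentrated on its zeroth coordinate. Its left shift `y` satisfies
`μ₀ y = (b 0)₀ v + w s² T y`, where `v` is the first column without its first entry; the pairing with
`y`, and `⟨y, T y⟩ ≤ μ₀ ‖y‖²`, give the bound. -/
theorem norm_leftShift_topEigenvector_le (hT : IsMatrixOperator (maxMatrix s w) T)
    (hanti : Antitone μ) (hb : ∀ n, T (b n) = (μ n : ℂ) • b n) (hr0 : 0 < w * s ^ 2)
    (hr : w * s ^ 2 < 1) :
    ‖leftShift (b 0)‖ ≤
      ‖b 0 0‖ * ‖leftShift (T (lp.single 2 0 (1 : ℂ)))‖ / (1 - w * s ^ 2) := by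
  set v := leftShift (T (lp.single 2 0 (1 : ℂ)))
  set y := leftShift (b 0) with hy
  have hμ := one_le_eigenvalue_zero hT hanti hb
  have h1 : (μ 0 : ℂ) • y = b 0 0 • v + ((w * s ^ 2 : ℝ) : ℂ) • T y := by
    rw [hy, ← leftShift_apply_maxMatrix hT, hb, map_smul]
  have h2 : (inner ℂ y (T y)).re ≤ μ 0 * ‖y‖ ^ 2 := b.inner_apply_le hanti hb (by simp)
  have h3 : μ 0 * ‖y‖ ^ 2 ≤ ‖b 0 0‖ * ‖v‖ * ‖y‖ + w * s ^ 2 * (μ 0 * ‖y‖ ^ 2) := by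
    have h4 := congrArg (fun z => (inner ℂ y z).re) h1
    simp only [inner_add_right, inner_smul_right, Complex.add_re, Complex.re_ofReal_mul] at h4
    rw [← RCLike.re_eq_complex_re, inner_self_eq_norm_sq] at h4
    have h5 : RCLike.re (b 0 0 * inner ℂ y v) ≤ ‖b 0 0‖ * ‖v‖ * ‖y‖ := by
      refine (RCLike.re_le_norm _).trans ?_
      rw [norm_mul, mul_assoc]
      gcongr
      rw [mul_comm]
      exact norm_inner_le_norm _ _
    have h6 := mul_le_mul_of_nonneg_left h2 hr0.le
    exact h4.le.trans (add_le_add h5 h6)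
  rw [le_div_iff₀ (by linarith)]
  rcases eq_or_lt_of_le (norm_nonneg y) with h0 | h0
  · rw [← h0, zero_mul]
    positivity
  · have h7 : (‖y‖ * (1 - w * s ^ 2)) * ‖y‖ ≤ (‖b 0 0‖ * ‖v‖) * ‖y‖ := by
      have h8 : (1 - w * s ^ 2) * ‖y‖ ^ 2 ≤ μ 0 * ((1 - w * s ^ 2) * ‖y‖ ^ 2) :=
        le_mul_of_one_le_left (mul_nonneg (by linarith) (sq_nonneg _)) hμ
      nlinarith
    exact le_of_mul_le_mul_right h7 h0

theorem topEigenvector_zero_ne_zero (hT : IsMatrixOperator (maxMatrix s w) T)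
    (hanti : Antitone μ) (hb : ∀ n, T (b n) = (μ n : ℂ) • b n) (hr0 : 0 < w * s ^ 2)
    (hr : w * s ^ 2 < 1) : b 0 0 ≠ 0 := by
  intro h
  have h1 := norm_leftShift_topEigenvector_le hT hanti hb hr0 hr
  rw [h, norm_zero, zero_mul, zero_div] at h1
  have h2 := norm_sq_eq_add_leftShift (b 0)
  rw [h, le_antisymm h1 (norm_nonneg _), b.orthonormal.1] at h2
  norm_num at h2

theorem one_sub_norm_sq_topEigenvector_le (hT : IsMatrixOperator (maxMatrix s w) T)
    (hanti : Antitone μ) (hb : ∀ n, T (b n) = (μ n : ℂ) • b n) (hr0 : 0 < w * s ^ 2)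
    (hr : w * s ^ 2 < 1) :
    1 - ‖b 0 0‖ ^ 2 ≤
      ‖leftShift (T (lp.single 2 0 (1 : ℂ)))‖ ^ 2 / (1 - w * s ^ 2) ^ 2 := by
  have h1 := norm_leftShift_topEigenvector_le hT hanti hb hr0 hr
  have h2 := norm_sq_eq_add_leftShift (b 0)
  rw [b.orthonormal.1, one_pow] at h2
  have h3 : ‖b 0 0‖ ≤ 1 := by
    have : ‖b 0 0‖ ^ 2 ≤ 1 ^ 2 := by nlinarith [sq_nonneg ‖leftShift (b 0)‖]
    exact le_of_sq_le_sq this zero_le_one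
  have h4 : ‖leftShift (b 0)‖ ≤ ‖leftShift (T (lp.single 2 0 (1 : ℂ)))‖ / (1 - w * s ^ 2) := by
    refine h1.trans ?_
    have : 0 < 1 - w * s ^ 2 := by linarith
    gcongr
    exact mul_le_of_le_one_left (norm_nonneg _) h3
  rw [← div_pow]
  have h5 := pow_le_pow_left₀ (norm_nonneg _) h4 2
  linarith

theorem eigenvalue_zero_le (hT : IsMatrixOperator (maxMatrix s w) T) (hpos : T.IsPositive)
    (hanti : Antitone μ) (hb : ∀ n, T (b n) = (μ n : ℂ) • b n) (hr0 : 0 < w * s ^ 2)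
    (hr : w * s ^ 2 < 1) :
    μ 0 ≤ 1 + ‖leftShift (T (lp.single 2 0 (1 : ℂ)))‖ ^ 2 / (1 - w * s ^ 2) := by
  have h1 := norm_leftShift_topEigenvector_le hT hanti hb hr0 hr
  have hne := norm_pos_iff.mpr (topEigenvector_zero_ne_zero hT hanti hb hr0 hr)
  have hμ := one_le_eigenvalue_zero hT hanti hb
  have h2 := apply_zero_maxMatrix hT hpos (b 0)
  rw [hb, lp.coeFn_smul, Pi.smul_apply, smul_eq_mul] at h2
  set v := leftShift (T (lp.single 2 0 (1 : ℂ)))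
  set y := leftShift (b 0) with hy
  have h3 : ((μ 0 - 1 : ℝ) : ℂ) * b 0 0 = inner ℂ v y := by
    push_cast
    linear_combination h2
  have h4 := congrArg norm h3
  rw [norm_mul, Complex.norm_real, Real.norm_of_nonneg (by linarith)] at h4
  have h5 : (μ 0 - 1) * ‖b 0 0‖ ≤ (‖v‖ ^ 2 / (1 - w * s ^ 2)) * ‖b 0 0‖ := by
    rw [h4]
    calc ‖inner ℂ v y‖ ≤ ‖v‖ * ‖y‖ := norm_inner_le_norm _ _
      _ ≤ ‖v‖ * (‖b 0 0‖ * ‖v‖ / (1 - w * s ^ 2)) := by gcongr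
      _ = _ := by ring
  have := le_of_mul_le_mul_right h5 hne
  linarith

/-- Self-similarity and the min-max principle make the eigenvalues decay geometrically. -/
theorem eigenvalue_succ_le (hT : IsMatrixOperator (maxMatrix s w) T) (hanti : Antitone μ)
    (hb : ∀ n, T (b n) = (μ n : ℂ) • b n) (hr0 : 0 < w * s ^ 2) (k : ℕ) :
    μ (k + 1) ≤ w * s ^ 2 * μ k := by
  -- a vector in the span of `b 0, …, b (k + 1)` that vanishes at `0` and whose left shift is
  -- orthogonal to `b 0, …, b (k - 1)`
  let V : (Fin (k + 2) → ℂ) →ₗ[ℂ] EllTwo ℕ := Fintype.linearCombination ℂ fun i => b i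
  let P : EllTwo ℕ →ₗ[ℂ] (Option (Fin k) → ℂ) := LinearMap.pi fun o =>
    o.elim ((innerSL ℂ (lp.single 2 0 (1 : ℂ) : EllTwo ℕ)) : EllTwo ℕ →ₗ[ℂ] ℂ)
      fun i => ((innerSL ℂ (b i) : EllTwo ℕ →L[ℂ] ℂ) : EllTwo ℕ →ₗ[ℂ] ℂ) ∘ₗ leftShift
  have hker := LinearMap.ker_ne_bot_of_finrank_lt (f := P ∘ₗ V) (by simp)
  obtain ⟨c, hc, hc0⟩ := Submodule.exists_mem_ne_zero_of_ne_bot hker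
  rw [LinearMap.mem_ker, LinearMap.comp_apply] at hc
  set x := V c with hx
  have hli : LinearIndependent ℂ fun i : Fin (k + 2) => b i :=
    b.orthonormal.linearIndependent.comp _ Fin.val_injective
  have hxne : x ≠ 0 := by
    intro h
    refine hc0 (funext fun i => ?_)
    have h1 : ∑ i, c i • b (i : ℕ) = 0 := by
      rw [← Fintype.linearCombination_apply (R := ℂ) (fun i : Fin (k + 2) => b i)]
      exact h
    exact Fintype.linearIndependent_iff.mp hli c h1 i
  have hx0 : x 0 = 0 := by
    have h := congrFun hc none
    rw [← EllTwo.inner_single_left 0 x]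
    exact h
  have horth : ∀ n < k, b.repr (leftShift x) n = 0 := by
    intro n hn
    have h := congrFun hc (some ⟨n, hn⟩)
    rw [b.repr_apply_apply]
    exact h
  have hspan : ∀ n > k + 1, b.repr x n = 0 := by
    intro n hn
    rw [b.repr_apply_apply, hx]
    simp only [V, Fintype.linearCombination_apply, inner_sum, inner_smul_right]
    refine Finset.sum_eq_zero fun i _ => ?_
    have hne : n ≠ i := by
      have := i.2
      omega
    rw [b.orthonormal.2 hne, mul_zero]
  have h1 := b.le_inner_apply hanti hb hspan
  have h2 := b.inner_apply_le hanti hb horth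
  have h3 : inner ℂ x (T x) = ((w * s ^ 2 : ℝ) : ℂ) * inner ℂ (leftShift x) (T (leftShift x)) := by
    rw [inner_eq_add_leftShift, leftShift_apply_maxMatrix hT, hx0, map_zero, zero_mul, zero_add,
      zero_smul, zero_add, inner_smul_right]
  -- since `x 0 = 0`, the shift loses nothing, and the form of `T` at `x` is `w s²` times its value at
  -- the shift
  have h4 : ‖leftShift x‖ ^ 2 = ‖x‖ ^ 2 := by
    rw [norm_sq_eq_add_leftShift x, hx0]
    simp
  rw [h3, Complex.re_ofReal_mul] at h1
  rw [h4] at h2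
  have h5 : μ (k + 1) * ‖x‖ ^ 2 ≤ (w * s ^ 2 * μ k) * ‖x‖ ^ 2 := by
    refine h1.trans ?_
    rw [mul_assoc (w * s ^ 2)]
    exact mul_le_mul_of_nonneg_left h2 hr0.le
  exact le_of_mul_le_mul_right h5 (by positivity)

/-- Lower bound for the second eigenvalue. The value `w s² (1 - w) / (1 + w s²)` is the determinant
over the trace of the upper left `2 × 2` corner, hence a lower bound for its form, and it is tested on
the vector in the span of the first two coordinates that is orthogonal to `b 0`. -/
theorem le_eigenvalue_one (hT : IsMatrixOperator (maxMatrix s w) T)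
    (hanti : Antitone μ) (hb : ∀ n, T (b n) = (μ n : ℂ) • b n) (hs : 0 < s) (hw : 0 < w)
    (hr : w * s ^ 2 < 1) : w * s ^ 2 * (1 - w) / (1 + w * s ^ 2) ≤ μ 1 := by
  have hr0 : 0 < w * s ^ 2 := by positivity
  set r := w * s ^ 2 with hrdef
  set m := r * (1 - w) / (1 + r) with hm
  have hne := topEigenvector_zero_ne_zero hT hanti hb hr0 hr
  set c₀ : ℂ := -conj (b 0 1) with hc₀
  set c₁ : ℂ := conj (b 0 0) with hc₁
  have hc₁ne : c₁ ≠ 0 := by simpa [hc₁] using hne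
  let x : EllTwo ℕ := c₀ • lp.single 2 0 (1 : ℂ) + c₁ • lp.single 2 1 (1 : ℂ)
  have hinner : ∀ y : EllTwo ℕ, inner ℂ x y = conj c₀ * y 0 + conj c₁ * y 1 := by
    intro y
    simp only [x, inner_add_left, inner_smul_left, EllTwo.inner_single_left]
  have hx0 : x 0 = c₀ := by
    change c₀ * (lp.single 2 0 (1 : ℂ) : EllTwo ℕ) 0 +
      c₁ * (lp.single 2 1 (1 : ℂ) : EllTwo ℕ) 0 = _
    simp
  have hx1 : x 1 = c₁ := by
    change c₀ * (lp.single 2 0 (1 : ℂ) : EllTwo ℕ) 1 +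
      c₁ * (lp.single 2 1 (1 : ℂ) : EllTwo ℕ) 1 = _
    simp
  have hTx : ∀ j, T x j = c₀ * maxMatrix s w j 0 + c₁ * maxMatrix s w j 1 := by
    intro j
    simp only [x, map_add, map_smul, lp.coeFn_add, lp.coeFn_smul, Pi.add_apply, Pi.smul_apply,
      hT.apply_single, smul_eq_mul]
  have hnorm : ‖x‖ ^ 2 = ‖c₀‖ ^ 2 + ‖c₁‖ ^ 2 := by
    have h := hinner x
    rw [inner_self_eq_norm_sq_to_K, hx0, hx1, RCLike.conj_mul, RCLike.conj_mul] at h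
    refine Complex.ofReal_injective ?_
    push_cast at h ⊢
    exact h
  have horth : ∀ n < 1, b.repr x n = 0 := by
    intro n hn
    obtain rfl : n = 0 := by omega
    rw [b.repr_apply_apply, ← inner_conj_symm, hinner, hc₀, hc₁]
    simp
    ring
  have h1 := b.inner_apply_le hanti hb horth
  have hform : (inner ℂ x (T x)).re =
      ‖c₀‖ ^ 2 + 2 * (s * w) * (conj c₀ * c₁).re + r * ‖c₁‖ ^ 2 := by
    have h00 : maxMatrix s w 0 0 = 1 := by simp [maxMatrix]
    have h01 : maxMatrix s w 0 1 = s * w := by simp [maxMatrix]; ring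
    have h10 : maxMatrix s w 1 0 = s * w := by simp [maxMatrix]
    have h11 : maxMatrix s w 1 1 = r := by simp [maxMatrix, hrdef]; ring
    rw [hinner, hTx, hTx, h00, h01, h10, h11, ← Complex.normSq_eq_norm_sq,
      ← Complex.normSq_eq_norm_sq, Complex.normSq_apply, Complex.normSq_apply]
    simp only [Complex.add_re, Complex.mul_re, Complex.conj_re, Complex.conj_im, Complex.ofReal_re,
      Complex.ofReal_im, Complex.mul_im, Complex.add_im]
    ring
  have hre : -(‖c₀‖ * ‖c₁‖) ≤ (conj c₀ * c₁).re := by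
    have := (abs_le.mp (Complex.abs_re_le_norm (conj c₀ * c₁))).1
    rwa [norm_mul, RCLike.norm_conj] at this
  -- the corner minus `m` has determinant `m²`, so it is positive definite, as `m < 1`
  have hm0 : (1 - m) * (r - m) - (s * w) ^ 2 = m ^ 2 := by
    have hm' : m * (1 + r) = r * (1 - w) := by
      rw [hm]
      field_simp
    have hsw : (s * w) ^ 2 = w * r := by rw [hrdef]; ring
    rw [hsw]
    linear_combination -hm'
  have hm1 : m < 1 := by
    rw [hm, div_lt_one (by linarith)]
    nlinarith
  have hquad : m * (‖c₀‖ ^ 2 + ‖c₁‖ ^ 2) ≤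
      ‖c₀‖ ^ 2 - 2 * (s * w) * (‖c₀‖ * ‖c₁‖) + r * ‖c₁‖ ^ 2 := by
    have h : 0 ≤ (1 - m) * ((1 - m) * ‖c₀‖ ^ 2 - 2 * (s * w) * (‖c₀‖ * ‖c₁‖) +
        (r - m) * ‖c₁‖ ^ 2) := by
      have : (1 - m) * ((1 - m) * ‖c₀‖ ^ 2 - 2 * (s * w) * (‖c₀‖ * ‖c₁‖) + (r - m) * ‖c₁‖ ^ 2) =
          ((1 - m) * ‖c₀‖ - s * w * ‖c₁‖) ^ 2 + m ^ 2 * ‖c₁‖ ^ 2 := by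
        linear_combination ‖c₁‖ ^ 2 * hm0
      rw [this]
      positivity
    have h2 := nonneg_of_mul_nonneg_right h (by linarith)
    linarith
  have h2 : m * ‖x‖ ^ 2 ≤ μ 1 * ‖x‖ ^ 2 := by
    refine le_trans ?_ h1
    rw [hform, hnorm]
    have h3 := mul_le_mul_of_nonneg_left hre (by positivity : 0 ≤ 2 * (s * w))
    linarith
  have hxpos : 0 < ‖x‖ ^ 2 := by
    rw [hnorm]
    have := norm_pos_iff.mpr hc₁ne
    positivity
  exact le_of_mul_le_mul_right h2 hxpos

end LocalEstimates

/-! ### A distributive law for infinite products of series -/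

section Distributive

variable {ι : Type*}

theorem multipliable_of_summable_norm_sub_one {g : ι → ℂ} (hg : Summable fun p => ‖g p - 1‖) :
    Multipliable g := by
  have h := multipliable_one_add_of_summable hg
  simpa using h

theorem summable_norm_mul_sub_one {a b : ι → ℂ} (ha : Summable fun p => ‖a p - 1‖)
    (hb : Summable fun p => ‖b p - 1‖) : Summable fun p => ‖a p * b p - 1‖ := by
  have hbdd : ∀ᶠ p in cofinite, ‖a p - 1‖ ≤ 1 :=
    ha.tendsto_cofinite_zero.eventually_le_const zero_lt_one
  refine Summable.of_norm_bounded_eventually (ha.add (hb.mul_left 2)) ?_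
  filter_upwards [hbdd] with p hp
  have h2 : ‖a p‖ ≤ 2 := by
    have := norm_add_le (a p - 1) 1
    rw [sub_add_cancel, norm_one] at this
    linarith
  rw [norm_norm, show a p * b p - 1 = a p * (b p - 1) + (a p - 1) by ring, add_comm ‖a p - 1‖]
  refine (norm_add_le _ _).trans ?_
  rw [norm_mul]
  gcongr

/-- The product of the `g p` over `p ∉ S`. -/
noncomputable def tailProd (g : ι → ℂ) (S : Finset ι) : ℂ :=
  open Classical in ∏' p, if p ∈ S then 1 else g p

theorem summable_tail {g : ι → ℂ} (hg : Summable fun p => ‖g p - 1‖) (S : Finset ι) :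
    open Classical in Summable fun p => ‖(if p ∈ S then 1 else g p) - 1‖ := by
  classical
  refine hg.of_nonneg_of_le (fun p => norm_nonneg _) fun p => ?_
  split_ifs
  · simp
  · exact le_rfl

theorem tprod_eq_prod_mul_tailProd {g : ι → ℂ} (hg : Summable fun p => ‖g p - 1‖) (S : Finset ι) :
    ∏' p, g p = (∏ p ∈ S, g p) * tailProd g S := by
  classical
  have h1 : HasProd (fun p => if p ∈ S then g p else 1) (∏ p ∈ S, g p) := by
    have h := hasProd_prod_of_ne_finset_one (f := fun p => if p ∈ S then g p else 1) (s := S)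
      (L := SummationFilter.unconditional ι) fun p hp => if_neg hp
    rwa [Finset.prod_congr rfl fun p hp => if_pos hp] at h
  have h2 := (multipliable_of_summable_norm_sub_one (summable_tail hg S)).hasProd
  have h3 := h1.mul h2
  refine Eq.trans (tprod_congr fun p => ?_) h3.tprod_eq
  by_cases hp : p ∈ S <;> simp [hp]

theorem norm_tprod_sub_one_le {g : ι → ℂ} (hg : Summable fun p => ‖g p - 1‖) :
    ‖∏' p, g p - 1‖ ≤ Real.exp (∑' p, ‖g p - 1‖) - 1 := by
  have h1 := (multipliable_of_summable_norm_sub_one hg).hasProd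
  have h2 : Tendsto (fun S : Finset ι => ‖∏ p ∈ S, g p - 1‖) atTop (𝓝 ‖∏' p, g p - 1‖) :=
    (Tendsto.sub_const h1 1).norm
  refine le_of_tendsto h2 (Eventually.of_forall fun S => ?_)
  have h3 := S.norm_prod_one_add_sub_one_le fun p => g p - 1
  simp only [add_sub_cancel] at h3
  refine h3.trans ?_
  gcongr
  exact hg.sum_le_tsum S fun p _ => norm_nonneg _

theorem norm_tailProd_sub_one_le {g : ι → ℂ} (hg : Summable fun p => ‖g p - 1‖) (S : Finset ι) :
    ‖tailProd g S - 1‖ ≤ Real.exp (∑' p, ‖g p - 1‖ - ∑ p ∈ S, ‖g p - 1‖) - 1 := by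
  classical
  refine (norm_tprod_sub_one_le (summable_tail hg S)).trans (le_of_eq ?_)
  congr 2
  have h1 : HasSum (fun p => if p ∈ S then ‖g p - 1‖ else 0) (∑ p ∈ S, ‖g p - 1‖) := by
    have h := hasSum_sum_of_ne_finset_zero (f := fun p => if p ∈ S then ‖g p - 1‖ else 0) (s := S)
      (L := SummationFilter.unconditional ι) fun p hp => if_neg hp
    rwa [Finset.sum_congr rfl fun p hp => if_pos hp] at h
  rw [← (hg.hasSum.sub h1).tsum_eq]
  refine tsum_congr fun p => ?_
  by_cases hp : p ∈ S <;> simp [hp]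

theorem tendsto_tailProd {g : ι → ℂ} (hg : Summable fun p => ‖g p - 1‖) :
    Tendsto (tailProd g) atTop (𝓝 1) := by
  rw [tendsto_iff_norm_sub_tendsto_zero]
  have h1 : Tendsto (fun S : Finset ι => ∑ p ∈ S, ‖g p - 1‖) atTop (𝓝 (∑' p, ‖g p - 1‖)) :=
    hg.hasSum
  have h2 : Tendsto (fun S : Finset ι =>
      Real.exp (∑' p, ‖g p - 1‖ - ∑ p ∈ S, ‖g p - 1‖) - 1) atTop (𝓝 0) := by
    have h3 := ((Real.continuous_exp.tendsto _).comp (h1.const_sub (∑' p, ‖g p - 1‖))).sub_const 1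
    simpa using h3
  exact squeeze_zero (fun _ => norm_nonneg _) (norm_tailProd_sub_one_le hg) h2

theorem norm_tailProd_le {g : ι → ℂ} (hg : Summable fun p => ‖g p - 1‖) (S : Finset ι) :
    ‖tailProd g S‖ ≤ Real.exp (∑' p, ‖g p - 1‖) := by
  have h1 := norm_tailProd_sub_one_le hg S
  have h2 : Real.exp (∑' p, ‖g p - 1‖ - ∑ p ∈ S, ‖g p - 1‖) ≤ Real.exp (∑' p, ‖g p - 1‖) := by
    gcongr
    have : 0 ≤ ∑ p ∈ S, ‖g p - 1‖ := Finset.sum_nonneg fun _ _ => norm_nonneg _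
    linarith
  have h3 : ‖tailProd g S‖ ≤ ‖tailProd g S - 1‖ + 1 := by
    simpa using norm_add_le (tailProd g S - 1) 1
  linarith

/-- The functions supported in `S` with values `< N`. These sets exhaust `ι →₀ ℕ`, and a sum of
products over them factorises. -/
noncomputable def finsuppBox (S : Finset ι) (N : ℕ) : Finset (ι →₀ ℕ) :=
  S.finsupp fun _ => Finset.range N

theorem mem_finsuppBox {S : Finset ι} {N : ℕ} {f : ι →₀ ℕ} :
    f ∈ finsuppBox S N ↔ f.support ⊆ S ∧ ∀ p ∈ S, f p < N := by
  simp [finsuppBox, Finset.mem_finsupp_iff]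

theorem exists_subset_finsuppBox (u : Finset (ι →₀ ℕ)) :
    ∃ S₀ N₀, ∀ S N, S₀ ⊆ S → N₀ ≤ N → u ⊆ finsuppBox S N := by
  classical
  refine ⟨u.biUnion fun f => f.support, u.sup fun f => f.support.sup f + 1,
    fun S N hS hN f hf => ?_⟩
  have hfN : f.support.sup f + 1 ≤ N :=
    (Finset.le_sup (f := fun f : ι →₀ ℕ => f.support.sup f + 1) hf).trans hN
  refine mem_finsuppBox.mpr ⟨(Finset.subset_biUnion_of_mem (fun f => f.support) hf).trans hS,
    fun p _ => ?_⟩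
  by_cases hp : p ∈ f.support
  · have := Finset.le_sup (f := f) hp
    omega
  · rw [Finsupp.notMem_support_iff.mp hp]
    omega

theorem sum_finsuppBox_prod {R : Type*} [CommSemiring R] (F : ι → ℕ → R) (S : Finset ι) (N : ℕ) :
    ∑ f ∈ finsuppBox S N, ∏ p ∈ S, F p (f p) = ∏ p ∈ S, ∑ k ∈ Finset.range N, F p k := by
  classical
  rw [Finset.prod_sum, finsuppBox, Finset.finsupp, Finset.sum_map]
  refine Finset.sum_congr rfl fun g _ => ?_
  rw [← Finset.prod_attach]
  refine Finset.prod_congr rfl fun p _ => ?_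
  simp [Finsupp.indicator_of_mem p.2]

theorem summable_comp_finsupp {F : ι → ℕ → ℂ} (h0 : Summable fun p => ‖F p 0 - 1‖) (f : ι →₀ ℕ) :
    Summable fun p => ‖F p (f p) - 1‖ := by
  refine (summable_congr_cofinite ?_).mp h0
  rw [Filter.EventuallyEq, eventually_cofinite]
  refine f.support.finite_toSet.subset fun p hp => ?_
  by_contra h
  refine hp ?_
  simp [Finsupp.notMem_support_iff.mp h]

/-- For `f` supported in `S`, only the factors in `S` depend on `f`. -/
theorem tprod_finsupp_eq {F : ι → ℕ → ℂ} (h0 : Summable fun p => ‖F p 0 - 1‖) {f : ι →₀ ℕ}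
    {S : Finset ι} (hf : f.support ⊆ S) :
    ∏' p, F p (f p) = (∏ p ∈ S, F p (f p)) * tailProd (fun p => F p 0) S := by
  rw [tprod_eq_prod_mul_tailProd (summable_comp_finsupp h0 f) S]
  congr 1
  refine tprod_congr fun p => ?_
  by_cases hp : p ∈ S
  · simp [hp]
  · have : f p = 0 := Finsupp.notMem_support_iff.mp fun h => hp (hf h)
    simp [hp, this]

/-- An infinite product of series, multiplied out: the terms are indexed by the finitely supported
choices of indices. The summability of the result is a hypothesis, for only the product of the sums
`G p`, and not that of the sums of norms, has to converge. -/
theorem hasSum_finsupp_tprod {F : ι → ℕ → ℂ} {G : ι → ℂ} {g : ℂ}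
    (h0 : Summable fun p => ‖F p 0 - 1‖) (hF : ∀ p, HasSum (F p) (G p)) (hG : HasProd G g)
    (hsum : Summable fun f : ι →₀ ℕ => ∏' p, F p (f p)) :
    HasSum (fun f : ι →₀ ℕ => ∏' p, F p (f p)) g := by
  classical
  obtain ⟨a, ha⟩ := hsum
  suffices a = g from this ▸ ha
  have hbox : ∀ S N, ∑ f ∈ finsuppBox S N, ∏' p, F p (f p) =
      (∏ p ∈ S, ∑ k ∈ Finset.range N, F p k) * tailProd (fun p => F p 0) S := by
    intro S N
    rw [← sum_finsuppBox_prod, Finset.sum_mul]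
    exact Finset.sum_congr rfl fun f hf => tprod_finsupp_eq h0 (mem_finsuppBox.mp hf).1
  have hlim : Tendsto (fun S : Finset ι => (∏ p ∈ S, G p) * tailProd (fun p => F p 0) S) atTop
      (𝓝 (g * 1)) := Tendsto.mul hG (tendsto_tailProd h0)
  rw [mul_one] at hlim
  refine tendsto_nhds_unique ?_ hlim
  rw [Metric.tendsto_atTop]
  intro ε hε
  obtain ⟨u, hu⟩ := (Metric.tendsto_atTop.mp ha) (ε / 2) (half_pos hε)
  obtain ⟨S₀, N₀, hSN⟩ := exists_subset_finsuppBox u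
  refine ⟨S₀, fun S hS => lt_of_le_of_lt ?_ (half_lt_self hε)⟩
  -- for a fixed set `S` of factors the partial sums over boxes converge as their height `N` grows
  have hN : Tendsto (fun N => dist ((∏ p ∈ S, ∑ k ∈ Finset.range N, F p k) *
      tailProd (fun p => F p 0) S) a) atTop
      (𝓝 (dist ((∏ p ∈ S, G p) * tailProd (fun p => F p 0) S) a)) := by
    refine Tendsto.dist (Tendsto.mul_const _ ?_) tendsto_const_nhds
    exact tendsto_finsetProd _ fun p _ => (hF p).tendsto_sum_nat
  refine le_of_tendsto hN ?_
  filter_upwards [eventually_ge_atTop N₀] with N hN'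
  rw [← hbox]
  exact (hu _ (hSN S N hS hN')).le

/-- Square summability of an infinite product of sequences. -/
theorem summable_finsupp_norm_tprod_sq {F : ι → ℕ → ℂ} {A : ι → ℝ} {C : ℝ}
    (h0 : Summable fun p => ‖F p 0 - 1‖) (hF : ∀ p, HasSum (fun k => ‖F p k‖ ^ 2) (A p))
    (hC : ∀ S : Finset ι, ∏ p ∈ S, A p ≤ C) :
    Summable fun f : ι →₀ ℕ => ‖∏' p, F p (f p)‖ ^ 2 := by
  set D := Real.exp (∑' p, ‖F p 0 - 1‖) with hD
  have hC0 : 0 ≤ C := le_trans (by simp) (hC ∅)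
  refine summable_of_sum_le (c := C * D ^ 2) (fun f => sq_nonneg _) fun u => ?_
  obtain ⟨S, N, hSN⟩ := exists_subset_finsuppBox u
  calc ∑ f ∈ u, ‖∏' p, F p (f p)‖ ^ 2
      ≤ ∑ f ∈ finsuppBox S N, ‖∏' p, F p (f p)‖ ^ 2 :=
        Finset.sum_le_sum_of_subset_of_nonneg (hSN S N subset_rfl le_rfl)
          fun _ _ _ => sq_nonneg _
    _ = (∏ p ∈ S, ∑ k ∈ Finset.range N, ‖F p k‖ ^ 2) * ‖tailProd (fun p => F p 0) S‖ ^ 2 := by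
        rw [← sum_finsuppBox_prod, Finset.sum_mul]
        refine Finset.sum_congr rfl fun f hf => ?_
        rw [tprod_finsupp_eq h0 (mem_finsuppBox.mp hf).1, norm_mul, mul_pow, norm_prod,
          Finset.prod_pow]
    _ ≤ C * D ^ 2 := by
        refine mul_le_mul ?_ ?_ (sq_nonneg _) hC0
        · refine le_trans (Finset.prod_le_prod (fun p _ => Finset.sum_nonneg fun _ _ => sq_nonneg _)
            fun p _ => ?_) (hC S)
          exact sum_le_hasSum _ (fun _ _ => sq_nonneg _) (hF p)
        · exact pow_le_pow_left₀ (norm_nonneg _) (norm_tailProd_le h0 S) 2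

/-- The distributive law for the termwise product of two square summable families. -/
theorem hasSum_finsupp_tprod_mul_tprod {F F' : ι → ℕ → ℂ} {A A' : ι → ℝ} {C C' : ℝ} {G : ι → ℂ}
    {g : ℂ} (h0 : Summable fun p => ‖F p 0 - 1‖) (h0' : Summable fun p => ‖F' p 0 - 1‖)
    (hF : ∀ p, HasSum (fun k => ‖F p k‖ ^ 2) (A p))
    (hF' : ∀ p, HasSum (fun k => ‖F' p k‖ ^ 2) (A' p))
    (hC : ∀ S : Finset ι, ∏ p ∈ S, A p ≤ C) (hC' : ∀ S : Finset ι, ∏ p ∈ S, A' p ≤ C')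
    (hFF : ∀ p, HasSum (fun k => F p k * F' p k) (G p)) (hG : HasProd G g) :
    HasSum (fun f : ι →₀ ℕ => (∏' p, F p (f p)) * ∏' p, F' p (f p)) g := by
  have hmul : ∀ f : ι →₀ ℕ, (∏' p, F p (f p)) * ∏' p, F' p (f p) =
      ∏' p, F p (f p) * F' p (f p) := fun f =>
    ((multipliable_of_summable_norm_sub_one (summable_comp_finsupp h0 f)).tprod_mul
      (multipliable_of_summable_norm_sub_one (summable_comp_finsupp h0' f))).symm
  have h00 : Summable fun p => ‖F p 0 * F' p 0 - 1‖ := summable_norm_mul_sub_one h0 h0'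
  have hsum : Summable fun f : ι →₀ ℕ => ∏' p, F p (f p) * F' p (f p) := by
    refine Summable.of_norm_bounded ((summable_finsupp_norm_tprod_sq h0 hF hC).add
      (summable_finsupp_norm_tprod_sq h0' hF' hC')) fun f => ?_
    rw [← hmul, norm_mul]
    nlinarith [sq_nonneg (‖∏' p, F p (f p)‖ - ‖∏' p, F' p (f p)‖),
      sq_nonneg ‖∏' p, F p (f p)‖, sq_nonneg ‖∏' p, F' p (f p)‖]
  simp only [hmul]
  exact hasSum_finsupp_tprod (F := fun p k => F p k * F' p k) h00 hFF hG hsum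

end Distributive

/-! ### Infinite tensor products of diagonalised matrices -/

/-- The rows of `u` form a complete orthonormal system of eigenvectors, with eigenvalues `μ`, of the
infinite matrix `A`. -/
structure IsEigenmatrix (A : ℕ → ℕ → ℝ) (μ : ℕ → ℝ) (u : ℕ → ℕ → ℂ) : Prop where
  row : ∀ k k', HasSum (fun j => conj (u k j) * u k' j) (if k = k' then 1 else 0)
  col : ∀ j, HasSum (fun k => ‖u k j‖ ^ 2) 1
  expand : ∀ j j', HasSum (fun k => (μ k : ℂ) * u k j * conj (u k j')) (A j j')

/-- An orthonormal system whose Bessel sums for the vectors `e n` are all equal to `‖e n‖²` has the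
same closed span as the vectors `e n`. Here the vectors `e n` are assumed to span a dense subspace, so
that nothing is orthogonal to `v`. -/
theorem Orthonormal.orthogonal_span_eq_bot {H : Type*} [NormedAddCommGroup H]
    [InnerProductSpace ℂ H] {ι κ : Type*} {v : ι → H} (hv : Orthonormal ℂ v) {e : κ → H}
    (he : ∀ x : H, (∀ n, inner ℂ (e n) x = 0) → x = 0)
    (hve : ∀ n, HasSum (fun i => ‖inner ℂ (v i) (e n)‖ ^ 2) (‖e n‖ ^ 2)) :
    (Submodule.span ℂ (Set.range v))ᗮ = ⊥ := by
  rw [Submodule.eq_bot_iff]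
  intro x hx
  refine he x fun n => ?_
  have hxv : ∀ i, inner ℂ (v i) x = 0 := fun i =>
    (Submodule.mem_orthogonal _ _).mp hx _ (Submodule.subset_span ⟨i, rfl⟩)
  set y := e n
  have hdist : ∀ s : Finset ι, ‖y - ∑ i ∈ s, inner ℂ (v i) y • v i‖ ^ 2 =
      ‖y‖ ^ 2 - ∑ i ∈ s, ‖inner ℂ (v i) y‖ ^ 2 := by
    intro s
    have h1 : ‖∑ i ∈ s, inner ℂ (v i) y • v i‖ ^ 2 = ∑ i ∈ s, ‖inner ℂ (v i) y‖ ^ 2 := by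
      have h := hv.inner_sum (fun i => inner ℂ (v i) y) (fun i => inner ℂ (v i) y) s
      rw [inner_self_eq_norm_sq_to_K] at h
      simp only [RCLike.conj_mul] at h
      refine Complex.ofReal_injective ?_
      push_cast
      exact h
    have h2 : RCLike.re (inner ℂ y (∑ i ∈ s, inner ℂ (v i) y • v i)) =
        ∑ i ∈ s, ‖inner ℂ (v i) y‖ ^ 2 := by
      rw [inner_sum, map_sum]
      refine Finset.sum_congr rfl fun i _ => ?_
      rw [inner_smul_right, ← inner_conj_symm y, RCLike.mul_conj, ← RCLike.ofReal_pow,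
        RCLike.ofReal_re]
    rw [@norm_sub_sq ℂ, h1, h2]
    ring
  have hbound : ∀ s : Finset ι, ‖inner ℂ y x‖ ^ 2 ≤
      (‖y‖ ^ 2 - ∑ i ∈ s, ‖inner ℂ (v i) y‖ ^ 2) * ‖x‖ ^ 2 := by
    intro s
    have h1 : inner ℂ y x = inner ℂ (y - ∑ i ∈ s, inner ℂ (v i) y • v i) x := by
      rw [inner_sub_left, sum_inner]
      simp [inner_smul_left, hxv]
    rw [← hdist, h1, ← mul_pow]
    exact pow_le_pow_left₀ (norm_nonneg _) (norm_inner_le_norm _ _) 2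
  have hlim : Tendsto (fun s : Finset ι =>
      (‖y‖ ^ 2 - ∑ i ∈ s, ‖inner ℂ (v i) y‖ ^ 2) * ‖x‖ ^ 2) atTop (𝓝 0) := by
    have h := (Tendsto.const_sub (‖y‖ ^ 2) (hve n)).mul_const (‖x‖ ^ 2)
    rwa [sub_self, zero_mul] at h
  have h0 := ge_of_tendsto' hlim hbound
  have h1 : ‖inner ℂ y x‖ = 0 := pow_eq_zero_iff two_ne_zero |>.mp (le_antisymm h0 (sq_nonneg _))
  exact norm_eq_zero.mp h1

section TensorProduct

variable {ι : Type} {A : ι → ℕ → ℕ → ℝ} {μ : ι → ℕ → ℝ} {u : ι → ℕ → ℕ → ℂ}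

theorem summable_row (hu0 : Summable fun p => ‖u p 0 0 - 1‖) (f : ι →₀ ℕ) :
    Summable fun p => ‖u p (f p) 0 - 1‖ :=
  summable_comp_finsupp (F := fun p k => u p k 0) hu0 f

theorem summable_col (hu0 : Summable fun p => ‖u p 0 0 - 1‖) (g : ι →₀ ℕ) :
    Summable fun p => ‖u p 0 (g p) - 1‖ :=
  summable_comp_finsupp (F := fun p j => u p 0 j) hu0 g

theorem Summable.norm_conj_sub_one {F : ι → ℂ} (h : Summable fun p => ‖F p - 1‖) :
    Summable fun p => ‖conj (F p) - 1‖ := by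
  refine h.congr fun p => ?_
  rw [← RCLike.norm_conj (F p - 1), map_sub, map_one]

theorem conj_tprod {F : ι → ℂ} (h : Summable fun p => ‖F p - 1‖) :
    conj (∏' p, F p) = ∏' p, conj (F p) := by
  have h1 := (multipliable_of_summable_norm_sub_one h).hasProd.map (starRingEnd ℂ)
    Complex.continuous_conj
  exact h1.tprod_eq.symm

theorem ofReal_tprod {F : ι → ℝ} (h : Summable fun p => ‖(F p : ℂ) - 1‖) :
    ((∏' p, F p : ℝ) : ℂ) = ∏' p, (F p : ℂ) := by
  have h0 : Summable fun p => ‖F p - 1‖ := by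
    refine h.congr fun p => ?_
    rw [← Complex.norm_real]
    push_cast
    rfl
  have h1 : Multipliable F := by
    have := multipliable_one_add_of_summable h0
    simpa using this
  exact (h1.hasProd.map Complex.ofRealHom Complex.continuous_ofReal).tprod_eq.symm

/-- The rows of the tensor product of the `u p` are orthonormal. -/
theorem hasSum_row_tprod (h : ∀ p, IsEigenmatrix (A p) (μ p) (u p))
    (hu0 : Summable fun p => ‖u p 0 0 - 1‖) (f f' : ι →₀ ℕ) :
    HasSum (fun g : ι →₀ ℕ => conj (∏' p, u p (f p) (g p)) * ∏' p, u p (f' p) (g p))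
      (open Classical in if f = f' then 1 else 0) := by
  classical
  have hnorm : ∀ (f : ι →₀ ℕ) p, HasSum (fun j => ‖u p (f p) j‖ ^ 2) 1 := by
    intro f p
    have h1 := (h p).row (f p) (f p)
    rw [if_pos rfl] at h1
    have h2 : (fun j => conj (u p (f p) j) * u p (f p) j) =
        fun j => ((‖u p (f p) j‖ ^ 2 : ℝ) : ℂ) := by
      funext j
      rw [RCLike.conj_mul]
      push_cast
      rfl
    rw [h2, ← Complex.ofReal_one] at h1
    exact Complex.hasSum_ofReal.mp h1
  have hprod : HasProd (fun p => if f p = f' p then (1 : ℂ) else 0) (if f = f' then 1 else 0) := by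
    have h1 := hasProd_prod_of_ne_finset_one (f := fun p => if f p = f' p then (1 : ℂ) else 0)
      (s := f.support ∪ f'.support) (L := SummationFilter.unconditional ι) fun p hp => by
        rw [Finset.notMem_union, Finsupp.notMem_support_iff, Finsupp.notMem_support_iff] at hp
        rw [hp.1, hp.2, if_pos rfl]
    convert h1 using 1
    by_cases hff : f = f'
    · rw [if_pos hff]
      refine (Finset.prod_eq_one fun p _ => ?_).symm
      rw [hff, if_pos rfl]
    · rw [if_neg hff]
      obtain ⟨p, hp⟩ := DFunLike.ne_iff.mp hff
      refine (Finset.prod_eq_zero (i := p) ?_ (if_neg hp)).symm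
      by_contra hmem
      rw [Finset.notMem_union, Finsupp.notMem_support_iff, Finsupp.notMem_support_iff] at hmem
      exact hp (hmem.1.trans hmem.2.symm)
  have h1 := hasSum_finsupp_tprod_mul_tprod (C := 1) (C' := 1)
    (F := fun p j => conj (u p (f p) j)) (F' := fun p j => u p (f' p) j)
    (summable_row hu0 f).norm_conj_sub_one (summable_row hu0 f')
    (fun p => by simpa using hnorm f p) (hnorm f') (by simp) (by simp)
    (fun p => (h p).row (f p) (f' p)) hprod
  refine h1.congr_fun fun g => ?_
  rw [conj_tprod (summable_comp_finsupp (summable_row hu0 f) g)]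

theorem hasSum_col_tprod (h : ∀ p, IsEigenmatrix (A p) (μ p) (u p))
    (hu0 : Summable fun p => ‖u p 0 0 - 1‖) (g : ι →₀ ℕ) :
    HasSum (fun f : ι →₀ ℕ => ‖∏' p, u p (f p) (g p)‖ ^ 2) 1 := by
  have hcol : ∀ p, HasSum (fun k => u p k (g p) * conj (u p k (g p))) 1 := by
    intro p
    have h1 := (h p).col (g p)
    have h2 : (fun k => u p k (g p) * conj (u p k (g p))) =
        fun k => ((‖u p k (g p)‖ ^ 2 : ℝ) : ℂ) := by
      funext j
      rw [RCLike.mul_conj]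
      push_cast
      rfl
    rw [h2, ← Complex.ofReal_one]
    exact Complex.hasSum_ofReal.mpr h1
  have h1 := hasSum_finsupp_tprod_mul_tprod (C := 1) (C' := 1)
    (F := fun p k => u p k (g p)) (F' := fun p k => conj (u p k (g p)))
    (summable_col hu0 g) (summable_col hu0 g).norm_conj_sub_one
    (fun p => (h p).col (g p)) (fun p => by simpa using (h p).col (g p)) (by simp) (by simp)
    hcol hasProd_one
  have h2 : (fun f : ι →₀ ℕ => (∏' p, u p (f p) (g p)) * ∏' p, conj (u p (f p) (g p))) =
      fun f : ι →₀ ℕ => ((‖∏' p, u p (f p) (g p)‖ ^ 2 : ℝ) : ℂ) := by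
    funext f
    rw [← conj_tprod (summable_comp_finsupp (F := fun p k => u p k (g p)) (summable_col hu0 g) f),
      RCLike.mul_conj]
    push_cast
    rfl
  rw [h2, ← Complex.ofReal_one] at h1
  exact Complex.hasSum_ofReal.mp h1

/-- The spectral expansion of the tensor product of the matrices `A p`. -/
theorem hasSum_expand_tprod (h : ∀ p, IsEigenmatrix (A p) (μ p) (u p))
    (hu0 : Summable fun p => ‖u p 0 0 - 1‖) (hμ0 : Summable fun p => |μ p 0 - 1|)
    (hanti : ∀ p, Antitone (μ p)) (hpos : ∀ p k, 0 < μ p k) (hA0 : ∀ p, A p 0 0 = 1)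
    (g g' : ι →₀ ℕ) :
    HasSum (fun f : ι →₀ ℕ => ((∏' p, μ p (f p) : ℝ) : ℂ) *
        (∏' p, u p (f p) (g p)) * conj (∏' p, u p (f p) (g' p)))
      ((∏' p, A p (g p) (g' p) : ℝ) : ℂ) := by
  have hμ0' : Summable fun p => ‖((μ p 0 : ℝ) : ℂ) - 1‖ := by
    refine hμ0.congr fun p => ?_
    rw [← Complex.ofReal_one, ← Complex.ofReal_sub, Complex.norm_real, Real.norm_eq_abs]
  have hF : ∀ p, HasSum (fun k => ‖(μ p k : ℂ) * u p k (g p)‖ ^ 2)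
      (∑' k, ‖(μ p k : ℂ) * u p k (g p)‖ ^ 2) ∧
      ∑' k, ‖(μ p k : ℂ) * u p k (g p)‖ ^ 2 ≤ μ p 0 ^ 2 := by
    intro p
    have h1 := ((h p).col (g p)).mul_left (μ p 0 ^ 2)
    have h2 : ∀ k, ‖(μ p k : ℂ) * u p k (g p)‖ ^ 2 ≤ μ p 0 ^ 2 * ‖u p k (g p)‖ ^ 2 := by
      intro k
      rw [norm_mul, mul_pow, Complex.norm_real, Real.norm_of_nonneg (hpos p k).le]
      have := hpos p k
      have := hanti p (Nat.zero_le k)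
      gcongr
    have h3 := h1.summable.of_nonneg_of_le (fun k => sq_nonneg _) h2
    refine ⟨h3.hasSum, ?_⟩
    have h4 := hasSum_le h2 h3.hasSum h1
    rwa [mul_one] at h4
  have hC : ∀ S : Finset ι, ∏ p ∈ S, ∑' k, ‖(μ p k : ℂ) * u p k (g p)‖ ^ 2 ≤
      Real.exp (∑' p, |μ p 0 - 1|) ^ 2 := by
    intro S
    calc ∏ p ∈ S, ∑' k, ‖(μ p k : ℂ) * u p k (g p)‖ ^ 2
        ≤ ∏ p ∈ S, μ p 0 ^ 2 :=
          Finset.prod_le_prod (fun p _ => tsum_nonneg fun _ => sq_nonneg _) fun p _ => (hF p).2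
      _ = (∏ p ∈ S, μ p 0) ^ 2 := Finset.prod_pow _ _ _
      _ ≤ (∏ p ∈ S, (1 + |μ p 0 - 1|)) ^ 2 := by
          refine pow_le_pow_left₀ (Finset.prod_nonneg fun p _ => (hpos p 0).le) ?_ 2
          refine Finset.prod_le_prod (fun p _ => (hpos p 0).le) fun p _ => ?_
          have := le_abs_self (μ p 0 - 1)
          linarith
      _ ≤ _ := by
          refine pow_le_pow_left₀ (Finset.prod_nonneg fun p _ => by positivity) ?_ 2
          refine (Real.prod_one_add_le_exp_sum S fun p => abs_nonneg (μ p 0 - 1)).trans ?_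
          gcongr
          exact hμ0.sum_le_tsum S fun p _ => abs_nonneg _
  have hprod : HasProd (fun p => ((A p (g p) (g' p) : ℝ) : ℂ))
      ((∏' p, A p (g p) (g' p) : ℝ) : ℂ) := by
    classical
    have h1 : Multipliable fun p => A p (g p) (g' p) := by
      refine (hasProd_prod_of_ne_finset_one (s := g.support ∪ g'.support) fun p hp => ?_).multipliable
      rw [Finset.notMem_union, Finsupp.notMem_support_iff, Finsupp.notMem_support_iff] at hp
      rw [hp.1, hp.2, hA0]
    exact h1.hasProd.map Complex.ofRealHom Complex.continuous_ofReal
  have h1 := hasSum_finsupp_tprod_mul_tprod (C' := 1)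
    (F := fun p k => (μ p k : ℂ) * u p k (g p)) (F' := fun p k => conj (u p k (g' p)))
    (summable_norm_mul_sub_one hμ0' (summable_col hu0 g)) (summable_col hu0 g').norm_conj_sub_one
    (fun p => (hF p).1) (fun p => by simpa using (h p).col (g' p)) hC (by simp)
    (fun p => (h p).expand (g p) (g' p)) hprod
  refine h1.congr_fun fun f => ?_
  have hμf := summable_comp_finsupp (F := fun p k => ((μ p k : ℝ) : ℂ)) hμ0' f
  have huf := summable_comp_finsupp (F := fun p k => u p k (g p)) (summable_col hu0 g) f
  rw [conj_tprod (summable_comp_finsupp (F := fun p k => u p k (g' p)) (summable_col hu0 g') f),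
    ofReal_tprod hμf, ← (multipliable_of_summable_norm_sub_one hμf).tprod_mul
      (multipliable_of_summable_norm_sub_one huf)]

/-- The infinite tensor product of diagonalised matrices is diagonalised by the tensor products of
the eigenvectors; the eigenvalues are the products of the eigenvalues. -/
theorem exists_tensor_operator {κ : Type} [DecidableEq κ] (v : κ ≃ (ι →₀ ℕ))
    (h : ∀ p, IsEigenmatrix (A p) (μ p) (u p))
    (hu0 : Summable fun p => ‖u p 0 0 - 1‖) (hμ0 : Summable fun p => |μ p 0 - 1|)
    (hanti : ∀ p, Antitone (μ p)) (hpos : ∀ p k, 0 < μ p k) (hA0 : ∀ p, A p 0 0 = 1)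
    (hlim : Tendsto (fun n => ∏' p, μ p (v n p)) cofinite (𝓝 0)) :
    ∃ T : EllTwo κ →L[ℂ] EllTwo κ,
      IsMatrixOperator (fun n m => ∏' p, A p (v n p) (v m p)) T ∧ IsCompactOperator T ∧
      T.IsPositive ∧ ∃ b : HilbertBasis κ ℂ (EllTwo κ),
        ∀ n, T (b n) = ((∏' p, μ p (v n p) : ℝ) : ℂ) • b n := by
  classical
  have hrow : ∀ n n', HasSum (fun m => conj (∏' p, u p (v n p) (v m p)) *
      ∏' p, u p (v n' p) (v m p)) (if n = n' then 1 else 0) := by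
    intro n n'
    have h1 := v.hasSum_iff.mpr (hasSum_row_tprod h hu0 (v n) (v n'))
    have h2 : (if v n = v n' then (1 : ℂ) else 0) = if n = n' then 1 else 0 := by
      simp only [v.injective.eq_iff]
    rw [← h2]
    exact h1
  have hsq : ∀ n, Summable fun m => ‖∏' p, u p (v n p) (v m p)‖ ^ 2 := by
    intro n
    have h1 := (hrow n n).summable.norm
    refine h1.congr fun m => ?_
    rw [norm_mul, RCLike.norm_conj, sq]
  let e : κ → EllTwo κ := fun n => ⟨fun m => ∏' p, u p (v n p) (v m p),
    memℓp_gen (by simpa using hsq n)⟩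
  have he_apply : ∀ n m, e n m = ∏' p, u p (v n p) (v m p) := fun _ _ => rfl
  have he : Orthonormal ℂ e := by
    rw [orthonormal_iff_ite]
    intro n n'
    refine (lp.hasSum_inner (𝕜 := ℂ) (e n) (e n')).unique ((hrow n n').congr_fun fun m => ?_)
    rw [RCLike.inner_apply, mul_comm]
  have hbot : (Submodule.span ℂ (Set.range e))ᗮ = ⊥ := by
    refine he.orthogonal_span_eq_bot (e := fun n => (lp.single 2 n (1 : ℂ) : EllTwo κ))
      (fun x hx => ?_) fun m => ?_
    · ext n
      have := hx n
      rwa [EllTwo.inner_single_left] at this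
    · have h1 := v.hasSum_iff.mpr (hasSum_col_tprod h hu0 (v m))
      rw [lp.norm_single (by simp), norm_one, one_pow]
      refine h1.congr_fun fun n => ?_
      rw [← inner_conj_symm, EllTwo.inner_single_left, RCLike.norm_conj]
      rfl
  let b : HilbertBasis κ ℂ (EllTwo κ) := HilbertBasis.mkOfOrthogonalEqBot he hbot
  have hb : ⇑b = e := HilbertBasis.coe_mkOfOrthogonalEqBot he hbot
  obtain ⟨T, hT⟩ := he.summable_rankOne hlim
  have hΛ : ∀ n, 0 ≤ ∏' p, μ p (v n p) := fun n => tprod_nonneg fun p => (hpos p _).le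
  refine ⟨T, isMatrixOperator_of_entries fun n m => ?_, isCompactOperator_of_hasSum_rankOne hT,
    isPositive_of_hasSum_rankOne hΛ hT, b, fun n => ?_⟩
  · have h1 := hT.mapL (ContinuousLinearMap.apply ℂ (EllTwo κ) (lp.single 2 m (1 : ℂ) : EllTwo κ))
    have h2 := h1.mapL (innerSL ℂ (lp.single 2 n (1 : ℂ) : EllTwo κ))
    simp only [innerSL_apply_apply, EllTwo.inner_single_left, ContinuousLinearMap.apply_apply] at h2
    have h3 := v.hasSum_iff.mpr (hasSum_expand_tprod h hu0 hμ0 hanti hpos hA0 (v n) (v m))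
    refine h2.unique (h3.congr_fun fun k => ?_)
    simp only [smul_apply, InnerProductSpace.rankOne_apply, lp.coeFn_smul, Pi.smul_apply,
      smul_eq_mul, lp.inner_single_right, he_apply, Function.comp_apply]
    simp
    ring
  · have h1 := hT.mapL (ContinuousLinearMap.apply ℂ (EllTwo κ) (e n))
    simp only [ContinuousLinearMap.apply_apply] at h1
    have h2 := h1.unique (hasSum_single n fun k hk => by
      rw [smul_apply, InnerProductSpace.rankOne_apply, he.2 hk, zero_smul, smul_zero])
    rw [hb, h2, smul_apply, InnerProductSpace.rankOne_apply, inner_self_eq_norm_sq_to_K, he.1]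
    simp

end TensorProduct

/-! ### Counting integers with a multiplicative weight -/

section Counting

/-- The part over the primes in `S` of the multiplicative weight with local values `h p k` at
`p ^ k`. -/
noncomputable def primeWeight (h : Nat.Primes → ℕ → ℝ) (S : Finset Nat.Primes) (n : ℕ) : ℝ :=
  ∏ p ∈ S, h p (n.factorization p)

/-- The positive integers `n ≤ x` with `n ≤ x * w n`, where `w` is the weight over the primes
in `S`. -/
noncomputable def weightedSet (h : Nat.Primes → ℕ → ℝ) (S : Finset Nat.Primes) (x : ℝ) :
    Finset ℕ :=
  open Classical in {n ∈ Finset.Ioc 0 ⌊x⌋₊ | (n : ℝ) ≤ x * primeWeight h S n}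

variable {h : Nat.Primes → ℕ → ℝ}

theorem primeWeight_pos (hpos : ∀ p k, 0 < h p k) (S : Finset Nat.Primes) (n : ℕ) :
    0 < primeWeight h S n := Finset.prod_pos fun p _ => hpos p _

theorem primeWeight_le_one (hpos : ∀ p k, 0 < h p k) (hle : ∀ p k, h p k ≤ 1)
    (S : Finset Nat.Primes) (n : ℕ) : primeWeight h S n ≤ 1 :=
  Finset.prod_le_one (fun p _ => (hpos p _).le) fun p _ => hle p _

theorem mem_weightedSet (hpos : ∀ p k, 0 < h p k) (hle : ∀ p k, h p k ≤ 1)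
    {S : Finset Nat.Primes} {x : ℝ} (hx : 0 ≤ x) {n : ℕ} :
    n ∈ weightedSet h S x ↔ 0 < n ∧ (n : ℝ) ≤ x * primeWeight h S n := by
  simp only [weightedSet, Finset.mem_filter, Finset.mem_Ioc]
  refine ⟨fun hn => ⟨hn.1.1, hn.2⟩, fun hn => ⟨⟨hn.1, ?_⟩, hn.2⟩⟩
  exact Nat.le_floor (hn.2.trans (mul_le_of_le_one_right hx (primeWeight_le_one hpos hle S n)))

theorem card_weightedSet_le (S : Finset Nat.Primes) {x : ℝ} (hx : 0 ≤ x) :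
    ((weightedSet h S x).card : ℝ) ≤ x := by
  have h1 : (weightedSet h S x).card ≤ ⌊x⌋₊ := by
    refine (Finset.card_filter_le _ _).trans ?_
    simp
  exact (Nat.cast_le.mpr h1).trans (Nat.floor_le hx)

theorem primeWeight_prime_pow_mul {S : Finset Nat.Primes} {p : Nat.Primes} (hp : p ∉ S) (k : ℕ)
    {m : ℕ} (hm : m ≠ 0) : primeWeight h S ((p : ℕ) ^ k * m) = primeWeight h S m := by
  refine Finset.prod_congr rfl fun q hq => ?_
  have hqp : (q : ℕ) ≠ p := fun hqp => hp (Subtype.ext hqp ▸ hq)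
  rw [Nat.factorization_mul (pow_ne_zero _ p.2.ne_zero) hm, p.2.factorization_pow]
  simp [Finsupp.single_eq_of_ne hqp]

/-- The elements of `weightedSet h S y` divisible by a prime `p` outside `S` correspond to
`weightedSet h S (y / p)`. -/
theorem card_filter_dvd_weightedSet (hpos : ∀ p k, 0 < h p k) (hle : ∀ p k, h p k ≤ 1)
    {S : Finset Nat.Primes} {p : Nat.Primes} (hp : p ∉ S) {y : ℝ} (hy : 0 ≤ y) :
    ({n ∈ weightedSet h S y | (p : ℕ) ∣ n}).card = (weightedSet h S (y / (p : ℕ))).card := by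
  have hp0 : (0 : ℝ) < ((p : ℕ) : ℝ) := by exact_mod_cast p.2.pos
  refine Finset.card_nbij' (fun n => n / p) (fun m => p * m) ?_ ?_ ?_ ?_
  · intro n hn
    obtain ⟨hn1, m, rfl⟩ := Finset.mem_filter.mp hn
    rw [mem_weightedSet hpos hle hy] at hn1
    have hm : m ≠ 0 := by
      rintro rfl
      simp at hn1
    change (p : ℕ) * m / p ∈ weightedSet h S (y / (p : ℕ))
    rw [Nat.mul_div_cancel_left _ p.2.pos, mem_weightedSet hpos hle (by positivity)]
    have hw := primeWeight_prime_pow_mul (h := h) hp 1 hm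
    rw [pow_one] at hw
    refine ⟨Nat.pos_of_ne_zero hm, ?_⟩
    have h2 := hn1.2
    rw [hw] at h2
    push_cast at h2
    rw [div_mul_eq_mul_div, le_div_iff₀ hp0]
    linarith
  · intro m hm
    have hm' := (mem_weightedSet hpos hle (by positivity)).mp hm
    have hw := primeWeight_prime_pow_mul (h := h) hp 1 hm'.1.ne'
    rw [pow_one] at hw
    refine Finset.mem_filter.mpr ⟨?_, Dvd.intro _ rfl⟩
    rw [mem_weightedSet hpos hle hy, hw]
    refine ⟨Nat.mul_pos p.2.pos hm'.1, ?_⟩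
    have h2 := hm'.2
    rw [div_mul_eq_mul_div, le_div_iff₀ hp0] at h2
    push_cast
    linarith
  · intro n hn
    obtain ⟨hn1, hdvd⟩ := Finset.mem_filter.mp hn
    exact Nat.mul_div_cancel' hdvd
  · intro m hm
    exact Nat.mul_div_cancel_left _ p.2.pos

/-- The elements of `weightedSet h (insert p S) x` that are exactly divisible by `p ^ k`. -/
theorem card_filter_factorization_weightedSet (hpos : ∀ p k, 0 < h p k) (hle : ∀ p k, h p k ≤ 1)
    {S : Finset Nat.Primes} {p : Nat.Primes} (hp : p ∉ S) {x : ℝ} (hx : 0 ≤ x) (k : ℕ) :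
    ({n ∈ weightedSet h (insert p S) x | n.factorization p = k}).card =
      ({m ∈ weightedSet h S (x * h p k / ((p : ℕ) : ℝ) ^ k) | ¬ (p : ℕ) ∣ m}).card := by
  have hp0 : (0 : ℝ) < ((p : ℕ) : ℝ) ^ k := pow_pos (by exact_mod_cast p.2.pos) k
  have hy : 0 ≤ x * h p k / ((p : ℕ) : ℝ) ^ k := by
    have := hpos p k
    positivity
  have hw : ∀ m : ℕ, m ≠ 0 → ¬ (p : ℕ) ∣ m →
      primeWeight h (insert p S) ((p : ℕ) ^ k * m) = h p k * primeWeight h S m ∧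
        ((p : ℕ) ^ k * m).factorization p = k := by
    intro m hm hpm
    have hfac : ((p : ℕ) ^ k * m).factorization p = k := by
      rw [Nat.factorization_mul (pow_ne_zero _ p.2.ne_zero) hm, p.2.factorization_pow]
      simp [Nat.factorization_eq_zero_of_not_dvd hpm]
    refine ⟨?_, hfac⟩
    have h1 : primeWeight h (insert p S) ((p : ℕ) ^ k * m) =
        h p (((p : ℕ) ^ k * m).factorization p) * primeWeight h S ((p : ℕ) ^ k * m) :=
      Finset.prod_insert hp
    rw [h1, hfac, primeWeight_prime_pow_mul hp k hm]
  refine Finset.card_nbij' (fun n => n / (p : ℕ) ^ k) (fun m => (p : ℕ) ^ k * m) ?_ ?_ ?_ ?_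
  · intro n hn
    obtain ⟨hn1, hfac⟩ := Finset.mem_filter.mp hn
    rw [mem_weightedSet hpos hle hx] at hn1
    have hmul : (p : ℕ) ^ k * (n / (p : ℕ) ^ k) = n := by
      have := Nat.ordProj_mul_ordCompl_eq_self n p
      rwa [hfac] at this
    have hndvd : ¬ (p : ℕ) ∣ n / (p : ℕ) ^ k := by
      have := Nat.not_dvd_ordCompl p.2 hn1.1.ne'
      rwa [hfac] at this
    have hm0 : n / (p : ℕ) ^ k ≠ 0 := by
      intro h0
      rw [h0, mul_zero] at hmul
      exact hn1.1.ne hmul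
    refine Finset.mem_filter.mpr ⟨?_, hndvd⟩
    rw [mem_weightedSet hpos hle hy]
    refine ⟨Nat.pos_of_ne_zero hm0, ?_⟩
    have h2 := hn1.2
    rw [← hmul, (hw _ hm0 hndvd).1] at h2
    push_cast at h2
    rw [div_mul_eq_mul_div, le_div_iff₀ hp0]
    linarith
  · intro m hm
    obtain ⟨hm1, hndvd⟩ := Finset.mem_filter.mp hm
    rw [mem_weightedSet hpos hle hy] at hm1
    have hw' := hw m hm1.1.ne' hndvd
    refine Finset.mem_filter.mpr ⟨?_, hw'.2⟩
    rw [mem_weightedSet hpos hle hx, hw'.1]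
    refine ⟨Nat.mul_pos (pow_pos p.2.pos k) hm1.1, ?_⟩
    have h2 := hm1.2
    rw [div_mul_eq_mul_div, le_div_iff₀ hp0] at h2
    push_cast
    linarith
  · intro n hn
    obtain ⟨-, hfac⟩ := Finset.mem_filter.mp hn
    have := Nat.ordProj_mul_ordCompl_eq_self n p
    rwa [hfac] at this
  · intro m hm
    exact Nat.mul_div_cancel_left _ (pow_pos p.2.pos k)

/-- The Euler factor of the density of the integers counted with the weight `h`. -/
noncomputable def densityFactor (h : Nat.Primes → ℕ → ℝ) (p : Nat.Primes) : ℝ :=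
  (1 - 1 / ((p : ℕ) : ℝ)) * ∑' k : ℕ, h p k / ((p : ℕ) : ℝ) ^ k

/-- Only finitely many primes carry a nontrivial weight: the counting function is computed by
adding the primes one at a time. -/
theorem tendsto_card_weightedSet (hpos : ∀ p k, 0 < h p k) (hle : ∀ p k, h p k ≤ 1)
    (S : Finset Nat.Primes) :
    Tendsto (fun x : ℝ => ((weightedSet h S x).card : ℝ) / x) atTop
      (𝓝 (∏ p ∈ S, densityFactor h p)) := by
  classical
  induction S using Finset.induction_on with
  | empty =>
    rw [Finset.prod_empty]
    refine tendsto_nat_floor_div_atTop.congr' ?_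
    filter_upwards [eventually_ge_atTop 0] with x hx
    congr 2
    have : weightedSet h ∅ x = Finset.Ioc 0 ⌊x⌋₊ := by
      ext n
      rw [mem_weightedSet hpos hle hx]
      simp only [primeWeight, Finset.prod_empty, mul_one, Finset.mem_Ioc, Nat.le_floor_iff hx]
    simp [this]
  | insert p S hp ih =>
    rw [Finset.prod_insert hp]
    set D := ∏ p ∈ S, densityFactor h p with hD
    have hp1 : (1 : ℝ) < ((p : ℕ) : ℝ) := by exact_mod_cast p.2.one_lt
    have hp0 : (0 : ℝ) < ((p : ℕ) : ℝ) := by linarith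
    -- `n = p ^ k * m` with `p ∤ m` is counted for the level `x` and the primes `insert p S` if and only
    -- if `m` is counted for the level `x * h p k / p ^ k` and the primes `S`
    let M : ℝ → ℝ := fun y => (({m ∈ weightedSet h S y | ¬ (p : ℕ) ∣ m}).card : ℝ)
    have hM : ∀ y, 0 ≤ y → M y =
        (weightedSet h S y).card - ((weightedSet h S (y / (p : ℕ))).card : ℝ) := by
      intro y hy
      have h1 := Finset.card_filter_add_card_filter_not (s := weightedSet h S y)
        (fun m => (p : ℕ) ∣ m)
      rw [card_filter_dvd_weightedSet hpos hle hp hy] at h1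
      have h2 : (((weightedSet h S (y / (p : ℕ))).card : ℕ) : ℝ) + M y =
          ((weightedSet h S y).card : ℝ) := by
        simp only [M]
        exact_mod_cast h1
      linarith
    have hM_le : ∀ y, 0 ≤ y → M y ≤ y := by
      intro y hy
      have := card_weightedSet_le (h := h) S (x := y) hy
      have := hM y hy
      have : (0 : ℝ) ≤ ((weightedSet h S (y / (p : ℕ))).card : ℝ) := Nat.cast_nonneg _
      linarith
    have hMlim : Tendsto (fun y => M y / y) atTop (𝓝 ((1 - 1 / ((p : ℕ) : ℝ)) * D)) := by
      have h1 : Tendsto (fun y : ℝ => y / ((p : ℕ) : ℝ)) atTop atTop :=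
        tendsto_id.atTop_div_const hp0
      have h2 := (ih.sub ((ih.comp h1).mul_const (1 / ((p : ℕ) : ℝ))))
      rw [show D - D * (1 / ((p : ℕ) : ℝ)) = (1 - 1 / ((p : ℕ) : ℝ)) * D by ring] at h2
      refine h2.congr' ?_
      filter_upwards [eventually_gt_atTop 0] with y hy
      rw [hM y hy.le, Function.comp_apply]
      field_simp
    have hterm : ∀ k, Tendsto (fun x : ℝ => M (x * h p k / ((p : ℕ) : ℝ) ^ k) / x) atTop
        (𝓝 (h p k / ((p : ℕ) : ℝ) ^ k * ((1 - 1 / ((p : ℕ) : ℝ)) * D))) := by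
      intro k
      have hc : 0 < h p k / ((p : ℕ) : ℝ) ^ k := div_pos (hpos p k) (pow_pos hp0 k)
      have h1 : Tendsto (fun x : ℝ => x * (h p k / ((p : ℕ) : ℝ) ^ k)) atTop atTop :=
        tendsto_id.atTop_mul_const hc
      have h2 := (hMlim.comp h1).const_mul (h p k / ((p : ℕ) : ℝ) ^ k)
      refine h2.congr' ?_
      filter_upwards [eventually_gt_atTop 0] with x hx
      rw [Function.comp_apply, mul_div_assoc x]
      generalize h p k / ((p : ℕ) : ℝ) ^ k = a at hc
      generalize hMa : M (x * a) = c
      field_simp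
    have hcard : ∀ x : ℝ, 0 ≤ x → ((weightedSet h (insert p S) x).card : ℝ) =
        ∑' k, M (x * h p k / ((p : ℕ) : ℝ) ^ k) := by
      intro x hx
      have h1 := Finset.card_eq_sum_card_fiberwise (f := fun n : ℕ => n.factorization p)
        (s := weightedSet h (insert p S) x) (t := Finset.range (⌊x⌋₊ + 1)) (by
          intro n hn
          have hn' := Finset.mem_Ioc.mp (Finset.mem_filter.mp hn).1
          simp only [Finset.coe_range, Set.mem_Iio]
          have := Nat.factorization_lt (p : ℕ) hn'.1.ne'
          omega)
      rw [tsum_eq_sum (s := Finset.range (⌊x⌋₊ + 1))]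
      · rw [h1]
        push_cast
        refine Finset.sum_congr rfl fun k _ => ?_
        rw [card_filter_factorization_weightedSet hpos hle hp hx k]
      · intro k hk
        have hk' : ⌊x⌋₊ < k := by simpa [Nat.lt_succ_iff] using hk
        have hempty : ({n ∈ weightedSet h (insert p S) x | n.factorization p = k}) = ∅ := by
          refine Finset.filter_eq_empty_iff.mpr fun n hn hnk => ?_
          have hn' := Finset.mem_Ioc.mp (Finset.mem_filter.mp hn).1
          have := Nat.factorization_lt (p : ℕ) hn'.1.ne'
          omega
        have h2 := card_filter_factorization_weightedSet hpos hle hp hx k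
        rw [hempty, Finset.card_empty] at h2
        change ((Finset.card _ : ℕ) : ℝ) = 0
        exact_mod_cast h2.symm
    have hdom : Tendsto (fun x : ℝ => ∑' k, M (x * h p k / ((p : ℕ) : ℝ) ^ k) / x) atTop
        (𝓝 (∑' k, h p k / ((p : ℕ) : ℝ) ^ k * ((1 - 1 / ((p : ℕ) : ℝ)) * D))) := by
      refine tendsto_tsum_of_dominated_convergence (bound := fun k => (1 / ((p : ℕ) : ℝ)) ^ k)
        (summable_geometric_of_lt_one (by positivity) ((div_lt_one hp0).mpr hp1)) hterm ?_
      filter_upwards [eventually_gt_atTop 0] with x hx k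
      have hy : 0 ≤ x * h p k / ((p : ℕ) : ℝ) ^ k := by
        have := hpos p k
        positivity
      have hM0 : 0 ≤ M (x * h p k / ((p : ℕ) : ℝ) ^ k) := Nat.cast_nonneg _
      rw [Real.norm_of_nonneg (by positivity), div_le_iff₀ hx]
      refine (hM_le _ hy).trans ?_
      rw [div_pow, one_pow, div_mul_eq_mul_div, one_mul]
      gcongr
      exact mul_le_of_le_one_right hx.le (hle p k)
    rw [tsum_mul_right] at hdom
    rw [show densityFactor h p * D =
      (∑' k, h p k / ((p : ℕ) : ℝ) ^ k) * ((1 - 1 / ((p : ℕ) : ℝ)) * D) by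
        rw [densityFactor]; ring]
    refine hdom.congr' ?_
    filter_upwards [eventually_ge_atTop 0] with x hx
    rw [hcard x hx, tsum_div_const]

theorem one_sub_prod_le_sum {ι : Type*} (s : Finset ι) {f : ι → ℝ} (h0 : ∀ i, 0 ≤ f i)
    (h1 : ∀ i, f i ≤ 1) : 1 - ∏ i ∈ s, f i ≤ ∑ i ∈ s, (1 - f i) := by
  classical
  induction s using Finset.induction_on with
  | empty => simp
  | insert a s ha ih =>
    rw [Finset.prod_insert ha, Finset.sum_insert ha]
    have h2 : ∏ i ∈ s, f i ≤ 1 := Finset.prod_le_one (fun i _ => h0 i) fun i _ => h1 i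
    nlinarith [h0 a, h1 a]

/-- Bound for the mean value of `1 - h p k` over the integers, where `p ^ k` is the exact power of `p`:
exponent `1` has density at most `1 / p`, and larger exponents have density `1 / p ^ 2`. -/
noncomputable def weightDefect (h : Nat.Primes → ℕ → ℝ) (p : Nat.Primes) : ℝ :=
  (1 - h p 1) / ((p : ℕ) : ℝ) + 1 / ((p : ℕ) : ℝ) ^ 2

theorem sum_one_sub_weight_le (hpos : ∀ p k, 0 < h p k) (hle : ∀ p k, h p k ≤ 1)
    (h0 : ∀ p, h p 0 = 1) (p : Nat.Primes) {x : ℝ} (hx : 0 ≤ x) :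
    ∑ n ∈ Finset.Ioc 0 ⌊x⌋₊, (1 - h p (n.factorization p)) ≤ x * weightDefect h p := by
  have hcount : ∀ d : ℕ, 0 < d →
      ∑ n ∈ Finset.Ioc 0 ⌊x⌋₊, (if d ∣ n then (1 : ℝ) else 0) ≤ x / d := by
    intro d hd
    rw [Finset.sum_boole, Nat.Ioc_filter_dvd_card_eq_div]
    refine Nat.cast_div_le.trans ?_
    gcongr
    exact Nat.floor_le hx
  calc ∑ n ∈ Finset.Ioc 0 ⌊x⌋₊, (1 - h p (n.factorization p))
      ≤ ∑ n ∈ Finset.Ioc 0 ⌊x⌋₊, ((1 - h p 1) * (if (p : ℕ) ∣ n then 1 else 0) +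
          (if (p : ℕ) ^ 2 ∣ n then 1 else 0)) := by
        refine Finset.sum_le_sum fun n hn => ?_
        have hn0 : n ≠ 0 := (Finset.mem_Ioc.mp hn).1.ne'
        have h1 := hle p 1
        rcases Nat.lt_or_ge (n.factorization p) 2 with h2 | h2
        · interval_cases hk : n.factorization p
          · rw [h0]
            split_ifs <;> linarith
          · have : (p : ℕ) ∣ n := Nat.dvd_of_factorization_pos (by omega)
            rw [if_pos this]
            split_ifs <;> linarith
        · have : (p : ℕ) ^ 2 ∣ n := (p.2.pow_dvd_iff_le_factorization hn0).mpr h2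
          rw [if_pos this]
          have := hpos p (n.factorization p)
          split_ifs <;> linarith
    _ = (1 - h p 1) * ∑ n ∈ Finset.Ioc 0 ⌊x⌋₊, (if (p : ℕ) ∣ n then (1 : ℝ) else 0) +
          ∑ n ∈ Finset.Ioc 0 ⌊x⌋₊, (if (p : ℕ) ^ 2 ∣ n then (1 : ℝ) else 0) := by
        rw [Finset.sum_add_distrib, Finset.mul_sum]
    _ ≤ (1 - h p 1) * (x / (p : ℕ)) + x / ((p : ℕ) ^ 2 : ℕ) := by
        have := hle p 1
        have := hcount p p.2.pos
        have := hcount _ (pow_pos p.2.pos 2)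
        gcongr
    _ = x * weightDefect h p := by
        rw [weightDefect]
        push_cast
        ring

/-- Passing from the primes in `S` to those in `Q ⊇ S` changes the counting function little: if the
weight over `Q \ S` is at least `1 - ε`, then it is made up for by the factor `1 - ε` at the level, and
the other integers are few by Markov's inequality. -/
theorem card_weightedSet_le_add (hpos : ∀ p k, 0 < h p k) (hle : ∀ p k, h p k ≤ 1)
    (h0 : ∀ p, h p 0 = 1) {S Q : Finset Nat.Primes} (hSQ : S ⊆ Q) {x ε : ℝ} (hx : 0 ≤ x)
    (hε : 0 < ε) (hε1 : ε < 1) :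
    ((weightedSet h S ((1 - ε) * x)).card : ℝ) ≤ (weightedSet h Q x).card +
      x / ε * (∑ p ∈ Q, weightDefect h p - ∑ p ∈ S, weightDefect h p) := by
  classical
  set bad : Finset ℕ := {n ∈ Finset.Ioc 0 ⌊x⌋₊ | primeWeight h (Q \ S) n < 1 - ε} with hbad
  have hsplit : ∀ n, primeWeight h Q n = primeWeight h (Q \ S) n * primeWeight h S n := fun n =>
    (Finset.prod_sdiff hSQ).symm
  have hsub : weightedSet h S ((1 - ε) * x) ⊆ weightedSet h Q x ∪ bad := by
    intro n hn
    rw [mem_weightedSet hpos hle (mul_nonneg (by linarith) hx)] at hn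
    have hS := primeWeight_pos hpos S n
    rw [Finset.mem_union]
    by_cases hn' : primeWeight h (Q \ S) n < 1 - ε
    · right
      refine Finset.mem_filter.mpr ⟨Finset.mem_Ioc.mpr ⟨hn.1, Nat.le_floor (hn.2.trans ?_)⟩, hn'⟩
      have h1 := primeWeight_le_one hpos hle S n
      calc (1 - ε) * x * primeWeight h S n ≤ (1 - ε) * x :=
            mul_le_of_le_one_right (mul_nonneg (by linarith) hx) h1
        _ ≤ x := mul_le_of_le_one_left hx (by linarith)
    · left
      rw [mem_weightedSet hpos hle hx, hsplit]
      refine ⟨hn.1, hn.2.trans ?_⟩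
      rw [not_lt] at hn'
      calc (1 - ε) * x * primeWeight h S n = x * ((1 - ε) * primeWeight h S n) := by ring
        _ ≤ _ := by gcongr
  have hbadcard : ε * (bad.card : ℝ) ≤
      x * (∑ p ∈ Q, weightDefect h p - ∑ p ∈ S, weightDefect h p) := by
    calc ε * (bad.card : ℝ) = ∑ n ∈ bad, ε := by rw [Finset.sum_const, nsmul_eq_mul, mul_comm]
      _ ≤ ∑ n ∈ bad, (1 - primeWeight h (Q \ S) n) := by
          refine Finset.sum_le_sum fun n hn => ?_
          have := (Finset.mem_filter.mp hn).2
          linarith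
      _ ≤ ∑ n ∈ Finset.Ioc 0 ⌊x⌋₊, (1 - primeWeight h (Q \ S) n) := by
          refine Finset.sum_le_sum_of_subset_of_nonneg (Finset.filter_subset _ _) fun n _ _ => ?_
          have := primeWeight_le_one hpos hle (Q \ S) n
          linarith
      _ ≤ ∑ n ∈ Finset.Ioc 0 ⌊x⌋₊, ∑ p ∈ Q \ S, (1 - h p (n.factorization p)) :=
          Finset.sum_le_sum fun n _ =>
            one_sub_prod_le_sum _ (fun p => (hpos p _).le) fun p => hle p _
      _ = ∑ p ∈ Q \ S, ∑ n ∈ Finset.Ioc 0 ⌊x⌋₊, (1 - h p (n.factorization p)) :=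
          Finset.sum_comm
      _ ≤ ∑ p ∈ Q \ S, x * weightDefect h p :=
          Finset.sum_le_sum fun p _ => sum_one_sub_weight_le hpos hle h0 p hx
      _ = _ := by rw [← Finset.mul_sum, Finset.sum_sdiff_eq_sub hSQ]
  have h1 : ((weightedSet h S ((1 - ε) * x)).card : ℝ) ≤ (weightedSet h Q x).card + bad.card := by
    exact_mod_cast (Finset.card_le_card hsub).trans (Finset.card_union_le _ _)
  have h2 : (bad.card : ℝ) ≤
      x / ε * (∑ p ∈ Q, weightDefect h p - ∑ p ∈ S, weightDefect h p) := by
    rw [div_mul_eq_mul_div, le_div_iff₀ hε, mul_comm]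
    exact hbadcard
  linarith

/-- The positive integers `n` with `n ≤ x * w n` for the multiplicative weight `w` with local values
`h p k` have density `∏_p (1 - 1/p) ∑_k h p k / p ^ k`: the counting function `N x` is the eventual
value for large finite sets of primes. -/
theorem tendsto_card_weighted (hpos : ∀ p k, 0 < h p k) (hle : ∀ p k, h p k ≤ 1)
    (h0 : ∀ p, h p 0 = 1) (hdef : Summable (weightDefect h)) {C : ℝ}
    (hC : HasProd (densityFactor h) C) {N : ℝ → ℕ}
    (hN : ∀ x, 0 ≤ x → ∀ᶠ Q in (atTop : Filter (Finset Nat.Primes)),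
      (weightedSet h Q x).card = N x) :
    Tendsto (fun x : ℝ => (N x : ℝ) / x) atTop (𝓝 C) := by
  classical
  have hdef0 : ∀ p, 0 ≤ weightDefect h p := by
    intro p
    have := hle p 1
    have : 0 ≤ 1 - h p 1 := by linarith
    rw [weightDefect]
    positivity
  have hupper : ∀ (S : Finset Nat.Primes) (x : ℝ), 0 ≤ x → N x ≤ (weightedSet h S x).card := by
    intro S x hx
    obtain ⟨Q, hQ, hSQ⟩ := ((hN x hx).and (eventually_ge_atTop S)).exists
    rw [← hQ]
    refine Finset.card_le_card fun n hn => ?_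
    rw [mem_weightedSet hpos hle hx] at hn ⊢
    refine ⟨hn.1, hn.2.trans (mul_le_mul_of_nonneg_left ?_ hx)⟩
    have h1 : primeWeight h Q n = primeWeight h (Q \ S) n * primeWeight h S n :=
      (Finset.prod_sdiff hSQ).symm
    rw [h1]
    exact mul_le_of_le_one_left (primeWeight_pos hpos S n).le (primeWeight_le_one hpos hle _ n)
  have hlower : ∀ (S : Finset Nat.Primes) (ε x : ℝ), 0 < ε → ε < 1 → 0 ≤ x →
      ((weightedSet h S ((1 - ε) * x)).card : ℝ) ≤ N x +
        x / ε * (∑' p, weightDefect h p - ∑ p ∈ S, weightDefect h p) := by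
    intro S ε x hε hε1 hx
    obtain ⟨Q, hQ, hSQ⟩ := ((hN x hx).and (eventually_ge_atTop S)).exists
    rw [← hQ]
    refine (card_weightedSet_le_add hpos hle h0 hSQ hx hε hε1).trans ?_
    gcongr
    exact hdef.sum_le_tsum Q fun p _ => hdef0 p
  rw [tendsto_order]
  constructor
  · intro a ha
    have hεlim : Tendsto (fun ε : ℝ => (1 - ε) * C) (𝓝[>] 0) (𝓝 C) := by
      have h1 : Tendsto (fun ε : ℝ => (1 - ε) * C) (𝓝 0) (𝓝 ((1 - 0) * C)) :=
        Continuous.tendsto (by fun_prop) 0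
      rw [sub_zero, one_mul] at h1
      exact h1.mono_left nhdsWithin_le_nhds
    obtain ⟨ε, hεa, hε, hε1⟩ := ((hεlim.eventually_const_lt ha).and
      (Ioo_mem_nhdsGT (zero_lt_one' ℝ))).exists
    have hSlim : Tendsto (fun S : Finset Nat.Primes => (1 - ε) * ∏ p ∈ S, densityFactor h p -
        (∑' p, weightDefect h p - ∑ p ∈ S, weightDefect h p) / ε) atTop
        (𝓝 ((1 - ε) * C - (∑' p, weightDefect h p - ∑' p, weightDefect h p) / ε)) :=
      (Tendsto.const_mul _ hC).sub ((Tendsto.const_sub _ hdef.hasSum).div_const ε)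
    rw [sub_self, zero_div, sub_zero] at hSlim
    obtain ⟨S, hS⟩ := (hSlim.eventually_const_lt hεa).exists
    have hx1 : Tendsto (fun x : ℝ => (1 - ε) * x) atTop atTop :=
      tendsto_id.const_mul_atTop (by linarith)
    have hlim := (((tendsto_card_weightedSet hpos hle S).comp hx1).const_mul (1 - ε)).sub_const
      ((∑' p, weightDefect h p - ∑ p ∈ S, weightDefect h p) / ε)
    filter_upwards [hlim.eventually_const_lt hS, eventually_gt_atTop 0] with x hx hx0
    refine hx.trans_le ?_
    have h1 := hlower S ε x hε hε1 hx0.le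
    have h1ε : 1 - ε ≠ 0 := by linarith
    rw [Function.comp_apply, le_div_iff₀ hx0]
    have h2 : ((1 - ε) * (((weightedSet h S ((1 - ε) * x)).card : ℝ) / ((1 - ε) * x)) -
        (∑' p, weightDefect h p - ∑ p ∈ S, weightDefect h p) / ε) * x =
        ((weightedSet h S ((1 - ε) * x)).card : ℝ) -
          x / ε * (∑' p, weightDefect h p - ∑ p ∈ S, weightDefect h p) := by
      field_simp
    rw [h2]
    linarith
  · intro a ha
    obtain ⟨S, hS⟩ := (Tendsto.eventually_lt_const ha hC).exists
    filter_upwards [(tendsto_card_weightedSet hpos hle S).eventually_lt_const hS,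
      eventually_gt_atTop 0] with x hx hx0
    refine lt_of_le_of_lt ?_ hx
    have := hupper S x hx0.le
    gcongr

end Counting

/-! ### Diagonalisation of the local operators -/

/-- A Hilbert basis of eigenvectors gives an eigenmatrix; the phase is chosen such that the entry
with indices `0, 0` is positive. -/
theorem exists_isEigenmatrix {A : ℕ → ℕ → ℝ} {T : EllTwo ℕ →L[ℂ] EllTwo ℕ} {μ : ℕ → ℝ}
    {b : HilbertBasis ℕ ℂ (EllTwo ℕ)} (hT : IsMatrixOperator A T)
    (hb : ∀ n, T (b n) = (μ n : ℂ) • b n) (h0 : b 0 0 ≠ 0) :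
    ∃ u : ℕ → ℕ → ℂ, IsEigenmatrix A μ u ∧ u 0 0 = (‖b 0 0‖ : ℂ) := by
  set c : ℂ := conj (b 0 0) / (‖b 0 0‖ : ℂ) with hc
  have hne : (‖b 0 0‖ : ℂ) ≠ 0 := by exact_mod_cast (norm_pos_iff.mpr h0).ne'
  have hcc : conj c * c = 1 := by
    rw [hc, map_div₀, Complex.conj_ofReal, Complex.conj_conj, div_mul_div_comm, RCLike.mul_conj]
    field_simp
    rfl
  have hcnorm : ‖c‖ = 1 := by
    rw [hc, norm_div, RCLike.norm_conj, Complex.norm_real, norm_norm, div_self]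
    exact (norm_pos_iff.mpr h0).ne'
  have hrepr : ∀ j k, b.repr (lp.single 2 j (1 : ℂ)) k = conj (b k j) := by
    intro j k
    rw [b.repr_apply_apply, ← inner_conj_symm, EllTwo.inner_single_left]
  refine ⟨fun k j => c * b k j, ⟨fun k k' => ?_, fun j => ?_, fun j j' => ?_⟩, ?_⟩
  · have h1 := lp.hasSum_inner (𝕜 := ℂ) (b k) (b k')
    rw [orthonormal_iff_ite.mp b.orthonormal k k'] at h1
    refine h1.congr_fun fun j => ?_
    rw [RCLike.inner_apply, map_mul]
    linear_combination (b k' j * conj (b k j)) * hcc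
  · have h1 := b.hasSum_norm_sq (lp.single 2 j (1 : ℂ))
    rw [lp.norm_single (by simp), norm_one, one_pow] at h1
    refine h1.congr_fun fun k => ?_
    rw [hrepr, RCLike.norm_conj, norm_mul, hcnorm, one_mul]
  · have h1 := ((b.hasSum_repr (lp.single 2 j' (1 : ℂ))).mapL T).mapL
      (innerSL ℂ (lp.single 2 j (1 : ℂ) : EllTwo ℕ))
    simp only [innerSL_apply_apply, EllTwo.inner_single_left, hT.apply_single, map_smul, hb,
      hrepr] at h1
    refine h1.congr_fun fun k => ?_
    rw [smul_eq_mul, smul_eq_mul, map_mul]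
    linear_combination (μ k * b k j * conj (b k j')) * hcc
  · change c * b 0 0 = _
    rw [hc, div_mul_eq_mul_div, RCLike.conj_mul]
    field_simp
    rfl

/-- The spectral data of the matrix `s^j w^{max(j,k)} s^k`, with all estimates that are needed for
the tensor product. -/
theorem exists_local_data {s w : ℝ} (hs : 0 < s) (hw : 0 < w) (hw1 : w < 1) (hr : w * s ^ 2 < 1) :
    ∃ (T : EllTwo ℕ →L[ℂ] EllTwo ℕ) (μ : ℕ → ℝ) (u : ℕ → ℕ → ℂ),
      IsMatrixOperator (maxMatrix s w) T ∧ IsCompactOperator T ∧ T.IsPositive ∧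
      IsEigenvalueSeq T μ ∧ IsEigenmatrix (maxMatrix s w) μ u ∧ Antitone μ ∧ (∀ k, 0 < μ k) ∧
      1 ≤ μ 0 ∧
      μ 0 ≤ 1 + w * (w * s ^ 2) / (1 - w * (w * s ^ 2)) / (1 - w * s ^ 2) ∧
      (∀ k, μ (k + 1) ≤ w * s ^ 2 * μ k) ∧
      w * s ^ 2 * (1 - w) / (1 + w * s ^ 2) ≤ μ 1 ∧
      ‖u 0 0 - 1‖ ≤ w * (w * s ^ 2) / (1 - w * (w * s ^ 2)) / (1 - w * s ^ 2) ^ 2 := by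
  have hr0 : 0 < w * s ^ 2 := by positivity
  have hwr : w * (w * s ^ 2) < 1 := by nlinarith
  obtain ⟨T, hT, hcomp, hpos, hinj⟩ := exists_maxMatrix_operator hs hw hw1 hr
  obtain ⟨b, μ, hanti, hμ, hlim, hb⟩ :=
    exists_hilbertBasis_eigenvectors hcomp hpos hinj not_finiteDimensional_ellTwo_nat
  obtain ⟨u, hu, hu0⟩ := exists_isEigenmatrix hT hb
    (topEigenvector_zero_ne_zero hT hanti hb hr0 hr)
  have hβ := norm_sq_leftShift_apply_single hT hwr hw
  refine ⟨T, μ, u, hT, hcomp, hpos, b.isEigenvalueSeq hanti (fun n => (hμ n).le) hlim hb, hu,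
    hanti, hμ, one_le_eigenvalue_zero hT hanti hb, ?_, eigenvalue_succ_le hT hanti hb hr0,
    le_eigenvalue_one hT hanti hb hs hw hr, ?_⟩
  · rw [← hβ]
    exact eigenvalue_zero_le hT hpos hanti hb hr0 hr
  · rw [← hβ]
    refine le_trans ?_ (one_sub_norm_sq_topEigenvector_le hT hanti hb hr0 hr)
    have h1 : ‖b 0 0‖ ≤ 1 := by
      have := lp.norm_apply_le_norm two_ne_zero (b 0) 0
      rwa [b.orthonormal.1] at this
    rw [hu0, ← Complex.ofReal_one, ← Complex.ofReal_sub, Complex.norm_real, Real.norm_eq_abs,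
      abs_sub_comm, abs_of_nonneg (by linarith)]
    nlinarith [norm_nonneg (b 0 0)]

/-! ### Inverting a counting function -/

/-- If `N x` counts the terms `≤ x` of a non-decreasing sequence and `N x ~ C x`, then the terms of
the sequence are asymptotic to `k / C`. As the sequence starts with index `0`, counting is expressed
by `k < N x ↔ a k ≤ x`. -/
theorem tendsto_div_of_counting {a : ℕ → ℝ} {N : ℝ → ℕ} {C : ℝ} (ha : ∀ k, 0 < a k)
    (hN : ∀ x k, k < N x ↔ a k ≤ x) (hC : Tendsto (fun x : ℝ => (N x : ℝ) / x) atTop (𝓝 C)) :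
    Tendsto (fun k : ℕ => ((k : ℝ) + 1) / a k) atTop (𝓝 C) := by
  have hatop : Tendsto a atTop atTop := by
    rw [tendsto_atTop]
    intro x
    filter_upwards [eventually_ge_atTop (N x)] with k hk
    by_contra h
    exact absurd ((hN x k).mpr (le_of_not_ge h)) (not_lt.mpr hk)
  rw [tendsto_order]
  constructor
  · intro y hy
    have hεlim : Tendsto (fun ε : ℝ => (1 - ε) * C) (𝓝[>] 0) (𝓝 C) := by
      have h1 : Tendsto (fun ε : ℝ => (1 - ε) * C) (𝓝 0) (𝓝 ((1 - 0) * C)) :=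
        Continuous.tendsto (by fun_prop) 0
      rw [sub_zero, one_mul] at h1
      exact h1.mono_left nhdsWithin_le_nhds
    obtain ⟨ε, hεy, hε, hε1⟩ := ((hεlim.eventually_const_lt hy).and
      (Ioo_mem_nhdsGT (zero_lt_one' ℝ))).exists
    have hx : Tendsto (fun k => (1 - ε) * a k) atTop atTop :=
      hatop.const_mul_atTop (by linarith)
    have hlim := (hC.comp hx).const_mul (1 - ε)
    filter_upwards [hlim.eventually_const_lt hεy] with k hk
    refine hk.trans_le ?_
    have h1ε : 1 - ε ≠ 0 := by linarith
    have hak := ha k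
    have h2 : (1 - ε) * ((N ((1 - ε) * a k) : ℝ) / ((1 - ε) * a k)) =
        (N ((1 - ε) * a k) : ℝ) / a k := by field_simp
    rw [Function.comp_apply, h2]
    have h3 : N ((1 - ε) * a k) ≤ k := by
      rw [← not_lt, hN, not_le]
      nlinarith
    have h4 : (N ((1 - ε) * a k) : ℝ) ≤ k := by exact_mod_cast h3
    gcongr
    linarith
  · intro y hy
    filter_upwards [(hC.comp hatop).eventually_lt_const hy] with k hk
    refine lt_of_le_of_lt ?_ hk
    have h3 : k + 1 ≤ N (a k) := (hN (a k) k).mpr le_rfl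
    have h4 : (k : ℝ) + 1 ≤ N (a k) := by exact_mod_cast h3
    have := ha k
    rw [Function.comp_apply]
    gcongr

/-! ### Prime exponents -/

/-- Prime factorisation as a bijection between the positive integers and the finitely supported
families of prime exponents. -/
noncomputable def primeExponents : ℕ+ ≃ (Nat.Primes →₀ ℕ) :=
  PNat.factorMultisetEquiv.trans
    (Multiset.toFinsupp : Multiset Nat.Primes ≃+ (Nat.Primes →₀ ℕ)).toEquiv

theorem primeExponents_apply (n : ℕ+) (p : Nat.Primes) :
    primeExponents n p = (n : ℕ).factorization p := by
  have h1 : primeExponents n p = Multiset.count p (PNat.factorMultiset n) :=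
    Multiset.toFinsupp_apply _ _
  rw [h1]
  refine eq_of_forall_le_iff fun k => ?_
  rw [← p.2.pow_dvd_iff_le_factorization n.ne_zero]
  have h2 := PNat.count_factorMultiset n p k
  rw [← h2, PNat.dvd_iff, PNat.pow_coe, Nat.Primes.coe_pnat_nat]

theorem prod_primes_pow_factorization {n : ℕ} (hn : n ≠ 0) {Q : Finset Nat.Primes}
    (hQ : ∀ p : Nat.Primes, (p : ℕ) ∣ n → p ∈ Q) :
    ∏ p ∈ Q, ((p : ℕ) : ℝ) ^ n.factorization p = n := by
  have h1 : ∏ p ∈ Q, (p : ℕ) ^ n.factorization p = n := by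
    conv_rhs => rw [← Nat.prod_factorization_pow_eq_self hn]
    rw [Finsupp.prod_of_support_subset (s := Q.map ⟨fun p : Nat.Primes => (p : ℕ), Nat.Primes.coe_nat_injective⟩)]
    · rw [Finset.prod_map]
      rfl
    · intro p hp
      rw [Nat.support_factorization, Nat.mem_primeFactors] at hp
      exact Finset.mem_map.mpr ⟨⟨p, hp.1⟩, hQ ⟨p, hp.1⟩ hp.2.1, rfl⟩
    · simp
  exact_mod_cast h1

theorem dvd_of_primeExponents_ne_zero {n : ℕ+} {p : Nat.Primes} :
    p ∈ (primeExponents n).support ↔ (p : ℕ) ∣ n := by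
  rw [Finsupp.mem_support_iff, primeExponents_apply, ← Nat.pos_iff_ne_zero]
  exact ⟨Nat.dvd_of_factorization_pos ∘ Nat.ne_of_gt,
    fun h => p.2.factorization_pos_of_dvd n.ne_zero h⟩

/-- The matrix `n^σ m^σ / [n,m]^τ` is the product over all primes of the local matrices. -/
theorem tprod_maxMatrix_eq_lcmMatrix (σ τ : ℝ) (n m : ℕ+) :
    ∏' p : Nat.Primes, maxMatrix (((p : ℕ) : ℝ) ^ σ) (((p : ℕ) : ℝ) ^ (-τ)) (primeExponents n p)
      (primeExponents m p) = lcmMatrix σ τ n m := by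
  classical
  set Q := (primeExponents n).support ∪ (primeExponents m).support with hQ
  have hn : ∀ p : Nat.Primes, (p : ℕ) ∣ n → p ∈ Q := fun p hp =>
    Finset.mem_union_left _ (dvd_of_primeExponents_ne_zero.mpr hp)
  have hm : ∀ p : Nat.Primes, (p : ℕ) ∣ m → p ∈ Q := fun p hp =>
    Finset.mem_union_right _ (dvd_of_primeExponents_ne_zero.mpr hp)
  have hlcm : ∀ p : Nat.Primes, (p : ℕ) ∣ Nat.lcm n m → p ∈ Q := by
    intro p hp
    rcases (Nat.Prime.dvd_lcm p.2).mp hp with h | h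
    · exact hn p h
    · exact hm p h
  rw [tprod_eq_prod (s := Q)]
  · have hpow : ∀ (a : ℝ) (N : ℕ), N ≠ 0 → (∀ p : Nat.Primes, (p : ℕ) ∣ N → p ∈ Q) →
        ∏ p ∈ Q, (((p : ℕ) : ℝ) ^ a) ^ N.factorization p = (N : ℝ) ^ a := by
      intro a N hN hNQ
      rw [← prod_primes_pow_factorization hN hNQ, ← Real.finsetProd_rpow _ _
        fun p _ => by positivity]
      refine Finset.prod_congr rfl fun p _ => ?_
      rw [← Real.rpow_natCast, ← Real.rpow_natCast, ← Real.rpow_mul (Nat.cast_nonneg _),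
        ← Real.rpow_mul (Nat.cast_nonneg _), mul_comm]
    have hlcm0 : Nat.lcm n m ≠ 0 := Nat.lcm_ne_zero n.ne_zero m.ne_zero
    rw [lcmMatrix, ← hpow σ n n.ne_zero hn, ← hpow σ m m.ne_zero hm, div_eq_mul_inv,
      ← Real.rpow_neg (Nat.cast_nonneg _), ← hpow (-τ) _ hlcm0 hlcm, ← Finset.prod_mul_distrib,
      ← Finset.prod_mul_distrib]
    refine Finset.prod_congr rfl fun p _ => ?_
    rw [maxMatrix, primeExponents_apply, primeExponents_apply,
      Nat.factorization_lcm n.ne_zero m.ne_zero, Finsupp.sup_apply]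
    ring
  · intro p hp
    rw [hQ, Finset.notMem_union, Finsupp.notMem_support_iff, Finsupp.notMem_support_iff] at hp
    rw [hp.1, hp.2]
    simp [maxMatrix]

/-! ### The products of the local eigenvalues -/

/-- Bounds on the eigenvalues `μ p k`, `k = 0, 1, …`, of the local operators. The bound `succ_le` makes
the weights in the counting function at most `1`; `le_one` and `summable` make them close to `1`. -/
structure LocalBounds (ρ τ : ℝ) (μ : Nat.Primes → ℕ → ℝ) : Prop where
  pos : ∀ p k, 0 < μ p k
  one_le : ∀ p, 1 ≤ μ p 0
  succ_le : ∀ (p : Nat.Primes) (k : ℕ), μ p (k + 1) ≤ ((p : ℕ) : ℝ) ^ (-ρ) * μ p k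
  le_one : ∀ p : Nat.Primes,
    ((p : ℕ) : ℝ) ^ (-ρ) * (1 - ((p : ℕ) : ℝ) ^ (-τ)) / (1 + ((p : ℕ) : ℝ) ^ (-ρ)) ≤ μ p 1
  summable : Summable fun p => μ p 0 - 1

/-- The weight with which the prime power `p ^ k` enters the counting function of the products of
local eigenvalues: `(μ p k / μ p 0) ^ (1/ρ) * p ^ k`. -/
noncomputable def eigenWeight (ρ : ℝ) (μ : Nat.Primes → ℕ → ℝ) (p : Nat.Primes) (k : ℕ) : ℝ :=
  (μ p k / μ p 0) ^ (1 / ρ) * ((p : ℕ) : ℝ) ^ k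

/-- The product of the local eigenvalues with indices the prime exponents of `n`. -/
noncomputable def eigenProd (μ : Nat.Primes → ℕ → ℝ) (n : ℕ+) : ℝ :=
  ∏' p, μ p (primeExponents n p)

theorem one_sub_rpow_le {x δ t : ℝ} (hx : 0 < x) (hδ : 0 ≤ δ) (hxδ : 1 - δ ≤ x) (ht : 0 < t) :
    1 - x ^ t ≤ max 1 t * δ := by
  have hxt : 0 < x ^ t := Real.rpow_pos_of_pos hx t
  rcases le_or_gt 1 δ with h1 | h1
  · have : 1 * 1 ≤ max 1 t * δ := mul_le_mul (le_max_left _ _) h1 zero_le_one (by positivity)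
    linarith
  · have h2 : (1 - δ) ^ t ≤ x ^ t := Real.rpow_le_rpow (by linarith) hxδ ht.le
    rcases le_total 1 t with h3 | h3
    · have h4 := one_add_mul_self_le_rpow_one_add (s := -δ) (by linarith) h3
      rw [max_eq_right h3]
      rw [← sub_eq_add_neg 1 δ] at h4
      linarith
    · have h4 := Real.rpow_le_rpow_of_exponent_ge (by linarith : 0 < 1 - δ) (by linarith) h3
      rw [Real.rpow_one] at h4
      rw [max_eq_left h3]
      linarith

theorem summable_primes_rpow_neg {s : ℝ} (hs : 1 < s) :
    Summable fun p : Nat.Primes => ((p : ℕ) : ℝ) ^ (-s) :=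
  Nat.Primes.summable_rpow.mpr (by linarith)

namespace LocalBounds

variable {ρ τ : ℝ} {μ : Nat.Primes → ℕ → ℝ}

theorem le_pow_mul (hμ : LocalBounds ρ τ μ) (p : Nat.Primes) (k : ℕ) :
    μ p k ≤ (((p : ℕ) : ℝ) ^ (-ρ)) ^ k * μ p 0 := by
  induction k with
  | zero => simp
  | succ k ih =>
    refine (hμ.succ_le p k).trans ?_
    rw [pow_succ', mul_assoc]
    gcongr

theorem eigenWeight_pos (hμ : LocalBounds ρ τ μ) (p : Nat.Primes) (k : ℕ) :
    0 < eigenWeight ρ μ p k := by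
  have h1 := hμ.pos p k
  have h2 := hμ.pos p 0
  have h3 : (0 : ℝ) < ((p : ℕ) : ℝ) := by exact_mod_cast p.2.pos
  rw [eigenWeight]
  positivity

theorem eigenWeight_zero (hμ : LocalBounds ρ τ μ) (p : Nat.Primes) : eigenWeight ρ μ p 0 = 1 := by
  rw [eigenWeight, div_self (hμ.pos p 0).ne', Real.one_rpow, pow_zero, one_mul]

theorem eigenWeight_le_one (hμ : LocalBounds ρ τ μ) (hρ : 0 < ρ) (p : Nat.Primes) (k : ℕ) :
    eigenWeight ρ μ p k ≤ 1 := by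
  have h3 : (0 : ℝ) < ((p : ℕ) : ℝ) := by exact_mod_cast p.2.pos
  have h1 : μ p k / μ p 0 ≤ (((p : ℕ) : ℝ) ^ (-ρ)) ^ k := by
    rw [div_le_iff₀ (hμ.pos p 0)]
    exact hμ.le_pow_mul p k
  have h2 : (μ p k / μ p 0) ^ (1 / ρ) ≤ ((((p : ℕ) : ℝ) ^ (-ρ)) ^ k) ^ (1 / ρ) :=
    Real.rpow_le_rpow (div_pos (hμ.pos p k) (hμ.pos p 0)).le h1 (by positivity)
  have h4 : ((((p : ℕ) : ℝ) ^ (-ρ)) ^ k) ^ (1 / ρ) = (((p : ℕ) : ℝ) ^ k)⁻¹ := by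
    rw [← Real.rpow_natCast, ← Real.rpow_mul h3.le, ← Real.rpow_mul h3.le,
      show -ρ * k * (1 / ρ) = -(k : ℝ) by field_simp, Real.rpow_neg h3.le, Real.rpow_natCast]
  rw [eigenWeight]
  calc (μ p k / μ p 0) ^ (1 / ρ) * ((p : ℕ) : ℝ) ^ k
      ≤ (((p : ℕ) : ℝ) ^ k)⁻¹ * ((p : ℕ) : ℝ) ^ k := by
        rw [← h4]
        gcongr
    _ = 1 := inv_mul_cancel₀ (by positivity)

theorem eigenWeight_div_rpow (hμ : LocalBounds ρ τ μ) (hρ : 0 < ρ) (p : Nat.Primes) (k : ℕ) :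
    (eigenWeight ρ μ p k / ((p : ℕ) : ℝ) ^ k) ^ ρ = μ p k / μ p 0 := by
  have h3 : (0 : ℝ) < ((p : ℕ) : ℝ) := by exact_mod_cast p.2.pos
  rw [eigenWeight, mul_div_assoc, div_self (pow_pos h3 k).ne', mul_one,
    ← Real.rpow_mul (div_pos (hμ.pos p k) (hμ.pos p 0)).le, one_div_mul_cancel hρ.ne',
    Real.rpow_one]

/-- The weights of the primes tend to `1` fast enough: `eigenWeight ρ μ p 1` is
`(p ^ ρ * μ p 1 / μ p 0) ^ (1/ρ)`, and the lower bound for `μ p 1` and the upper bound for `μ p 0` keep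
its base above `1 - (p ^ (-τ) + p ^ (-ρ) + (μ p 0 - 1))`. -/
theorem summable_weightDefect (hμ : LocalBounds ρ τ μ) (hρ : 0 < ρ) (hτ : 0 < τ) :
    Summable (weightDefect (eigenWeight ρ μ)) := by
  have hsum : Summable fun p : Nat.Primes => max 1 (1 / ρ) * (((p : ℕ) : ℝ) ^ (-(1 + τ)) +
      ((p : ℕ) : ℝ) ^ (-(1 + ρ)) + (μ p 0 - 1)) + ((p : ℕ) : ℝ) ^ (-(2 : ℝ)) :=
    ((((summable_primes_rpow_neg (by linarith)).add (summable_primes_rpow_neg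
      (by linarith))).add hμ.summable).mul_left _).add (summable_primes_rpow_neg (by norm_num))
  refine hsum.of_nonneg_of_le (fun p => ?_) fun p => ?_
  · have := hμ.eigenWeight_le_one hρ p 1
    have : 0 ≤ 1 - eigenWeight ρ μ p 1 := by linarith
    rw [weightDefect]
    positivity
  · have hp1 : (1 : ℝ) < ((p : ℕ) : ℝ) := by exact_mod_cast p.2.one_lt
    have hp0 : (0 : ℝ) < ((p : ℕ) : ℝ) := by linarith
    have hone := hμ.one_le p
    have hle := hμ.le_one p
    set w := ((p : ℕ) : ℝ) ^ (-τ) with hw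
    set r := ((p : ℕ) : ℝ) ^ (-ρ) with hr
    have hw0 : 0 < w := Real.rpow_pos_of_pos hp0 _
    have hr0 : 0 < r := Real.rpow_pos_of_pos hp0 _
    have hw1 : w < 1 := Real.rpow_lt_one_of_one_lt_of_neg hp1 (by linarith)
    have hr1 : r < 1 := Real.rpow_lt_one_of_one_lt_of_neg hp1 (by linarith)
    set δ := w + r + (μ p 0 - 1) with hδ
    set x := μ p 1 / μ p 0 / r with hx
    have hx0 : 0 < x := by
      have := hμ.pos p 1
      have := hμ.pos p 0
      positivity
    have hxδ : 1 - δ ≤ x := by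
      rw [hx, le_div_iff₀ hr0, le_div_iff₀ (hμ.pos p 0)]
      refine le_trans ?_ hle
      rw [le_div_iff₀ (by linarith)]
      set t := μ p 0 - 1 with ht
      have hμt : μ p 0 = 1 + t := by rw [ht]; ring
      have ht0 : 0 ≤ t := by linarith
      have hrt : 0 ≤ r * t := mul_nonneg hr0.le ht0
      rcases le_or_gt 1 δ with h1 | h1
      · have h2 : (1 - δ) * r * μ p 0 * (1 + r) ≤ 0 := by
          have : 0 ≤ r * μ p 0 * (1 + r) := by positivity
          nlinarith
        have h3 : 0 ≤ r * (1 - w) := mul_nonneg hr0.le (by linarith)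
        linarith
      · have ht1 : t < 1 := by linarith
        have h2 : 1 - δ ≤ (1 - w) * ((1 - r) * (1 - t)) := by
          have h4 : 1 - r - t ≤ (1 - r) * (1 - t) := by nlinarith
          have h5 : (1 - r) * (1 - t) ≤ 1 := by nlinarith
          nlinarith
        have h6 : (1 - r) * (1 + r) ≤ 1 := by nlinarith
        have h7 : (1 - t) * (1 + t) ≤ 1 := by nlinarith
        have h8 : ((1 - r) * (1 + r)) * ((1 - t) * (1 + t)) ≤ 1 :=
          mul_le_one₀ h6 (mul_nonneg (by linarith) (by linarith)) h7
        calc (1 - δ) * r * μ p 0 * (1 + r)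
            ≤ ((1 - w) * ((1 - r) * (1 - t))) * r * μ p 0 * (1 + r) := by
              have := hμ.pos p 0
              gcongr
          _ = r * (1 - w) * (((1 - r) * (1 + r)) * ((1 - t) * (1 + t))) := by rw [hμt]; ring
          _ ≤ r * (1 - w) * 1 := by
              have : 0 ≤ r * (1 - w) := mul_nonneg hr0.le (by linarith)
              gcongr
          _ = r * (1 - w) := mul_one _
    have hweight : eigenWeight ρ μ p 1 = x ^ (1 / ρ) := by
      have h1 : r ^ (1 / ρ) = (((p : ℕ) : ℝ))⁻¹ := by
        rw [hr, ← Real.rpow_mul hp0.le, show -ρ * (1 / ρ) = -1 by field_simp,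
          Real.rpow_neg_one]
      rw [eigenWeight, hx, Real.div_rpow (div_pos (hμ.pos p 1) (hμ.pos p 0)).le hr0.le, h1,
        pow_one, div_inv_eq_mul]
    have h1 := one_sub_rpow_le hx0 (by linarith : 0 ≤ δ) hxδ (by positivity : 0 < 1 / ρ)
    rw [← hweight] at h1
    have h2 : δ / ((p : ℕ) : ℝ) ≤
        ((p : ℕ) : ℝ) ^ (-(1 + τ)) + ((p : ℕ) : ℝ) ^ (-(1 + ρ)) + (μ p 0 - 1) := by
      rw [neg_add, neg_add, Real.rpow_add hp0, Real.rpow_add hp0, Real.rpow_neg_one, hδ, add_div,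
        add_div, ← hw, ← hr, div_eq_inv_mul, div_eq_inv_mul]
      gcongr
      exact div_le_self (by linarith) hp1.le
    have h3 : 1 / ((p : ℕ) : ℝ) ^ 2 = ((p : ℕ) : ℝ) ^ (-(2 : ℝ)) := by
      rw [Real.rpow_neg hp0.le, one_div]
      norm_num
    rw [weightDefect, h3]
    gcongr
    calc (1 - eigenWeight ρ μ p 1) / ((p : ℕ) : ℝ) ≤ (max 1 (1 / ρ) * δ) / ((p : ℕ) : ℝ) := by
          gcongr
      _ = max 1 (1 / ρ) * (δ / ((p : ℕ) : ℝ)) := by ring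
      _ ≤ _ := by gcongr

theorem summable_eigenWeight_div (hμ : LocalBounds ρ τ μ) (hρ : 0 < ρ) (p : Nat.Primes) :
    Summable fun k => eigenWeight ρ μ p k / ((p : ℕ) : ℝ) ^ k := by
  have hp1 : (1 : ℝ) < ((p : ℕ) : ℝ) := by exact_mod_cast p.2.one_lt
  refine (summable_geometric_of_lt_one (r := 1 / ((p : ℕ) : ℝ)) (by positivity)
    ((div_lt_one (by linarith)).mpr hp1)).of_nonneg_of_le (fun k => ?_) fun k => ?_
  · have := hμ.eigenWeight_pos p k
    positivity
  · rw [div_pow, one_pow]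
    have := hμ.eigenWeight_le_one hρ p k
    gcongr

theorem densityFactor_pos (hμ : LocalBounds ρ τ μ) (hρ : 0 < ρ) (p : Nat.Primes) :
    0 < densityFactor (eigenWeight ρ μ) p := by
  have hp1 : (1 : ℝ) < ((p : ℕ) : ℝ) := by exact_mod_cast p.2.one_lt
  refine mul_pos (sub_pos.mpr ((div_lt_one (by linarith)).mpr hp1)) ?_
  refine (hμ.summable_eigenWeight_div hρ p).tsum_pos (fun k => ?_) 0 ?_
  · have := hμ.eigenWeight_pos p k
    positivity
  · have := hμ.eigenWeight_pos p 0
    positivity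

theorem abs_densityFactor_sub_one_le (hμ : LocalBounds ρ τ μ) (hρ : 0 < ρ) (p : Nat.Primes) :
    |densityFactor (eigenWeight ρ μ) p - 1| ≤ weightDefect (eigenWeight ρ μ) p := by
  have hp1 : (1 : ℝ) < ((p : ℕ) : ℝ) := by exact_mod_cast p.2.one_lt
  set q : ℝ := 1 / ((p : ℕ) : ℝ) with hq
  have hq0 : 0 < q := by positivity
  have hq1 : q < 1 := (div_lt_one (by linarith)).mpr hp1
  have hgeo := hasSum_geometric_of_lt_one hq0.le hq1
  have hterm : ∀ k, eigenWeight ρ μ p k / ((p : ℕ) : ℝ) ^ k = eigenWeight ρ μ p k * q ^ k := by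
    intro k
    rw [hq, div_pow, one_pow]
    ring
  have hsum := hμ.summable_eigenWeight_div hρ p
  simp only [hterm] at hsum
  have hdiff : HasSum (fun k => (1 - eigenWeight ρ μ p k) * q ^ k)
      ((1 - q)⁻¹ - ∑' k, eigenWeight ρ μ p k * q ^ k) := by
    refine (hgeo.sub hsum.hasSum).congr_fun fun k => ?_
    ring
  have hnn : 0 ≤ (1 - q)⁻¹ - ∑' k, eigenWeight ρ μ p k * q ^ k := by
    refine hdiff.nonneg fun k => mul_nonneg ?_ (by positivity)
    have := hμ.eigenWeight_le_one hρ p k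
    linarith
  -- the terms with `k = 0` vanish, those with `k ≥ 2` are estimated by the geometric series
  have hle : (1 - q)⁻¹ - ∑' k, eigenWeight ρ μ p k * q ^ k ≤
      (1 - eigenWeight ρ μ p 1) * q + q ^ 2 * (1 - q)⁻¹ := by
    have h1 := (hasSum_nat_add_iff' 2).mpr hdiff
    have h2 := hasSum_le (fun k => ?_) h1 (hgeo.mul_left (q ^ 2))
    · rw [Finset.sum_range_succ, Finset.sum_range_one, hμ.eigenWeight_zero] at h2
      simp only [sub_self, zero_mul, pow_one, zero_add] at h2
      linarith
    · have := hμ.eigenWeight_pos p (k + 2)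
      rw [pow_add, mul_comm (q ^ k)]
      exact mul_le_of_le_one_left (by positivity) (by linarith)
  have hdens : densityFactor (eigenWeight ρ μ) p - 1 =
      -((1 - q) * ((1 - q)⁻¹ - ∑' k, eigenWeight ρ μ p k * q ^ k)) := by
    have h1q : 1 - q ≠ 0 := by linarith
    rw [densityFactor]
    simp only [hterm]
    rw [← hq]
    field_simp
    ring
  have h1q0 : 0 < 1 - q := by linarith
  rw [hdens, abs_neg, abs_of_nonneg (mul_nonneg h1q0.le hnn)]
  calc (1 - q) * ((1 - q)⁻¹ - ∑' k, eigenWeight ρ μ p k * q ^ k)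
      ≤ (1 - q) * ((1 - eigenWeight ρ μ p 1) * q + q ^ 2 * (1 - q)⁻¹) := by gcongr
    _ = (1 - q) * ((1 - eigenWeight ρ μ p 1) * q) + q ^ 2 := by
        field_simp
    _ ≤ (1 - eigenWeight ρ μ p 1) * q + q ^ 2 := by
        have h2 := hμ.eigenWeight_le_one hρ p 1
        have h3 : 0 ≤ (1 - eigenWeight ρ μ p 1) * q := mul_nonneg (by linarith) hq0.le
        have := mul_le_of_le_one_left h3 (by linarith : 1 - q ≤ 1)
        linarith
    _ = weightDefect (eigenWeight ρ μ) p := by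
        rw [weightDefect, hq]
        ring

theorem multipliable_of_summable_sub_one {g : Nat.Primes → ℝ} (hg : Summable fun p => |g p - 1|) :
    Multipliable g := by
  have h := multipliable_one_add_of_summable (f := fun p => g p - 1) hg
  simpa using h

theorem tprod_pos_of_summable_sub_one {g : Nat.Primes → ℝ} (h0 : ∀ p, 0 < g p)
    (hg : Summable fun p => |g p - 1|) : 0 < ∏' p, g p := by
  refine lt_of_le_of_ne (tprod_nonneg fun p => (h0 p).le) (Ne.symm ?_)
  have h := tprod_one_add_ne_zero_of_summable (f := fun p => g p - 1)
    (fun p => by simpa using (h0 p).ne') hg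
  simpa using h

theorem summable_abs_zero (hμ : LocalBounds ρ τ μ) : Summable fun p => |μ p 0 - 1| := by
  refine hμ.summable.congr fun p => ?_
  rw [abs_of_nonneg (by linarith [hμ.one_le p])]

theorem summable_abs_densityFactor (hμ : LocalBounds ρ τ μ) (hρ : 0 < ρ) (hτ : 0 < τ) :
    Summable fun p => |densityFactor (eigenWeight ρ μ) p - 1| :=
  (hμ.summable_weightDefect hρ hτ).of_nonneg_of_le (fun _ => abs_nonneg _)
    (hμ.abs_densityFactor_sub_one_le hρ)

/-- The product of local eigenvalues attached to `n` in terms of the weight of `n`. -/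
theorem eigenProd_eq (hμ : LocalBounds ρ τ μ) (hρ : 0 < ρ) (n : ℕ+) {Q : Finset Nat.Primes}
    (hQ : ∀ p : Nat.Primes, (p : ℕ) ∣ n → p ∈ Q) :
    eigenProd μ n = (∏' p, μ p 0) * (primeWeight (eigenWeight ρ μ) Q n / n) ^ ρ := by
  classical
  have h1 : ∀ p, μ p (primeExponents n p) = μ p 0 * (if p ∈ Q then
      (eigenWeight ρ μ p ((n : ℕ).factorization p) /
        ((p : ℕ) : ℝ) ^ (n : ℕ).factorization p) ^ ρ else 1) := by
    intro p
    rw [primeExponents_apply]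
    split_ifs with hp
    · rw [hμ.eigenWeight_div_rpow hρ, mul_div_cancel₀ _ (hμ.pos p 0).ne']
    · rw [Nat.factorization_eq_zero_of_not_dvd fun h => hp (hQ p h), mul_one]
  have h2 := hasProd_prod_of_ne_finset_one (f := fun p => if p ∈ Q then
      (eigenWeight ρ μ p ((n : ℕ).factorization p) /
        ((p : ℕ) : ℝ) ^ (n : ℕ).factorization p) ^ ρ else 1) (s := Q)
      (L := SummationFilter.unconditional Nat.Primes) fun p hp => if_neg hp
  have h3 := (multipliable_of_summable_sub_one hμ.summable_abs_zero).hasProd.mul h2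
  rw [eigenProd, tprod_congr h1, h3.tprod_eq, Finset.prod_congr rfl fun p hp => if_pos hp,
    Real.finsetProd_rpow, Finset.prod_div_distrib, prod_primes_pow_factorization n.ne_zero hQ]
  · rfl
  · intro p _
    have := hμ.eigenWeight_pos p ((n : ℕ).factorization p)
    positivity

theorem eigenProd_pos (hμ : LocalBounds ρ τ μ) (hρ : 0 < ρ) (n : ℕ+) : 0 < eigenProd μ n := by
  have hn : (0 : ℝ) < (n : ℕ) := by exact_mod_cast n.pos
  rw [hμ.eigenProd_eq hρ n fun p hp => dvd_of_primeExponents_ne_zero.mpr hp]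
  have h1 := tprod_pos_of_summable_sub_one (fun p => hμ.pos p 0) hμ.summable_abs_zero
  have h2 := primeWeight_pos hμ.eigenWeight_pos (primeExponents n).support n
  positivity

theorem tendsto_eigenProd (hμ : LocalBounds ρ τ μ) (hρ : 0 < ρ) :
    Tendsto (eigenProd μ) cofinite (𝓝 0) := by
  have h0 := tprod_pos_of_summable_sub_one (fun p => hμ.pos p 0) hμ.summable_abs_zero
  have h1 : Tendsto (fun n : ℕ => (∏' p, μ p 0) * ((n : ℝ) ^ (-ρ))) atTop (𝓝 0) := by
    have := ((tendsto_rpow_neg_atTop hρ).comp tendsto_natCast_atTop_atTop).const_mul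
      (∏' p, μ p 0)
    simpa using this
  rw [← Nat.cofinite_eq_atTop] at h1
  have h2 := h1.comp PNat.coe_injective.tendsto_cofinite
  refine squeeze_zero (fun n => (hμ.eigenProd_pos hρ n).le) (fun n => ?_) h2
  have hn : (0 : ℝ) < (n : ℕ) := by exact_mod_cast n.pos
  rw [hμ.eigenProd_eq hρ n fun p hp => dvd_of_primeExponents_ne_zero.mpr hp, Function.comp_apply,
    Real.rpow_neg hn.le, ← Real.inv_rpow hn.le, ← one_div]
  have h3 := primeWeight_pos hμ.eigenWeight_pos (primeExponents n).support n
  have h4 := primeWeight_le_one hμ.eigenWeight_pos (hμ.eigenWeight_le_one hρ)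
    (primeExponents n).support n
  gcongr

/-- The asymptotics of the products of local eigenvalues, listed in non-increasing order. -/
theorem tendsto_eigenProd_mul_rpow (hμ : LocalBounds ρ τ μ) (hρ : 0 < ρ) (hτ : 0 < τ)
    {e : ℕ ≃ ℕ+} (he : Antitone (eigenProd μ ∘ e)) :
    Tendsto (fun k : ℕ => eigenProd μ (e k) * ((k : ℝ) + 1) ^ ρ) atTop
      (𝓝 ((∏' p, μ p 0) * (∏' p, densityFactor (eigenWeight ρ μ) p) ^ ρ)) := by
  have hw0 := hμ.eigenWeight_pos
  have hw1 := hμ.eigenWeight_le_one hρ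
  set L := ∏' p, μ p 0 with hL
  have hL0 : 0 < L := tprod_pos_of_summable_sub_one (fun p => hμ.pos p 0) hμ.summable_abs_zero
  have hC := (multipliable_of_summable_sub_one (hμ.summable_abs_densityFactor hρ hτ)).hasProd
  set a : ℕ+ → ℝ := fun n => (L / eigenProd μ n) ^ (1 / ρ) with ha
  have ha0 : ∀ n, 0 < a n := fun n =>
    Real.rpow_pos_of_pos (div_pos hL0 (hμ.eigenProd_pos hρ n)) _
  have ha_eq : ∀ (n : ℕ+) (Q : Finset Nat.Primes), (∀ p : Nat.Primes, (p : ℕ) ∣ n → p ∈ Q) →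
      a n = n / primeWeight (eigenWeight ρ μ) Q n := by
    intro n Q hQ
    have hn : (0 : ℝ) < (n : ℕ) := by exact_mod_cast n.pos
    have h2 := primeWeight_pos hw0 Q n
    simp only [ha]
    rw [hμ.eigenProd_eq hρ n hQ, ← hL, div_mul_eq_div_div, div_self hL0.ne', one_div,
      ← Real.inv_rpow (by positivity), ← Real.rpow_mul (by positivity), mul_one_div_cancel hρ.ne',
      Real.rpow_one, inv_div]
  have hle_a : ∀ n : ℕ+, ((n : ℕ) : ℝ) ≤ a n := by
    intro n
    rw [ha_eq n _ fun p hp => dvd_of_primeExponents_ne_zero.mpr hp]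
    exact le_div_self (by positivity) (primeWeight_pos hw0 _ n) (primeWeight_le_one hw0 hw1 _ n)
  have hmono : Monotone (a ∘ e) := by
    intro k l hkl
    have h1 : eigenProd μ (e l) ≤ eigenProd μ (e k) := he hkl
    have h2 := hμ.eigenProd_pos hρ (e l)
    have h3 := hμ.eigenProd_pos hρ (e k)
    simp only [Function.comp_apply, ha]
    gcongr
  have hfin : ∀ x : ℝ, {n : ℕ+ | a n ≤ x}.Finite := by
    intro x
    refine ((Set.finite_le_nat ⌊x⌋₊).preimage PNat.coe_injective.injOn).subset fun n hn => ?_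
    exact Nat.le_floor ((hle_a n).trans hn)
  let N : ℝ → ℕ := fun x => {n : ℕ+ | a n ≤ x}.ncard
  have hNcount : ∀ x, 0 ≤ x → ∀ᶠ Q in (atTop : Filter (Finset Nat.Primes)),
      (weightedSet (eigenWeight ρ μ) Q x).card = N x := by
    intro x hx
    have hfinp : {p : Nat.Primes | (p : ℕ) ≤ ⌊x⌋₊}.Finite :=
      (Set.finite_le_nat ⌊x⌋₊).preimage Nat.Primes.coe_nat_injective.injOn
    filter_upwards [eventually_ge_atTop hfinp.toFinset] with Q hQ
    have hQn : ∀ n : ℕ+, ((n : ℕ) : ℝ) ≤ x → ∀ p : Nat.Primes, (p : ℕ) ∣ n → p ∈ Q := by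
      intro n hn p hp
      refine hQ (hfinp.mem_toFinset.mpr ?_)
      exact (Nat.le_of_dvd n.pos hp).trans (Nat.le_floor hn)
    have himg : ((weightedSet (eigenWeight ρ μ) Q x : Finset ℕ) : Set ℕ) =
        ((↑) : ℕ+ → ℕ) '' {n : ℕ+ | a n ≤ x} := by
      ext n
      rw [Finset.mem_coe, mem_weightedSet hw0 hw1 hx]
      constructor
      · rintro ⟨hn0, hn⟩
        have hnx : (n : ℝ) ≤ x := hn.trans (mul_le_of_le_one_right hx
          (primeWeight_le_one hw0 hw1 Q n))
        refine ⟨⟨n, hn0⟩, ?_, rfl⟩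
        change a ⟨n, hn0⟩ ≤ x
        rw [ha_eq _ Q (hQn ⟨n, hn0⟩ hnx), div_le_iff₀ (primeWeight_pos hw0 Q _)]
        exact hn
      · rintro ⟨m, hm, rfl⟩
        have hm' : a m ≤ x := hm
        refine ⟨m.pos, ?_⟩
        rwa [ha_eq m Q (hQn m ((hle_a m).trans hm')), div_le_iff₀ (primeWeight_pos hw0 Q _)] at hm'
    rw [← Set.ncard_coe_finset, himg, Set.ncard_image_of_injective _ PNat.coe_injective]
  have hdens := tendsto_card_weighted hw0 hw1 hμ.eigenWeight_zero
    (hμ.summable_weightDefect hρ hτ) hC hNcount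
  have hNlt : ∀ x k, k < N x ↔ (a ∘ e) k ≤ x := by
    intro x k
    have h1 : N x = {k : ℕ | (a ∘ e) k ≤ x}.ncard := by
      have : {n : ℕ+ | a n ≤ x} = e '' {k : ℕ | (a ∘ e) k ≤ x} := by
        ext n
        constructor
        · intro hn
          exact ⟨e.symm n, by simpa using hn, by simp⟩
        · rintro ⟨k, hk, rfl⟩
          exact hk
      simp only [N]
      rw [this, Set.ncard_image_of_injective _ e.injective]
    have hfin' : {k : ℕ | (a ∘ e) k ≤ x}.Finite := (hfin x).preimage e.injective.injOn
    rw [h1]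
    constructor
    · intro hk
      by_contra h
      have hsub : {k : ℕ | (a ∘ e) k ≤ x} ⊆ Set.Iio k := by
        intro l hl
        by_contra hlk
        exact h ((hmono (not_lt.mp hlk)).trans hl)
      have h2 := Set.ncard_le_ncard hsub (Set.finite_Iio k)
      rw [Set.ncard_eq_toFinset_card' (Set.Iio k), Set.toFinset_Iio, Nat.card_Iio] at h2
      omega
    · intro hk
      have hsub : Set.Iic k ⊆ {k : ℕ | (a ∘ e) k ≤ x} := fun l hl => (hmono hl).trans hk
      have h2 := Set.ncard_le_ncard hsub hfin'
      rw [Set.ncard_eq_toFinset_card' (Set.Iic k), Set.toFinset_Iic, Nat.card_Iic] at h2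
      omega
  have hlim := tendsto_div_of_counting (fun k => ha0 (e k)) hNlt hdens
  have hfinal := (hlim.rpow_const (p := ρ) (Or.inr hρ.le)).const_mul L
  refine hfinal.congr fun k => ?_
  have h1 := hμ.eigenProd_pos hρ (e k)
  have h2 : (a (e k)) ^ ρ = L / eigenProd μ (e k) := by
    simp only [ha]
    rw [← Real.rpow_mul (by positivity), one_div_mul_cancel hρ.ne', Real.rpow_one]
  rw [Real.div_rpow (by positivity) (ha0 _).le, h2]
  field_simp

end LocalBounds

/-! ### Schatten classes of diagonal operators -/

/-- The singular values of a self-adjoint operator diagonalised with non-negative eigenvalues are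
these eigenvalues. -/
theorem HilbertBasis.isSingularValueSeq {H : Type} [NormedAddCommGroup H] [InnerProductSpace ℂ H]
    [CompleteSpace H] (b : HilbertBasis ℕ ℂ H) {T : H →L[ℂ] H} {μ : ℕ → ℝ} (hT : IsSelfAdjoint T)
    (hanti : Antitone μ) (hpos : ∀ n, 0 ≤ μ n) (hlim : Tendsto μ atTop (𝓝 0))
    (hb : ∀ n, T (b n) = (μ n : ℂ) • b n) : IsSingularValueSeq T μ := by
  refine ⟨hpos, ?_⟩
  rw [hT.adjoint_eq]
  refine b.isEigenvalueSeq (fun m n hmn => ?_) (fun n => sq_nonneg _) ?_ fun n => ?_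
  · have := hanti hmn
    have := hpos n
    gcongr
  · simpa using hlim.pow 2
  · rw [ContinuousLinearMap.comp_apply, hb, map_smul, hb, smul_smul, ← Complex.ofReal_mul, sq]

theorem IsSingularValueSeq.unique {H : Type} [NormedAddCommGroup H] [InnerProductSpace ℂ H]
    [CompleteSpace H] {T : H →L[ℂ] H} {s t : ℕ → ℝ} (hs : IsSingularValueSeq T s)
    (ht : IsSingularValueSeq T t) : s = t := by
  funext k
  exact (pow_left_inj₀ (hs.1 k) (ht.1 k) two_ne_zero).mp (congrFun (hs.2.unique ht.2) k)

theorem IsSingularValueSeq.inSchattenClass_iff {H : Type} [NormedAddCommGroup H]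
    [InnerProductSpace ℂ H] [CompleteSpace H] {T : H →L[ℂ] H} {s : ℕ → ℝ} {q : ℝ}
    (hs : IsSingularValueSeq T s) (hT : IsCompactOperator T) :
    InSchattenClass q T ↔ Summable fun k => s k ^ q := by
  constructor
  · rintro ⟨-, t, ht, hsum⟩
    rwa [hs.unique ht]
  · exact fun h => ⟨hT, s, hs, h⟩

theorem summable_rpow_iff_of_tendsto {a : ℕ → ℝ} {c ρ q : ℝ} (ha : ∀ n, 0 < a n) (hc : 0 < c)
    (h : Tendsto (fun n : ℕ => a n * ((n : ℝ) + 1) ^ ρ) atTop (𝓝 c)) :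
    (Summable fun n => a n ^ q) ↔ 1 < q * ρ := by
  have h1 : Tendsto (fun n : ℕ => a n ^ q / ((n : ℝ) + 1) ^ (-(q * ρ))) atTop (𝓝 (c ^ q)) := by
    refine (h.rpow_const (p := q) (Or.inl hc.ne')).congr fun n => ?_
    have hn : (0 : ℝ) < (n : ℝ) + 1 := by positivity
    rw [Real.mul_rpow (ha n).le (by positivity), ← Real.rpow_mul hn.le, Real.rpow_neg hn.le,
      div_inv_eq_mul, mul_comm ρ]
  have h2 : (fun n : ℕ => a n ^ q) =Θ[atTop] fun n : ℕ => ((n : ℝ) + 1) ^ (-(q * ρ)) := by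
    exact (isTheta_of_div_tendsto_nhds_ne_zero h1 (by positivity)).symm
  rw [h2.summable_iff_nat]
  have h3 := summable_nat_add_iff (f := fun n : ℕ => (n : ℝ) ^ (-(q * ρ))) 1
  push_cast at h3
  rw [h3, Real.summable_nat_rpow]
  constructor <;> intro h <;> linarith

/-! ### The Euler product -/

namespace LocalBounds

variable {ρ τ : ℝ} {μ : Nat.Primes → ℕ → ℝ}

/-- The terms of the series in the Euler factor, with the power of the first eigenvalue split off. -/
theorem rpow_eq (hμ : LocalBounds ρ τ μ) (p : Nat.Primes) (k : ℕ) :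
    μ p k ^ (1 / ρ) = μ p 0 ^ (1 / ρ) * (eigenWeight ρ μ p k / ((p : ℕ) : ℝ) ^ k) := by
  have hp : (0 : ℝ) < ((p : ℕ) : ℝ) := by exact_mod_cast p.2.pos
  have h0 := Real.rpow_pos_of_pos (hμ.pos p 0) (1 / ρ)
  rw [eigenWeight, Real.div_rpow (hμ.pos p k).le (hμ.pos p 0).le]
  field_simp

theorem summable_rpow (hμ : LocalBounds ρ τ μ) (hρ : 0 < ρ) (p : Nat.Primes) :
    Summable fun k => μ p k ^ (1 / ρ) :=
  ((hμ.summable_eigenWeight_div hρ p).mul_left _).congr fun k => (hμ.rpow_eq p k).symm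

theorem euler_factor_eq (hμ : LocalBounds ρ τ μ) (p : Nat.Primes) :
    (1 - 1 / ((p : ℕ) : ℝ)) * ∑' k, μ p k ^ (1 / ρ) =
      μ p 0 ^ (1 / ρ) * densityFactor (eigenWeight ρ μ) p := by
  rw [tsum_congr (hμ.rpow_eq p), tsum_mul_left, densityFactor]
  ring

theorem hasProd_euler_factor (hμ : LocalBounds ρ τ μ) (hρ : 0 < ρ) (hτ : 0 < τ) :
    HasProd (fun p : Nat.Primes => (1 - 1 / ((p : ℕ) : ℝ)) * ∑' k, μ p k ^ (1 / ρ))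
      ((∏' p, μ p 0) ^ (1 / ρ) * ∏' p, densityFactor (eigenWeight ρ μ) p) := by
  rw [funext hμ.euler_factor_eq]
  refine HasProd.mul ?_
    (multipliable_of_summable_sub_one (hμ.summable_abs_densityFactor hρ hτ)).hasProd
  have h1 := (multipliable_of_summable_sub_one hμ.summable_abs_zero).hasProd
  have h2 := Tendsto.rpow_const (p := 1 / ρ) h1 (Or.inr (by positivity))
  refine h2.congr fun s => ?_
  exact (Real.finsetProd_rpow s _ (fun p _ => (hμ.pos p 0).le) _).symm

end LocalBounds

/-! ### The local operators of `E(σ,τ)` -/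

/-- The simultaneous diagonalisation of the local operators: the parameters `p ^ σ` and `p ^ (-τ)`
give `w * s ^ 2 = p ^ (-ρ)`, and the first eigenvalue and eigenvector differ from `1` and `e 0` by
`O(p ^ (-(τ + ρ)))`. -/
theorem exists_localBounds {σ τ ρ : ℝ} (hρ : ρ = τ - 2 * σ) (hρ_pos : 0 < ρ) (hτρ : 1 < τ + ρ)
    (hτ_pos : 0 < τ) :
    ∃ (T : Nat.Primes → EllTwo ℕ →L[ℂ] EllTwo ℕ) (μ : Nat.Primes → ℕ → ℝ)
      (u : Nat.Primes → ℕ → ℕ → ℂ), LocalBounds ρ τ μ ∧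
      (∀ p : Nat.Primes, IsMatrixOperator (localMatrix σ τ p) (T p) ∧ IsCompactOperator (T p) ∧
        (T p).IsPositive ∧ IsEigenvalueSeq (T p) (μ p)) ∧
      (∀ p : Nat.Primes, IsEigenmatrix (maxMatrix (((p : ℕ) : ℝ) ^ σ) (((p : ℕ) : ℝ) ^ (-τ)))
        (μ p) (u p)) ∧
      (∀ p, Antitone (μ p)) ∧ Summable fun p => ‖u p 0 0 - 1‖ := by
  have hp0 : ∀ p : Nat.Primes, (0 : ℝ) < ((p : ℕ) : ℝ) := fun p => by exact_mod_cast p.2.pos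
  have hp2 : ∀ p : Nat.Primes, (2 : ℝ) ≤ ((p : ℕ) : ℝ) := fun p => by exact_mod_cast p.2.two_le
  have hr : ∀ p : Nat.Primes, ((p : ℕ) : ℝ) ^ (-τ) * (((p : ℕ) : ℝ) ^ σ) ^ 2 =
      ((p : ℕ) : ℝ) ^ (-ρ) := by
    intro p
    rw [← Real.rpow_natCast, ← Real.rpow_mul (hp0 p).le, ← Real.rpow_add (hp0 p), hρ]
    congr 1
    push_cast
    ring
  have hwr : ∀ p : Nat.Primes, ((p : ℕ) : ℝ) ^ (-τ) * ((p : ℕ) : ℝ) ^ (-ρ) =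
      ((p : ℕ) : ℝ) ^ (-(τ + ρ)) := by
    intro p
    rw [← Real.rpow_add (hp0 p)]
    congr 1
    ring
  have hlt : ∀ (p : Nat.Primes) (t : ℝ), 0 < t → ((p : ℕ) : ℝ) ^ (-t) < 1 := fun p t ht =>
    Real.rpow_lt_one_of_one_lt_of_neg (by linarith [hp2 p]) (by linarith)
  choose T μ u hT hcomp hTpos hev heig hanti hpos hone hle hsucc hμ1 hu using
    fun p : Nat.Primes => exists_local_data (s := ((p : ℕ) : ℝ) ^ σ) (w := ((p : ℕ) : ℝ) ^ (-τ))
      (Real.rpow_pos_of_pos (hp0 p) _) (Real.rpow_pos_of_pos (hp0 p) _) (hlt p τ hτ_pos)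
      (by rw [hr]; exact hlt p ρ hρ_pos)
  simp only [hr, hwr] at hle hsucc hμ1 hu
  -- the denominators of the local bounds are smallest at `p = 2`
  have hden : ∀ t : ℝ, 0 < t → (0 : ℝ) < 1 - 2 ^ (-t) ∧
      ∀ p : Nat.Primes, (1 : ℝ) - 2 ^ (-t) ≤ 1 - ((p : ℕ) : ℝ) ^ (-t) := by
    intro t ht
    refine ⟨sub_pos.mpr (Real.rpow_lt_one_of_one_lt_of_neg one_lt_two (by linarith)), fun p => ?_⟩
    have := Real.rpow_le_rpow_of_nonpos two_pos (hp2 p) (by linarith : -t ≤ 0)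
    linarith
  obtain ⟨hd0, hd⟩ := hden (τ + ρ) (by linarith)
  obtain ⟨hd0', hd'⟩ := hden ρ hρ_pos
  have hsum := summable_primes_rpow_neg hτρ
  refine ⟨T, μ, u, ⟨hpos, hone, hsucc, hμ1, ?_⟩, fun p => ⟨?_, hcomp p, hTpos p, hev p⟩, heig,
    hanti, ?_⟩
  · refine ((hsum.div_const (1 - 2 ^ (-(τ + ρ)))).div_const (1 - 2 ^ (-ρ))).of_nonneg_of_le
      (fun p => sub_nonneg.mpr (hone p)) fun p => ?_
    have h2 := hd p
    have h3 := hd' p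
    have h4 := Real.rpow_pos_of_pos (hp0 p) (-(τ + ρ))
    refine (sub_le_iff_le_add'.mpr (hle p)).trans ?_
    gcongr
  · rw [localMatrix_eq_maxMatrix]
    exact hT p
  · refine ((hsum.div_const (1 - 2 ^ (-(τ + ρ)))).div_const ((1 - 2 ^ (-ρ)) ^ 2)).of_nonneg_of_le
      (fun p => norm_nonneg _) fun p => ?_
    have h2 := hd p
    have h3 := hd' p
    have h4 := Real.rpow_pos_of_pos (hp0 p) (-(τ + ρ))
    refine (hu p).trans ?_
    gcongr

/-! ### Eigenvalue asymptotics of `E(σ,τ)` -/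

/-- The conjuncts say, in this order: the matrix `E(σ,τ)` defines an everywhere defined bounded
operator on `ℓ²(ℕ)`, which is compact, positive definite and has a trivial kernel; everything that
enters the definition of `ϰ(σ,τ)` exists and converges; `ϰ(σ,τ) > 0`; the eigenvalues of `E(σ,τ)` can
be listed in non-increasing order with multiplicities; their asymptotics (the list starts with index
`0`, so that `λ_n` is the entry with index `n - 1`); and the Schatten class inclusions. -/
theorem theorem1 (σ τ ρ : ℝ) (hρ : ρ = τ - 2 * σ) (hρ_pos : 0 < ρ) (hτρ : 1 < τ + ρ)
    (hτ_pos : 0 < τ) :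
    IsMatrixOperator (lcmMatrix σ τ) (lcmOperator σ τ) ∧
    IsCompactOperator (lcmOperator σ τ) ∧
    (lcmOperator σ τ).IsPositive ∧
    (∀ x : EllTwo ℕ+, x ≠ 0 → 0 < (inner ℂ (lcmOperator σ τ x) x).re) ∧
    (∀ x : EllTwo ℕ+, lcmOperator σ τ x = 0 → x = 0) ∧
    (∀ p : Nat.Primes,
      IsMatrixOperator (localMatrix σ τ p) (localOperator σ τ p) ∧
      IsCompactOperator (localOperator σ τ p) ∧
      (localOperator σ τ p).IsPositive ∧
      IsEigenvalueSeq (localOperator σ τ p) (eigenvalueSeq (localOperator σ τ p)) ∧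
      Summable fun k : ℕ => eigenvalueSeq (localOperator σ τ p) k ^ (1 / ρ)) ∧
    (Multipliable fun p : Nat.Primes => kappaFactor σ τ p) ∧
    0 < kappa σ τ ∧
    IsEigenvalueSeq (lcmOperator σ τ) (eigenvalueSeq (lcmOperator σ τ)) ∧
    ((fun n : ℕ => eigenvalueSeq (lcmOperator σ τ) n - kappa σ τ / ((n : ℝ) + 1) ^ ρ)
      =o[atTop] fun n : ℕ => ((n : ℝ) + 1) ^ (-ρ)) ∧
    (∀ q : ℝ, 0 < q → (InSchattenClass q (lcmOperator σ τ) ↔ 1 < q * ρ)) := by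
  obtain ⟨T, μ, u, hμ, hT, heig, hanti, hu⟩ := exists_localBounds hρ hρ_pos hτρ hτ_pos
  have hloc : ∀ p : Nat.Primes, localOperator σ τ p = T p := fun p => matrixOperator_spec (hT p).1
  have hev : ∀ p : Nat.Primes, eigenvalueSeq (T p) = μ p := fun p => (hT p).2.2.2.eigenvalueSeq_eq
  obtain ⟨E, hE, hEcomp, hEpos, b, hb⟩ := exists_tensor_operator primeExponents heig hu
    hμ.summable_abs_zero hanti hμ.pos (fun p => by simp [maxMatrix]) (hμ.tendsto_eigenProd hρ_pos)
  change ∀ n, E (b n) = ((eigenProd μ n : ℝ) : ℂ) • b n at hb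
  simp only [tprod_maxMatrix_eq_lcmMatrix] at hE
  have hlcm : lcmOperator σ τ = E := matrixOperator_spec hE
  obtain ⟨e, he⟩ := exists_equiv_nat_antitone (hμ.eigenProd_pos hρ_pos)
    (hμ.tendsto_eigenProd hρ_pos)
  obtain ⟨c, hc⟩ := b.exists_reindex e
  have hcE : ∀ k, E (c k) = (((eigenProd μ ∘ e) k : ℝ) : ℂ) • c k := fun k => by
    rw [hc, hb, Function.comp_apply]
  have hpos : ∀ k, 0 < (eigenProd μ ∘ e) k := fun k => hμ.eigenProd_pos hρ_pos (e k)
  have hlim : Tendsto (eigenProd μ ∘ e) atTop (𝓝 0) := by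
    rw [← Nat.cofinite_eq_atTop]
    exact (hμ.tendsto_eigenProd hρ_pos).comp e.injective.tendsto_cofinite
  have hEev := c.isEigenvalueSeq he (fun k => (hpos k).le) hlim hcE
  have hfac : ∀ p : Nat.Primes, kappaFactor σ τ p =
      (1 - 1 / ((p : ℕ) : ℝ)) * ∑' k, μ p k ^ (1 / ρ) := fun p => by
    rw [kappaFactor, hloc, hev, hρ]
  have hprod := hμ.hasProd_euler_factor hρ_pos hτ_pos
  simp only [← hfac] at hprod
  have h0 := LocalBounds.tprod_pos_of_summable_sub_one (fun p => hμ.pos p 0) hμ.summable_abs_zero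
  have hC := LocalBounds.tprod_pos_of_summable_sub_one (fun p => hμ.densityFactor_pos hρ_pos p)
    (hμ.summable_abs_densityFactor hρ_pos hτ_pos)
  have hkappa : kappa σ τ =
      (∏' p, μ p 0) * (∏' p, densityFactor (eigenWeight ρ μ) p) ^ ρ := by
    rw [kappa, hprod.tprod_eq, ← hρ, Real.mul_rpow (by positivity) hC.le, ← Real.rpow_mul h0.le,
      one_div_mul_cancel hρ_pos.ne', Real.rpow_one]
  have hkpos : 0 < kappa σ τ := by
    rw [hkappa]
    positivity
  have hasymp := hμ.tendsto_eigenProd_mul_rpow hρ_pos hτ_pos he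
  rw [← hkappa] at hasymp
  have hposdef : ∀ x : EllTwo ℕ+, x ≠ 0 → 0 < (inner ℂ (E x) x).re := fun x hx =>
    b.inner_apply_self_pos (hμ.eigenProd_pos hρ_pos) hb hx
  rw [hlcm, hEev.eigenvalueSeq_eq]
  refine ⟨hE, hEcomp, hEpos, hposdef, fun x hx => ?_, fun p => ?_, hprod.multipliable, hkpos, hEev,
    ?_, fun q _ => ?_⟩
  · by_contra h
    have := hposdef x h
    simp [hx] at this
  · rw [hloc, hev]
    exact ⟨(hT p).1, (hT p).2.1, (hT p).2.2.1, (hT p).2.2.2, hμ.summable_rpow hρ_pos p⟩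
  · rw [isLittleO_iff_tendsto' (Eventually.of_forall fun n h =>
      absurd h (Real.rpow_pos_of_pos (by positivity) _).ne')]
    refine (by simpa using hasymp.sub_const (kappa σ τ) :
      Tendsto _ atTop (𝓝 (0 : ℝ))).congr fun n => ?_
    have hn : (0 : ℝ) < (n : ℝ) + 1 := by positivity
    have hn' := Real.rpow_pos_of_pos hn ρ
    rw [Real.rpow_neg hn.le, Function.comp_apply]
    field_simp
  · rw [(c.isSingularValueSeq hEpos.isSelfAdjoint he (fun k => (hpos k).le) hlim
      hcE).inSchattenClass_iff hEcomp]
    exact summable_rpow_iff_of_tendsto hpos hkpos hasymp
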